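/- Let $G$ be a second-countable, locally compact group and let $\alpha\colon G\curvearrowright A$ be a (point-norm continuous) action by $*$-automorphisms on a $\sigma$-unital C*-algebra $A$. Let $\mathcal M(A)$ be the multiplier algebra of $A$ and $\mathcal Q(A)=\mathcal M(A)/A$ its corona algebra. Equip $\mathcal M(A)$ with the algebraic (i.e. not necessarily continuous) action determined by $\alpha_g(x)\cdot a=\alpha_g(x\cdot\alpha_g^{-1}(a))$ for $g\in G$, $x\in\mathcal M(A)$, $a\in A$, and $\mathcal Q(A)$ with the induced quotient action, again denoted $\alpha$. Then $(\mathcal Q(A),\alpha)$ has the dynamical folding property. Here the following notation is used. For a C*-algebra $E$, let $E_{\mathfrak c}=\mathcal C_b([0,\infty),E)/\mathcal C_0([0,\infty),E)$, and regard $E\subseteq E_{\mathfrak c}$ as the classes of constant paths. For an algebraic action $\beta\colon G\curvearrowright E$, let $\beta_{\mathfrak c}$ be the algebraic action on $E_{\mathfrak c}$ induced by $(g,f)\mapsto\beta_g\circ f$, let $E_\beta=\{x\in E : g\mapsto\beta_g(x)\text{ is norm-continuous}\}$, and regard $(E_\beta)_{\mathfrak c}\subseteq E_{\mathfrak c}$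 as the classes of bounded continuous paths with values in $E_\beta$. One says that $(E,\beta)$ has the dynamical folding property if the following holds. Let $B$ be a separable C*-algebra, let $B_0,D\subseteq B$ be C*-subalgebras, and let $\delta\colon G\curvearrowright D$ be a point-norm continuous action. Let $\psi\colon B\to E_{\mathfrak c}$ be a $*$-homomorphism such that $\psi(B_0)\subseteq E$, $\psi\circ\delta_g=\beta_{\mathfrak c,g}\circ\psi$ on $D$ for all $g\in G$, and $\psi(D)\subseteq (E_\beta)_{\mathfrak c}$. Then there is a $*$-homomorphism $\varphi\colon B\to E$ such that $\varphi|_{B_0}=\psi|_{B_0}$, $\varphi\circ\delta_g=\beta_g\circ\varphi$ on $D$ for all $g\in G$, and $\ker\varphi=\ker\psi$. -/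

import Mathlib

open Filter Topology
open scoped NNReal BoundedContinuousFunction MultiplierAlgebra

universe u v w

noncomputable section

namespace DynFolding

/-! ### Quotients of C*-algebras -/

/-- A closed, self-adjoint two-sided ideal of a C*-algebra. (Self-adjointness is automatic; it is
recorded here for convenience.) -/
structure CStarIdeal (A : Type u) [NonUnitalCStarAlgebra A] extends
    NonUnitalStarSubalgebra ℂ A where
  mul_left_mem' : ∀ (a : A) {x : A}, x ∈ carrier → a * x ∈ carrier
  mul_right_mem' : ∀ (a : A) {x : A}, x ∈ carrier → x * a ∈ carrier
  isClosed' : IsClosed carrier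

namespace CStarIdeal

variable {A : Type u} [NonUnitalCStarAlgebra A] (I : CStarIdeal A)

/-- The ideal as a linear subspace. -/
abbrev toSubspace : Submodule ℂ A := I.toNonUnitalStarSubalgebra.toNonUnitalSubalgebra.toSubmodule

instance isClosed_toSubspace : IsClosed (I.toSubspace : Set A) := I.isClosed'

instance isClosed_toSubalgebra : IsClosed (I.toNonUnitalStarSubalgebra : Set A) := I.isClosed'

theorem mul_left_mem (a : A) {x : A} (hx : x ∈ I.toSubspace) : a * x ∈ I.toSubspace :=
  I.mul_left_mem' a hx

theorem mul_right_mem (a : A) {x : A} (hx : x ∈ I.toSubspace) : x * a ∈ I.toSubspace :=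
  I.mul_right_mem' a hx

theorem star_mem {x : A} (hx : x ∈ I.toSubspace) : star x ∈ I.toSubspace :=
  I.star_mem' hx

/-- The quotient `A / I` of a C*-algebra by a closed two-sided ideal. -/
def Quotient : Type u := A ⧸ I.toSubspace

namespace Quotient

instance : NormedAddCommGroup I.Quotient :=
  inferInstanceAs (NormedAddCommGroup (A ⧸ I.toSubspace))

instance : NormedSpace ℂ I.Quotient :=
  inferInstanceAs (NormedSpace ℂ (A ⧸ I.toSubspace))

instance : CompleteSpace I.Quotient :=
  inferInstanceAs (CompleteSpace (A ⧸ I.toSubspace))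

variable {I} in
/-- The class of an element of `A` in the quotient `A / I`. -/
def mk (a : A) : I.Quotient := Submodule.Quotient.mk a

theorem mk_surjective : Function.Surjective (mk : A → I.Quotient) :=
  Submodule.Quotient.mk_surjective _

variable {I}

theorem mk_eq_mk {a b : A} : (mk a : I.Quotient) = mk b ↔ a - b ∈ I.toSubspace :=
  Submodule.Quotient.eq _

theorem mk_eq_zero {a : A} : (mk a : I.Quotient) = 0 ↔ a ∈ I.toSubspace :=
  Submodule.Quotient.mk_eq_zero _

theorem norm_mk_le (a : A) : ‖(mk a : I.Quotient)‖ ≤ ‖a‖ :=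
  Submodule.Quotient.norm_mk_le _ a

theorem exists_norm_lt (x : I.Quotient) {ε : ℝ} (hε : 0 < ε) : ∃ a : A, mk a = x ∧ ‖a‖ < ‖x‖ + ε :=
  Submodule.Quotient.norm_mk_lt x hε

instance : Mul I.Quotient where
  mul := Quotient.map₂ (· * ·) (by
    intro a a' ha b b' hb
    have ha' : a - a' ∈ I.toSubspace := (Submodule.quotientRel_def _).1 ha
    have hb' : b - b' ∈ I.toSubspace := (Submodule.quotientRel_def _).1 hb
    refine (Submodule.quotientRel_def _).2 ?_
    have h : a * b - a' * b' = (a - a') * b + a' * (b - b') := by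
      rw [sub_mul, mul_sub]; abel
    rw [h]
    exact add_mem (I.mul_right_mem _ ha') (I.mul_left_mem _ hb'))

instance : Star I.Quotient where
  star := Quotient.map star (by
    intro a a' ha
    have ha' : a - a' ∈ I.toSubspace := (Submodule.quotientRel_def _).1 ha
    refine (Submodule.quotientRel_def _).2 ?_
    rw [← star_sub]
    exact I.star_mem ha')

theorem mk_add (a b : A) : (mk (a + b) : I.Quotient) = mk a + mk b := rfl
theorem mk_zero : (mk 0 : I.Quotient) = 0 := rfl
theorem mk_smul (c : ℂ) (a : A) : (mk (c • a) : I.Quotient) = c • mk a := rfl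
theorem mk_mul (a b : A) : (mk (a * b) : I.Quotient) = mk a * mk b := rfl
theorem mk_star (a : A) : (mk (star a) : I.Quotient) = star (mk a) := rfl

theorem norm_mul_le' (x y : I.Quotient) : ‖x * y‖ ≤ ‖x‖ * ‖y‖ := by
  have h : Tendsto (fun ε : ℝ => (‖x‖ + ε) * (‖y‖ + ε)) (𝓝[>] 0) (𝓝 (‖x‖ * ‖y‖)) := by
    have : Continuous (fun ε : ℝ => (‖x‖ + ε) * (‖y‖ + ε)) := by fun_prop
    have h0 := this.tendsto 0
    simp only [add_zero] at h0
    exact h0.mono_left nhdsWithin_le_nhds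
  refine ge_of_tendsto h ?_
  filter_upwards [self_mem_nhdsWithin] with ε hε
  obtain ⟨a, rfl, ha⟩ := exists_norm_lt x hε
  obtain ⟨b, rfl, hb⟩ := exists_norm_lt y hε
  rw [← mk_mul]
  exact (norm_mk_le _).trans ((norm_mul_le a b).trans
    (mul_le_mul ha.le hb.le (norm_nonneg _) ((norm_nonneg _).trans ha.le)))

instance : NonUnitalNormedRing I.Quotient where
  __ := (inferInstance : NormedAddCommGroup I.Quotient)
  __ := (inferInstance : Mul I.Quotient)
  left_distrib x y z := by
    obtain ⟨a, rfl⟩ := mk_surjective I x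
    obtain ⟨b, rfl⟩ := mk_surjective I y
    obtain ⟨c, rfl⟩ := mk_surjective I z
    exact congrArg mk (mul_add a b c)
  right_distrib x y z := by
    obtain ⟨a, rfl⟩ := mk_surjective I x
    obtain ⟨b, rfl⟩ := mk_surjective I y
    obtain ⟨c, rfl⟩ := mk_surjective I z
    exact congrArg mk (add_mul a b c)
  zero_mul x := by
    obtain ⟨a, rfl⟩ := mk_surjective I x
    exact congrArg mk (zero_mul a)
  mul_zero x := by
    obtain ⟨a, rfl⟩ := mk_surjective I x
    exact congrArg mk (mul_zero a)
  mul_assoc x y z := by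
    obtain ⟨a, rfl⟩ := mk_surjective I x
    obtain ⟨b, rfl⟩ := mk_surjective I y
    obtain ⟨c, rfl⟩ := mk_surjective I z
    exact congrArg mk (mul_assoc a b c)
  norm_mul_le := norm_mul_le'

instance : StarRing I.Quotient where
  star_involutive x := by
    obtain ⟨a, rfl⟩ := mk_surjective I x
    exact congrArg mk (star_star a)
  star_mul x y := by
    obtain ⟨a, rfl⟩ := mk_surjective I x
    obtain ⟨b, rfl⟩ := mk_surjective I y
    exact congrArg mk (star_mul a b)
  star_add x y := by
    obtain ⟨a, rfl⟩ := mk_surjective I x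
    obtain ⟨b, rfl⟩ := mk_surjective I y
    exact congrArg mk (star_add a b)

instance : IsScalarTower ℂ I.Quotient I.Quotient where
  smul_assoc c x y := by
    obtain ⟨a, rfl⟩ := mk_surjective I x
    obtain ⟨b, rfl⟩ := mk_surjective I y
    exact congrArg mk (smul_mul_assoc c a b)

instance : SMulCommClass ℂ I.Quotient I.Quotient where
  smul_comm c x y := by
    obtain ⟨a, rfl⟩ := mk_surjective I x
    obtain ⟨b, rfl⟩ := mk_surjective I y
    exact congrArg mk (mul_smul_comm c a b).symm

instance : StarModule ℂ I.Quotient where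
  star_smul c x := by
    obtain ⟨a, rfl⟩ := mk_surjective I x
    exact congrArg mk (star_smul c a)

/-- The inequality behind the C*-identity: `‖[x]‖²` is bounded by the norm of any representative
`x* x + j` of `[x]* [x]`. -/
theorem norm_sq_le (x j : A) (hj : j ∈ I.toSubspace) :
    ‖(mk x : I.Quotient)‖ * ‖(mk x : I.Quotient)‖ ≤ ‖star x * x + j‖ := by
  let S := I.toNonUnitalStarSubalgebra
  let _ : PartialOrder S := CStarAlgebra.spectralOrder S
  have _ : StarOrderedRing S := CStarAlgebra.spectralOrderedRing S
  let _ : PartialOrder (Unitization ℂ A) := CStarAlgebra.spectralOrder _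
  have _ : StarOrderedRing (Unitization ℂ A) := CStarAlgebra.spectralOrderedRing _
  have hau := CStarAlgebra.increasingApproximateUnit S
  have hne : (CStarAlgebra.approximateUnit S).NeBot := hau.neBot
  let js : S := ⟨j, hj⟩
  have hlim : Tendsto (fun e : S => ‖star x * x + j‖ + ‖j - (e : A) * j‖)
      (CStarAlgebra.approximateUnit S) (𝓝 (‖star x * x + j‖)) := by
    have h1 : Tendsto (fun e : S => e * js) (CStarAlgebra.approximateUnit S) (𝓝 js) :=
      hau.tendsto_mul_right js
    have h2 : Tendsto (fun e : S => (e : A) * j) (CStarAlgebra.approximateUnit S) (𝓝 j) :=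
      (continuous_subtype_val.tendsto js).comp h1
    have h3 := (tendsto_const_nhds (x := j)).sub h2
    have h4 := h3.norm
    simp only [sub_self, norm_zero] at h4
    simpa using (tendsto_const_nhds (x := ‖star x * x + j‖)).add h4
  refine ge_of_tendsto hlim ?_
  filter_upwards [hau.eventually_nonneg, hau.eventually_norm] with e he0 he1
  let φ : S →⋆ₙₐ[ℂ] Unitization ℂ A :=
    (Unitization.inrNonUnitalStarAlgHom ℂ A).comp (NonUnitalStarSubalgebraClass.subtype S)
  have hφ : φ e = ((e : A) : Unitization ℂ A) := rfl
  have hE0 : 0 ≤ φ e := map_nonneg φ he0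
  have hEn : ‖φ e‖ ≤ 1 := by
    rw [hφ, Unitization.norm_inr]; exact he1
  have hE1 : φ e ≤ 1 := by
    have := CStarAlgebra.mem_Icc_iff_norm_le_one.mpr ⟨hE0, hEn⟩
    exact this.2
  have hF : ‖1 - φ e‖ ≤ 1 := by
    have := CStarAlgebra.mem_Icc_iff_norm_le_one.mp
      (⟨sub_nonneg.2 hE1, sub_le_self _ hE0⟩ : (1 - φ e) ∈ Set.Icc 0 1)
    exact this.2
  have hFs : star (1 - φ e) = 1 - φ e := by
    rw [star_sub, star_one, (IsSelfAdjoint.of_nonneg hE0).star_eq]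
  have hx : ‖(mk x : I.Quotient)‖ ≤ ‖x - x * (e : A)‖ := by
    have : (mk x : I.Quotient) = mk (x - x * (e : A)) := by
      rw [mk_eq_mk]
      have : x - (x - x * (e : A)) = x * (e : A) := by abel
      rw [this]
      exact I.mul_left_mem _ e.2
    rw [this]
    exact norm_mk_le _
  have hn : ‖x - x * (e : A)‖ = ‖(x : Unitization ℂ A) * (1 - φ e)‖ := by
    rw [← Unitization.norm_inr (𝕜 := ℂ), Unitization.inr_sub, Unitization.inr_mul, mul_sub,
      mul_one, hφ]
  calc ‖(mk x : I.Quotient)‖ * ‖(mk x : I.Quotient)‖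
      ≤ ‖(x : Unitization ℂ A) * (1 - φ e)‖ * ‖(x : Unitization ℂ A) * (1 - φ e)‖ := by
        rw [← hn]; exact mul_self_le_mul_self (norm_nonneg _) hx
    _ = ‖(1 - φ e) * ((star x * x : A) : Unitization ℂ A) * (1 - φ e)‖ := by
        rw [← CStarRing.norm_star_mul_self, star_mul, hFs, Unitization.inr_mul,
          Unitization.inr_star]
        simp only [mul_assoc]
    _ = ‖(1 - φ e) * ((star x * x + j : A) : Unitization ℂ A) * (1 - φ e)
          - ((j - (e : A) * j : A) : Unitization ℂ A) * (1 - φ e)‖ := by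
        congr 1
        rw [Unitization.inr_add, Unitization.inr_sub, Unitization.inr_mul ℂ (e : A) j, hφ]
        noncomm_ring
    _ ≤ ‖(1 - φ e) * ((star x * x + j : A) : Unitization ℂ A) * (1 - φ e)‖
          + ‖((j - (e : A) * j : A) : Unitization ℂ A) * (1 - φ e)‖ := norm_sub_le _ _
    _ ≤ ‖star x * x + j‖ + ‖j - (e : A) * j‖ := by
        refine add_le_add ?_ ?_
        · refine (norm_mul_le _ _).trans ?_
          refine (mul_le_of_le_one_right (norm_nonneg _) hF).trans ?_
          refine (norm_mul_le _ _).trans ?_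
          refine (mul_le_of_le_one_left (norm_nonneg _) hF).trans ?_
          rw [Unitization.norm_inr]
        · refine (norm_mul_le _ _).trans ?_
          refine (mul_le_of_le_one_right (norm_nonneg _) hF).trans ?_
          rw [Unitization.norm_inr]

instance : CStarRing I.Quotient where
  norm_mul_self_le x := by
    obtain ⟨a, rfl⟩ := mk_surjective I x
    refine le_of_forall_pos_le_add fun ε hε => ?_
    obtain ⟨b, hb, hbn⟩ := exists_norm_lt (star (mk a : I.Quotient) * mk a) hε
    refine le_trans ?_ hbn.le
    have hmem : b - star a * a ∈ I.toSubspace := by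
      rw [← mk_eq_mk, hb]; rfl
    have := norm_sq_le (I := I) a _ hmem
    simpa using this

instance instNonUnitalCStarAlgebra : NonUnitalCStarAlgebra I.Quotient where

end Quotient

/-- The quotient map `A → A / I`. -/
def mkHom : A →⋆ₙₐ[ℂ] I.Quotient where
  toFun := Quotient.mk
  map_smul' _ _ := rfl
  map_zero' := rfl
  map_add' _ _ := rfl
  map_mul' _ _ := rfl
  map_star' _ := rfl

/-- The *-homomorphism `A / I → A / I` induced by an endomorphism of `A` mapping `I` to itself. -/
def mapHom (σ : A →⋆ₙₐ[ℂ] A) (h : ∀ x ∈ I.toSubspace, σ x ∈ I.toSubspace) :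
    I.Quotient →⋆ₙₐ[ℂ] I.Quotient where
  toFun := _root_.Quotient.map σ (by
    intro a b hab
    have h' : a - b ∈ I.toSubspace := (Submodule.quotientRel_def _).1 hab
    refine (Submodule.quotientRel_def _).2 ?_
    rw [← map_sub]
    exact h _ h')
  map_smul' c x := by
    obtain ⟨a, rfl⟩ := Quotient.mk_surjective I x
    exact congrArg Quotient.mk (map_smul σ c a)
  map_zero' := congrArg Quotient.mk (map_zero σ)
  map_add' x y := by
    obtain ⟨a, rfl⟩ := Quotient.mk_surjective I x
    obtain ⟨b, rfl⟩ := Quotient.mk_surjective I y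
    exact congrArg Quotient.mk (map_add σ a b)
  map_mul' x y := by
    obtain ⟨a, rfl⟩ := Quotient.mk_surjective I x
    obtain ⟨b, rfl⟩ := Quotient.mk_surjective I y
    exact congrArg Quotient.mk (map_mul σ a b)
  map_star' x := by
    obtain ⟨a, rfl⟩ := Quotient.mk_surjective I x
    exact congrArg Quotient.mk (map_star σ a)

theorem mapHom_mk (σ : A →⋆ₙₐ[ℂ] A) (h : ∀ x ∈ I.toSubspace, σ x ∈ I.toSubspace) (a : A) :
    I.mapHom σ h (Quotient.mk a) = Quotient.mk (σ a) := rfl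

end CStarIdeal

/-! ### Algebraic actions -/

/-- An algebraic action of `G` on a C*-algebra `A`: a homomorphism from `G` to the group of
*-automorphisms of `A`, without any continuity requirement. -/
abbrev AlgAction (G : Type v) [Group G] (A : Type u) [NonUnitalCStarAlgebra A] : Type (max u v) :=
  G →* (A ≃⋆ₐ[ℂ] A)

section Actions

variable {G : Type v} [Group G] {A : Type u} [NonUnitalCStarAlgebra A]

/-- An algebraic action from a family of *-endomorphisms respecting the group law. -/
def AlgAction.ofHoms (f : G → (A →⋆ₙₐ[ℂ] A)) (h1 : ∀ a, f 1 a = a)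
    (hmul : ∀ g h a, f (g * h) a = f g (f h a)) : AlgAction G A where
  toFun g := StarAlgEquiv.ofNonUnitalStarAlgHom (f g) (f g⁻¹)
    (by ext a; change f g⁻¹ (f g a) = a; rw [← hmul, inv_mul_cancel, h1])
    (by ext a; change f g (f g⁻¹ a) = a; rw [← hmul, mul_inv_cancel, h1])
  map_one' := by ext a; exact h1 a
  map_mul' g h := by ext a; exact hmul g h a

theorem AlgAction.ofHoms_apply (f : G → (A →⋆ₙₐ[ℂ] A)) (h1 : ∀ a, f 1 a = a)
    (hmul : ∀ g h a, f (g * h) a = f g (f h a)) (g : G) (a : A) :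
    AlgAction.ofHoms f h1 hmul g a = f g a := rfl

/-- The action on `A / I` induced by an action on `A` leaving `I` invariant. -/
def AlgAction.quotient (α : AlgAction G A) (I : CStarIdeal A)
    (h : ∀ g, ∀ x ∈ I.toSubspace, α g x ∈ I.toSubspace) : AlgAction G I.Quotient :=
  AlgAction.ofHoms (fun g => I.mapHom (α g : A →⋆ₙₐ[ℂ] A) (h g))
    (by
      intro x
      obtain ⟨a, rfl⟩ := CStarIdeal.Quotient.mk_surjective I x
      change CStarIdeal.Quotient.mk (α 1 a) = _
      rw [map_one]; rfl)
    (by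
      intro g k x
      obtain ⟨a, rfl⟩ := CStarIdeal.Quotient.mk_surjective I x
      change CStarIdeal.Quotient.mk (α (g * k) a) = CStarIdeal.Quotient.mk (α g (α k a))
      rw [map_mul]; rfl)

theorem AlgAction.quotient_mk (α : AlgAction G A) (I : CStarIdeal A)
    (h : ∀ g, ∀ x ∈ I.toSubspace, α g x ∈ I.toSubspace) (g : G) (a : A) :
    α.quotient I h g (CStarIdeal.Quotient.mk a) = CStarIdeal.Quotient.mk (α g a) := rfl

variable [TopologicalSpace G]

/-- A (point-norm) continuous action. -/
def AlgAction.IsContinuous (α : AlgAction G A) : Prop :=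
  ∀ a : A, Continuous fun g : G => α g a

/-- The continuous part `A_α` of an algebraic action: the C*-subalgebra of all `a` for which
`g ↦ α_g(a)` is norm-continuous. -/
def AlgAction.continuousPart (α : AlgAction G A) : NonUnitalStarSubalgebra ℂ A where
  carrier := {a | Continuous fun g : G => α g a}
  add_mem' {a b} ha hb := by
    have ha' : Continuous fun g : G => α g a := ha
    have hb' : Continuous fun g : G => α g b := hb
    have h : Continuous fun g : G => α g a + α g b := ha'.add hb'
    exact h.congr fun g => (map_add (α g) a b).symm
  zero_mem' := (continuous_const (y := (0 : A))).congr fun g => (map_zero (α g)).symm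
  mul_mem' {a b} ha hb := by
    have ha' : Continuous fun g : G => α g a := ha
    have hb' : Continuous fun g : G => α g b := hb
    have h : Continuous fun g : G => α g a * α g b := ha'.mul hb'
    exact h.congr fun g => (map_mul (α g) a b).symm
  smul_mem' c a ha := by
    have ha' : Continuous fun g : G => α g a := ha
    have h : Continuous fun g : G => c • α g a := ha'.const_smul c
    exact h.congr fun g => (map_smul (α g) c a).symm
  star_mem' {a} ha := by
    have ha' : Continuous fun g : G => α g a := ha
    have h : Continuous fun g : G => star (α g a) := ha'.star
    exact h.congr fun g => (map_star (α g) a).symm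

theorem AlgAction.mem_continuousPart {α : AlgAction G A} {a : A} :
    a ∈ α.continuousPart ↔ Continuous fun g : G => α g a := Iff.rfl

end Actions

/-! ### The path algebra -/

section Path

variable (A : Type u) [NonUnitalCStarAlgebra A]

/-- The ideal `C₀([0,∞), A)` of paths vanishing at infinity in `C_b([0,∞), A)`. -/
def vanishingPaths : CStarIdeal (ℝ≥0 →ᵇ A) where
  carrier := {f | Tendsto f atTop (𝓝 0)}
  add_mem' {f g} hf hg := by
    have hf' : Tendsto f atTop (𝓝 0) := hf
    have hg' : Tendsto g atTop (𝓝 0) := hg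
    have h := hf'.add hg'
    rw [add_zero] at h
    exact h
  zero_mem' := tendsto_const_nhds
  mul_mem' {f g} hf hg := by
    have hf' : Tendsto f atTop (𝓝 0) := hf
    have hg' : Tendsto g atTop (𝓝 0) := hg
    have h := hf'.mul hg'
    rw [mul_zero] at h
    exact h
  smul_mem' c f hf := by
    have hf' : Tendsto f atTop (𝓝 0) := hf
    have h := hf'.const_smul c
    rw [smul_zero] at h
    exact h
  star_mem' {f} hf := by
    have hf' : Tendsto f atTop (𝓝 0) := hf
    have h := hf'.star
    rw [star_zero] at h
    exact h
  mul_left_mem' f g hg := by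
    have hg' : Tendsto g atTop (𝓝 0) := hg
    change Tendsto (fun t => f t * g t) atTop (𝓝 0)
    refine squeeze_zero_norm (a := fun t => ‖f‖ * ‖g t‖) (fun t => ?_) ?_
    · exact (norm_mul_le _ _).trans
        (mul_le_mul_of_nonneg_right (f.norm_coe_le_norm t) (norm_nonneg _))
    · simpa using hg'.norm.const_mul ‖f‖
  mul_right_mem' f g hg := by
    have hg' : Tendsto g atTop (𝓝 0) := hg
    change Tendsto (fun t => g t * f t) atTop (𝓝 0)
    refine squeeze_zero_norm (a := fun t => ‖g t‖ * ‖f‖) (fun t => ?_) ?_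
    · exact (norm_mul_le _ _).trans
        (mul_le_mul_of_nonneg_left (f.norm_coe_le_norm t) (norm_nonneg _))
    · simpa using hg'.norm.mul_const ‖f‖
  isClosed' := by
    refine isClosed_of_closure_subset fun f hf => ?_
    change Tendsto f atTop (𝓝 0)
    rw [Metric.tendsto_nhds]
    intro ε hε
    obtain ⟨g, hg, hfg⟩ := Metric.mem_closure_iff.1 hf (ε / 2) (half_pos hε)
    have hg' : Tendsto g atTop (𝓝 0) := hg
    filter_upwards [Metric.tendsto_nhds.1 hg' (ε / 2) (half_pos hε)] with t ht
    calc dist (f t) 0 ≤ dist (f t) (g t) + dist (g t) 0 := dist_triangle _ _ _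
      _ < ε / 2 + ε / 2 :=
        add_lt_add ((BoundedContinuousFunction.dist_coe_le_dist t).trans_lt hfg) ht
      _ = ε := add_halves ε

/-- The path algebra `A_𝔠 = C_b([0,∞), A) / C₀([0,∞), A)`. -/
abbrev PathAlgebra : Type u := (vanishingPaths A).Quotient

variable {A}

/-- The quotient map `π_𝔠 : C_b([0,∞), A) → A_𝔠`. -/
def pathMk : (ℝ≥0 →ᵇ A) →⋆ₙₐ[ℂ] PathAlgebra A := (vanishingPaths A).mkHom

/-- The embedding `ι_𝔠 : A → A_𝔠` as (classes of) constant paths. -/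
def pathConst : A →⋆ₙₐ[ℂ] PathAlgebra A where
  toFun a := pathMk (BoundedContinuousFunction.const ℝ≥0 a)
  map_smul' _ _ := rfl
  map_zero' := rfl
  map_add' _ _ := rfl
  map_mul' _ _ := rfl
  map_star' _ := rfl

/-- For a C*-subalgebra `S ⊆ A`, the path algebra `S_𝔠` as a subalgebra of `A_𝔠`: the image under
`π_𝔠` of the bounded continuous paths with values in `S`. -/
def pathSubalgebra (S : NonUnitalStarSubalgebra ℂ A) :
    NonUnitalStarSubalgebra ℂ (PathAlgebra A) :=
  NonUnitalStarSubalgebra.map pathMk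
    { carrier := {f : ℝ≥0 →ᵇ A | ∀ t, f t ∈ S}
      add_mem' := fun hf hg t => add_mem (hf t) (hg t)
      zero_mem' := fun _ => zero_mem S
      mul_mem' := fun hf hg t => mul_mem (hf t) (hg t)
      smul_mem' := fun c _ hf t => SMulMemClass.smul_mem c (hf t)
      star_mem' := fun hf t => star_mem (hf t) }

theorem mem_pathSubalgebra {S : NonUnitalStarSubalgebra ℂ A} {x : PathAlgebra A} :
    x ∈ pathSubalgebra S ↔ ∃ f : ℝ≥0 →ᵇ A, (∀ t, f t ∈ S) ∧ pathMk f = x := Iff.rfl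

variable {G : Type v} [Group G]

/-- Pointwise application of a *-endomorphism to bounded continuous paths. -/
def pathMapHom (σ : A →⋆ₙₐ[ℂ] A) : (ℝ≥0 →ᵇ A) →⋆ₙₐ[ℂ] (ℝ≥0 →ᵇ A) where
  toFun f := BoundedContinuousFunction.ofNormedAddCommGroup (fun t => σ (f t))
    ((AddMonoidHomClass.continuous_of_bound σ 1 (by
      simpa only [one_mul] using NonUnitalStarAlgHom.norm_apply_le σ)).comp f.continuous) ‖f‖
    (fun t => (NonUnitalStarAlgHom.norm_apply_le σ _).trans (f.norm_coe_le_norm t))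
  map_smul' c f := by ext t; exact map_smul σ c (f t)
  map_zero' := by ext t; exact map_zero σ
  map_add' f g := by ext t; exact map_add σ (f t) (g t)
  map_mul' f g := by ext t; exact map_mul σ (f t) (g t)
  map_star' f := by ext t; exact map_star σ (f t)

theorem pathMapHom_apply (σ : A →⋆ₙₐ[ℂ] A) (f : ℝ≥0 →ᵇ A) (t : ℝ≥0) :
    pathMapHom σ f t = σ (f t) := rfl

/-- The induced algebraic action `α_b` on `C_b([0,∞), A)`, `(α_b)_g(f) = α_g ∘ f`. -/
def boundedPathAction (α : AlgAction G A) : AlgAction G (ℝ≥0 →ᵇ A) :=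
  AlgAction.ofHoms (fun g => pathMapHom (α g : A →⋆ₙₐ[ℂ] A))
    (by intro f; ext t; change α 1 (f t) = _; rw [map_one]; rfl)
    (by intro g h f; ext t; change α (g * h) (f t) = α g (α h (f t)); rw [map_mul]; rfl)

theorem boundedPathAction_apply (α : AlgAction G A) (g : G) (f : ℝ≥0 →ᵇ A) (t : ℝ≥0) :
    boundedPathAction α g f t = α g (f t) := rfl

/-- The induced algebraic action `α_𝔠` on the path algebra `A_𝔠`. -/
def pathAction (α : AlgAction G A) : AlgAction G (PathAlgebra A) :=
  (boundedPathAction α).quotient (vanishingPaths A) (by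
    intro g f hf
    have hf' : Tendsto f atTop (𝓝 0) := hf
    change Tendsto (fun t => α g (f t)) atTop (𝓝 0)
    refine squeeze_zero_norm (a := fun t => ‖f t‖)
      (fun t => (StarAlgEquiv.norm_map (α g) (f t)).le) ?_
    simpa using hf'.norm)

theorem pathAction_mk (α : AlgAction G A) (g : G) (f : ℝ≥0 →ᵇ A) :
    pathAction α g (pathMk f) = pathMk (boundedPathAction α g f) := rfl

end Path

/-! ### The dynamical folding property -/

/-- The dynamical folding property of an algebraic action `α` of `G` on a C*-algebra `A`. -/
def HasDynamicalFoldingProperty {G : Type v} [Group G] [TopologicalSpace G]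
    {A : Type u} [NonUnitalCStarAlgebra A] (α : AlgAction G A) : Prop :=
  ∀ (B : Type w) [NonUnitalCStarAlgebra B] [TopologicalSpace.SeparableSpace B]
    (B₀ D : NonUnitalStarSubalgebra ℂ B) (_ : IsClosed (B₀ : Set B)) [IsClosed (D : Set B)]
    (δ : AlgAction G D) (_ : δ.IsContinuous) (ψ : B →⋆ₙₐ[ℂ] PathAlgebra A),
    (∀ b ∈ B₀, ψ b ∈ Set.range (pathConst (A := A))) →
    (∀ (g : G) (d : D), ψ (δ g d) = pathAction α g (ψ d)) →
    (∀ d : D, ψ d ∈ pathSubalgebra α.continuousPart) →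
    ∃ φ : B →⋆ₙₐ[ℂ] A,
      (∀ b ∈ B₀, pathConst (φ b) = ψ b) ∧
      (∀ (g : G) (d : D), φ (δ g d) = α g (φ d)) ∧
      (∀ b : B, φ b = 0 ↔ ψ b = 0)

/-! ### Multiplier algebra, corona algebra and the induced actions -/

section Corona

variable (A : Type u) [NonUnitalCStarAlgebra A]

/-- A C*-algebra is σ-unital if it has a countable (sequential) approximate unit consisting of
positive contractions. -/
def IsSigmaUnital : Prop :=
  ∃ e : ℕ → A, (∀ n, ∃ b, e n = star b * b) ∧ (∀ n, ‖e n‖ ≤ 1) ∧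
    (∀ a, Tendsto (fun n => e n * a) atTop (𝓝 a)) ∧
    (∀ a, Tendsto (fun n => a * e n) atTop (𝓝 a))

variable {A} in
theorem fst_mul (x : 𝓜(ℂ, A)) (a b : A) : x.fst (a * b) = x.fst a * b := by
  have h : ∀ c : A, c * x.fst (a * b) = c * (x.fst a * b) := fun c => by
    rw [← x.central, ← mul_assoc, x.central, mul_assoc]
  have h2 := h (star (x.fst (a * b) - x.fst a * b))
  rw [← sub_eq_zero, ← mul_sub, CStarRing.star_mul_self_eq_zero_iff, sub_eq_zero] at h2
  exact h2

variable {A} in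
theorem snd_mul (x : 𝓜(ℂ, A)) (a b : A) : x.snd (a * b) = a * x.snd b := by
  have h : ∀ c : A, x.snd (a * b) * c = a * x.snd b * c := fun c => by
    rw [x.central, mul_assoc, mul_assoc, x.central]
  have h2 := h (star (x.snd (a * b) - a * x.snd b))
  rw [← sub_eq_zero, ← sub_mul, CStarRing.mul_star_self_eq_zero_iff, sub_eq_zero] at h2
  exact h2

theorem norm_coe_multiplier (a : A) : ‖DoubleCentralizer.coeHom (𝕜 := ℂ) (A := A) a‖ = ‖a‖ := by
  rw [← DoubleCentralizer.norm_fst]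
  exact ContinuousLinearMap.opNorm_mul_apply ℂ A a

/-- The canonical copy of `A` as an ideal of its multiplier algebra `M(A)`. -/
def multiplierIdeal : CStarIdeal 𝓜(ℂ, A) where
  toNonUnitalStarSubalgebra :=
    NonUnitalStarAlgHom.range (DoubleCentralizer.coeHom (𝕜 := ℂ) (A := A))
  mul_left_mem' := by
    rintro x _ ⟨a, rfl⟩
    refine ⟨x.fst a, ?_⟩
    refine DoubleCentralizer.ext ℂ A _ _ (Prod.ext ?_ ?_)
    · ext b
      change x.fst a * b = x.fst (a * b)
      exact (fst_mul x a b).symm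
    · ext b
      exact (x.central b a).symm
  mul_right_mem' := by
    rintro x _ ⟨a, rfl⟩
    refine ⟨x.snd a, ?_⟩
    refine DoubleCentralizer.ext ℂ A _ _ (Prod.ext ?_ ?_)
    · ext b
      exact x.central a b
    · ext b
      change b * x.snd a = x.snd (b * a)
      exact (snd_mul x b a).symm
  isClosed' := by
    have h : Isometry (DoubleCentralizer.coeHom (𝕜 := ℂ) (A := A)) :=
      AddMonoidHomClass.isometry_of_norm _ (norm_coe_multiplier A)
    have := h.isClosedEmbedding.isClosed_range
    convert this using 1
    ext x
    rfl

/-- The corona algebra `Q(A) = M(A) / A`. -/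
abbrev Corona : Type u := (multiplierIdeal A).Quotient

variable {A} {G : Type v} [Group G]

/-- A *-automorphism as a bounded linear map. -/
def autToCLM (σ : A ≃⋆ₐ[ℂ] A) : A →L[ℂ] A :=
  LinearMap.mkContinuous
    { toFun := σ, map_add' := map_add σ, map_smul' := map_smul σ } 1
    (fun a => by rw [one_mul]; exact (StarAlgEquiv.norm_map σ a).le)

/-- The extension of a *-automorphism `σ` of `A` to the multiplier algebra, determined by
`σ(x) · a = σ(x · σ⁻¹(a))` and `a · σ(x) = σ(σ⁻¹(a) · x)`. -/
def multiplierMapHom (σ : A ≃⋆ₐ[ℂ] A) : 𝓜(ℂ, A) →⋆ₙₐ[ℂ] 𝓜(ℂ, A) where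
  toFun x :=
    { fst := (autToCLM σ).comp (x.fst.comp (autToCLM σ.symm))
      snd := (autToCLM σ).comp (x.snd.comp (autToCLM σ.symm))
      central := fun a b => by
        change σ (x.snd (σ.symm a)) * b = a * σ (x.fst (σ.symm b))
        have h := congrArg σ (x.central (σ.symm a) (σ.symm b))
        simpa only [map_mul, StarAlgEquiv.apply_symm_apply] using h }
  map_smul' c x := by
    refine DoubleCentralizer.ext ℂ A _ _ (Prod.ext ?_ ?_)
    · ext a; exact map_smul σ c (x.fst (σ.symm a))
    · ext a; exact map_smul σ c (x.snd (σ.symm a))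
  map_zero' := by
    refine DoubleCentralizer.ext ℂ A _ _ (Prod.ext ?_ ?_)
    · ext a; exact map_zero σ
    · ext a; exact map_zero σ
  map_add' x y := by
    refine DoubleCentralizer.ext ℂ A _ _ (Prod.ext ?_ ?_)
    · ext a; exact map_add σ (x.fst (σ.symm a)) (y.fst (σ.symm a))
    · ext a; exact map_add σ (x.snd (σ.symm a)) (y.snd (σ.symm a))
  map_mul' x y := by
    refine DoubleCentralizer.ext ℂ A _ _ (Prod.ext ?_ ?_)
    · ext a
      change σ (x.fst (y.fst (σ.symm a))) = σ (x.fst (σ.symm (σ (y.fst (σ.symm a)))))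
      rw [StarAlgEquiv.symm_apply_apply]
    · ext a
      change σ (y.snd (x.snd (σ.symm a))) = σ (y.snd (σ.symm (σ (x.snd (σ.symm a)))))
      rw [StarAlgEquiv.symm_apply_apply]
  map_star' x := by
    refine DoubleCentralizer.ext ℂ A _ _ (Prod.ext ?_ ?_)
    · ext a
      change σ (star (x.snd (star (σ.symm a)))) = star (σ (x.snd (σ.symm (star a))))
      rw [map_star σ, map_star σ.symm]
    · ext a
      change σ (star (x.fst (star (σ.symm a)))) = star (σ (x.fst (σ.symm (star a))))
      rw [map_star σ, map_star σ.symm]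

theorem multiplierMapHom_fst (σ : A ≃⋆ₐ[ℂ] A) (x : 𝓜(ℂ, A)) (a : A) :
    (multiplierMapHom σ x).fst a = σ (x.fst (σ.symm a)) := rfl

theorem multiplierMapHom_snd (σ : A ≃⋆ₐ[ℂ] A) (x : 𝓜(ℂ, A)) (a : A) :
    (multiplierMapHom σ x).snd a = σ (x.snd (σ.symm a)) := rfl

/-- The induced algebraic action on the multiplier algebra,
`α_g(x) · a = α_g(x · α_g⁻¹(a))`. -/
def multiplierAction (α : AlgAction G A) : AlgAction G 𝓜(ℂ, A) :=
  AlgAction.ofHoms (fun g => multiplierMapHom (α g))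
    (by
      intro x
      refine DoubleCentralizer.ext ℂ A _ _ (Prod.ext ?_ ?_)
      · ext a
        change α 1 (x.fst ((α 1).symm a)) = x.fst a
        rw [map_one]; rfl
      · ext a
        change α 1 (x.snd ((α 1).symm a)) = x.snd a
        rw [map_one]; rfl)
    (by
      intro g h x
      refine DoubleCentralizer.ext ℂ A _ _ (Prod.ext ?_ ?_)
      · ext a
        change α (g * h) (x.fst ((α (g * h)).symm a)) =
          α g (α h (x.fst ((α h).symm ((α g).symm a))))
        rw [map_mul]; rfl
      · ext a
        change α (g * h) (x.snd ((α (g * h)).symm a)) =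
          α g (α h (x.snd ((α h).symm ((α g).symm a))))
        rw [map_mul]; rfl)

theorem multiplierAction_fst (α : AlgAction G A) (g : G) (x : 𝓜(ℂ, A)) (a : A) :
    (multiplierAction α g x).fst a = α g (x.fst ((α g)⁻¹ a)) := rfl

/-- On the canonical copy of `A` in `M(A)`, the induced action is the original one. -/
theorem multiplierAction_coe (α : AlgAction G A) (g : G) (a : A) :
    multiplierAction α g (DoubleCentralizer.coeHom (𝕜 := ℂ) a) =
      DoubleCentralizer.coeHom (𝕜 := ℂ) (α g a) := by
  refine DoubleCentralizer.ext ℂ A _ _ (Prod.ext ?_ ?_)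
  · ext b
    change α g (a * (α g).symm b) = α g a * b
    rw [map_mul, StarAlgEquiv.apply_symm_apply]
  · ext b
    change α g ((α g).symm b * a) = b * α g a
    rw [map_mul, StarAlgEquiv.apply_symm_apply]

/-- The induced algebraic action on the corona algebra `Q(A) = M(A) / A`. -/
def coronaAction (α : AlgAction G A) : AlgAction G (Corona A) :=
  (multiplierAction α).quotient (multiplierIdeal A) (by
    rintro g _ ⟨a, rfl⟩
    exact ⟨α g a, (multiplierAction_coe α g a).symm⟩)

end Corona

end DynFolding

end

namespace DynFolding

/-! ### Averages of asymptotically orthogonal sequences -/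

section Averages

variable {N : Type u} [NonUnitalCStarAlgebra N]

/-! A path in the corona is folded into a single element by reading it along an approximate unit.
Choose times `t n` tending to infinity so slowly that the given paths hardly move between
consecutive times, lift their values at `t n` to multipliers `x n`, and form the strict sum `X` of
`bump e n * x n * wide e n`, where `e` is an approximate unit of the ideal and `bump e n`, `wide e
n` are differences of its members. Near the `n`-th block `X` looks like `x n`. Hence modulo the
ideal its size and its algebraic relations are governed by the behaviour of the `x n` as `n → ∞`,
which is what the norm of the path algebra measures.

For this `e` must asymptotically commute with the lifts, be asymptotically invariant under `G`, and
detect quotient norms (`ApproxUnit.exists_quasicentral`). Commutators and translation defects of an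
approximate unit are asymptotically orthogonal, so averages of many of them are small; this gives
quasi-centrality by a direct estimate, uniformly over compact subsets of `G`.

Gluing is done at once for countably many sequences, coming from dense sequences in `B`, `B₀` and
`D` (`exists_simultaneous_glue`). These sequences need not be closed under the operations. Instead,
estimates such as `‖φ y * φ z - φ v‖ ≤ 64 * ‖y * z - v‖` are proved on the dense sequence and
extended by continuity, and `v = y * z` then gives multiplicativity. Two-sided estimates between `‖φ
y‖` and `‖ψ y‖` give equality of kernels; the constants play no role.

Equivariance has to hold for all `g`, while `e` is chosen once. So quotient norms of `β g (x n) - x'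
n` must be detected uniformly for `g` in a compact set, which requires continuous orbits of the
lifts and not just of their classes. That is automatic by a Baire category argument
(`continuous_action_of_mkHom`).

The argument is run for an abstract ideal that is complete in its strict topology. The multiplier
algebra has this property, σ-unitality provides the sequential approximate unit, and continuity of
`α` gives continuous orbits on the ideal. -/

theorem exists_almost_orthogonal_finset {Ω : Type v} (c : ℕ → Ω → N)
    (h : ∀ j, ∀ η : ℝ, 0 < η → ∀ᶠ k in atTop, ∀ ω, ‖star (c k ω) * c j ω‖ ≤ η)
    {η : ℝ} (hη : 0 < η) (k₀ m : ℕ) :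
    ∃ s : Finset ℕ, s.card = m ∧ (∀ i ∈ s, k₀ ≤ i) ∧
      ∀ i ∈ s, ∀ j ∈ s, i ≠ j → ∀ ω, ‖star (c i ω) * c j ω‖ ≤ η := by
  induction m with
  | zero => exact ⟨∅, rfl, by simp, by simp⟩
  | succ m ih =>
    obtain ⟨s, hs, hs0, hs1⟩ := ih
    have h1 : ∀ᶠ k in atTop, ∀ j ∈ s, ∀ ω, ‖star (c k ω) * c j ω‖ ≤ η :=
      (Finset.eventually_all s).2 fun j _ => h j η hη
    have h2 : ∀ᶠ k in atTop, ∀ j ∈ s, j < k :=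
      (Finset.eventually_all s).2 fun j _ => eventually_gt_atTop j
    obtain ⟨k, hk1, hk2, hk0⟩ := (h1.and (h2.and (eventually_ge_atTop k₀))).exists
    have hks : k ∉ s := fun hk => (hk2 k hk).false
    refine ⟨insert k s, by rw [Finset.card_insert_of_notMem hks, hs], ?_, ?_⟩
    · intro i hi
      rcases Finset.mem_insert.1 hi with rfl | hi
      exacts [hk0, hs0 i hi]
    · intro i hi j hj hij ω
      rcases Finset.mem_insert.1 hi with rfl | hi
      · rcases Finset.mem_insert.1 hj with rfl | hj
        exacts [(hij rfl).elim, hk1 j hj ω]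
      · rcases Finset.mem_insert.1 hj with rfl | hj
        · rw [← norm_star, star_mul, star_star]
          exact hk1 i ((Finset.mem_insert.1 hi).resolve_left hij) ω
        · exact hs1 i hi j hj hij ω

/-- Expand the square by the C*-identity: each row contributes one diagonal term of size `R ^ 2` and
fewer than `s.card` small ones. For negligible `η` the sum grows only like the square root of the
number of terms, so averages tend to zero. -/
theorem norm_sum_sq_le_of_almost_orthogonal (s : Finset ℕ) (c : ℕ → N) {R η : ℝ}
    (hR : ∀ i ∈ s, ‖c i‖ ≤ R) (hη : 0 ≤ η)
    (h : ∀ i ∈ s, ∀ j ∈ s, i ≠ j → ‖star (c i) * c j‖ ≤ η) :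
    ‖∑ i ∈ s, c i‖ ^ 2 ≤ s.card * (R ^ 2 + s.card * η) := by
  rw [sq, ← CStarRing.norm_star_mul_self, star_sum, Finset.sum_mul]
  refine (norm_sum_le_of_le (n := fun _ => R ^ 2 + s.card * η) s fun i hi => ?_).trans
    (by rw [Finset.sum_const, nsmul_eq_mul])
  rw [Finset.mul_sum, ← Finset.add_sum_erase s _ hi]
  refine (norm_add_le _ _).trans (add_le_add ?_ ?_)
  · rw [CStarRing.norm_star_mul_self, ← sq]
    exact pow_le_pow_left₀ (norm_nonneg _) (hR i hi) 2
  · refine (norm_sum_le_of_le (n := fun _ => η) _ fun j hj => ?_).trans ?_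
    · exact h i hi j (Finset.mem_of_mem_erase hj) (Finset.ne_of_mem_erase hj).symm
    · rw [Finset.sum_const, nsmul_eq_mul]
      exact mul_le_mul_of_nonneg_right (by exact_mod_cast Finset.card_erase_le) hη

/-- A bounded family of sequences that is asymptotically orthogonal, uniformly in the parameter,
has averages which are uniformly small. -/
theorem exists_small_average {Ω : Type v} (c : ℕ → Ω → N) {R : ℝ} (hR : ∀ k ω, ‖c k ω‖ ≤ R)
    (h : ∀ j, ∀ η : ℝ, 0 < η → ∀ᶠ k in atTop, ∀ ω, ‖star (c k ω) * c j ω‖ ≤ η)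
    {ε : ℝ} (hε : 0 < ε) (k₀ : ℕ) :
    ∃ s : Finset ℕ, s.Nonempty ∧ (∀ i ∈ s, k₀ ≤ i) ∧ ∀ ω, ‖∑ i ∈ s, c i ω‖ ≤ s.card * ε := by
  -- With `m + 1` terms and off-diagonal bound `ε ^ 2 / 2`, the diagonal and the off-diagonal parts
  -- each contribute at most half of `((m + 1) * ε) ^ 2`.
  obtain ⟨m, hm⟩ := exists_nat_gt (R ^ 2 / (ε ^ 2 / 2))
  obtain ⟨s, hs, hs0, hs1⟩ := exists_almost_orthogonal_finset c h
    (half_pos (pow_pos hε 2)) k₀ (m + 1)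
  refine ⟨s, Finset.card_pos.1 (by omega), hs0, fun ω => ?_⟩
  refine le_of_sq_le_sq ?_ (by positivity)
  refine (norm_sum_sq_le_of_almost_orthogonal s (fun i => c i ω) (fun i _ => hR i ω)
    (half_pos (pow_pos hε 2)).le (fun i hi j hj hij => hs1 i hi j hj hij ω)).trans ?_
  rw [div_lt_iff₀ (by positivity)] at hm
  rw [hs]
  push_cast
  have h1 : R ^ 2 ≤ ((m : ℝ) + 1) * (ε ^ 2 / 2) := by nlinarith [pow_pos hε 2]
  calc ((m : ℝ) + 1) * (R ^ 2 + (m + 1) * (ε ^ 2 / 2))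
      ≤ ((m : ℝ) + 1) * ((m + 1) * (ε ^ 2 / 2) + (m + 1) * (ε ^ 2 / 2)) := by gcongr
    _ = (((m : ℝ) + 1) * ε) ^ 2 := by ring

/-- The average of a finite family. -/
noncomputable def average (s : Finset ℕ) (f : ℕ → N) : N := (s.card : ℂ)⁻¹ • ∑ i ∈ s, f i

theorem average_mul (s : Finset ℕ) (f : ℕ → N) (x : N) :
    average s f * x = average s fun i => f i * x := by
  rw [average, smul_mul_assoc, Finset.sum_mul, average]

theorem mul_average (s : Finset ℕ) (f : ℕ → N) (x : N) :
    x * average s f = average s fun i => x * f i := by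
  rw [average, mul_smul_comm, Finset.mul_sum, average]

theorem average_sub (s : Finset ℕ) (f g : ℕ → N) :
    (average s fun i => f i - g i) = average s f - average s g := by
  simp only [average, Finset.sum_sub_distrib, smul_sub]

theorem average_const {s : Finset ℕ} (hs : s.Nonempty) {f : ℕ → N} {x : N}
    (h : ∀ i ∈ s, f i = x) : average s f = x := by
  have : (s.card : ℂ) ≠ 0 := by exact_mod_cast hs.card_pos.ne'
  rw [average, Finset.sum_congr rfl h, Finset.sum_const, ← Nat.cast_smul_eq_nsmul ℂ, smul_smul,
    inv_mul_cancel₀ this, one_smul]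

theorem norm_average_le_of_norm_sum_le {s : Finset ℕ} (hs : s.Nonempty) {f : ℕ → N} {r : ℝ}
    (h : ‖∑ i ∈ s, f i‖ ≤ s.card * r) : ‖average s f‖ ≤ r := by
  have : (0 : ℝ) < s.card := by exact_mod_cast hs.card_pos
  rw [average, norm_smul, norm_inv, Complex.norm_natCast, inv_mul_le_iff₀ this]
  exact h

theorem norm_average_le {s : Finset ℕ} (hs : s.Nonempty) {f : ℕ → N} {r : ℝ}
    (h : ∀ i ∈ s, ‖f i‖ ≤ r) : ‖average s f‖ ≤ r := by
  refine norm_average_le_of_norm_sum_le hs ((norm_sum_le_of_le s h).trans ?_)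
  simp

theorem norm_average_sub_le {s : Finset ℕ} (hs : s.Nonempty) {f : ℕ → N} {x : N} {r : ℝ}
    (h : ∀ i ∈ s, ‖f i - x‖ ≤ r) : ‖average s f - x‖ ≤ r := by
  have h1 := norm_average_le hs h
  rwa [average_sub, average_const (f := fun _ => x) hs fun _ _ => rfl] at h1

end Averages

/-! ### Approximate units of ideals -/

/-- The functions are equi-Lipschitz, so a finite net reduces uniformity on `S` to finitely many
points. Only upper bounds are involved, so `f n` may be a difference of two norms. -/
theorem eventually_forall_le_of_isCompact {X : Type u} [PseudoMetricSpace X] {S : Set X}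
    (hS : IsCompact S) {f : ℕ → X → ℝ} {C : ℝ} (hC : 0 < C)
    (hf : ∀ n a b, f n a ≤ f n b + C * dist a b)
    (h : ∀ a ∈ S, ∀ δ > 0, ∀ᶠ n in atTop, f n a ≤ δ) {ε : ℝ} (hε : 0 < ε) :
    ∀ᶠ n in atTop, ∀ a ∈ S, f n a ≤ ε := by
  obtain ⟨t, htS, htf, ht⟩ := hS.finite_cover_balls (e := ε / 2 / C) (by positivity)
  have h1 : ∀ᶠ n in atTop, ∀ b ∈ t, f n b ≤ ε / 2 :=
    (eventually_all_finite htf).2 fun b hb => h b (htS hb) _ (half_pos hε)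
  filter_upwards [h1] with n hn a ha
  obtain ⟨b, hb, hab⟩ := Set.mem_iUnion₂.1 (ht ha)
  have h2 : C * dist a b ≤ ε / 2 := by
    rw [mul_comm, ← le_div_iff₀ hC]
    exact (Metric.mem_ball.1 hab).le
  linarith [hf n a b, hn b hb]

namespace CStarIdeal

variable {M : Type u} [CStarAlgebra M] (I : CStarIdeal M)

theorem mkHom_eq_zero {x : M} : I.mkHom x = 0 ↔ x ∈ I.toSubspace := Quotient.mk_eq_zero

theorem norm_mkHom_le (x : M) : ‖I.mkHom x‖ ≤ ‖x‖ := Quotient.norm_mk_le x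

theorem exists_mkHom_eq (y : I.Quotient) {ε : ℝ} (hε : 0 < ε) :
    ∃ x, I.mkHom x = y ∧ ‖x‖ < ‖y‖ + ε := Quotient.exists_norm_lt y hε

theorem mkHom_sub_of_mem {x a : M} (ha : a ∈ I.toSubspace) : I.mkHom (x - a) = I.mkHom x := by
  rw [map_sub, I.mkHom_eq_zero.2 ha, sub_zero]

theorem mkHom_eq_mkHom {x y : M} : I.mkHom x = I.mkHom y ↔ x - y ∈ I.toSubspace := by
  rw [← I.mkHom_eq_zero, map_sub, sub_eq_zero]

/-- An ideal `I` of `M` is strictly complete if `M` is, like a multiplier algebra, complete in the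
strict topology given by `I`, and `I` is essential. -/
structure StrictlyComplete : Prop where
  norm_le : ∀ (x : M) (R : ℝ), 0 ≤ R → (∀ a ∈ I.toSubspace, ‖a‖ ≤ 1 → ‖x * a‖ ≤ R) → ‖x‖ ≤ R
  exists_limit : ∀ S : ℕ → M, (∃ R, ∀ n, ‖S n‖ ≤ R) →
    (∀ a ∈ I.toSubspace, CauchySeq fun n => S n * a) →
    (∀ a ∈ I.toSubspace, CauchySeq fun n => a * S n) →
    ∃ x, ∀ a ∈ I.toSubspace, Tendsto (fun n => S n * a) atTop (𝓝 (x * a)) ∧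
      Tendsto (fun n => a * S n) atTop (𝓝 (a * x))

/-- A sequential approximate unit `u` of `I` by self-adjoint contractions with
`u n * u m = u m` for `m < n`. -/
structure ApproxUnit (u : ℕ → M) : Prop where
  mem : ∀ n, u n ∈ I.toSubspace
  star_eq : ∀ n, star (u n) = u n
  norm_le_one : ∀ n, ‖u n‖ ≤ 1
  mul_eq : ∀ {m n}, m < n → u n * u m = u m
  tendsto_mul : ∀ a ∈ I.toSubspace, Tendsto (fun n => u n * a) atTop (𝓝 a)

namespace ApproxUnit

variable {I} {u : ℕ → M}

theorem mul_eq' (hu : I.ApproxUnit u) {m n : ℕ} (h : m < n) : u m * u n = u m := by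
  rw [← hu.star_eq m, ← hu.star_eq n, ← star_mul, hu.mul_eq h]

theorem tendsto_mul' (hu : I.ApproxUnit u) {a : M} (ha : a ∈ I.toSubspace) :
    Tendsto (fun n => a * u n) atTop (𝓝 a) := by
  have h := (hu.tendsto_mul (star a) (I.star_mem ha)).star
  simpa [star_mul, hu.star_eq] using h

theorem norm_mul_le (hu : I.ApproxUnit u) (n : ℕ) (x : M) : ‖u n * x‖ ≤ ‖x‖ :=
  (_root_.norm_mul_le _ _).trans (mul_le_of_le_one_left (norm_nonneg _) (hu.norm_le_one n))

theorem norm_mul_le' (hu : I.ApproxUnit u) (n : ℕ) (x : M) : ‖x * u n‖ ≤ ‖x‖ :=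
  (_root_.norm_mul_le _ _).trans (mul_le_of_le_one_right (norm_nonneg _) (hu.norm_le_one n))

theorem norm_sub_mul_le (hu : I.ApproxUnit u) (n : ℕ) (x : M) : ‖x - u n * x‖ ≤ 2 * ‖x‖ := by
  linarith [norm_sub_le x (u n * x), hu.norm_mul_le n x]

theorem eventually_norm_sub_mul_le (hu : I.ApproxUnit u) {a : M} (ha : a ∈ I.toSubspace) {δ : ℝ}
    (hδ : 0 < δ) : ∀ᶠ n in atTop, ‖a - u n * a‖ ≤ δ := by
  filter_upwards [(Metric.tendsto_nhds.1 (hu.tendsto_mul a ha)) δ hδ] with n hn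
  rw [dist_comm, dist_eq_norm] at hn
  exact hn.le

theorem eventually_forall_norm_sub_mul_le (hu : I.ApproxUnit u) {S : Set M} (hS : IsCompact S)
    (hSI : ∀ a ∈ S, a ∈ I.toSubspace) {ε : ℝ} (hε : 0 < ε) :
    ∀ᶠ n in atTop, ∀ a ∈ S, ‖a - u n * a‖ ≤ ε := by
  refine eventually_forall_le_of_isCompact hS (f := fun n a => ‖a - u n * a‖) two_pos
    (fun n a b => ?_) (fun a ha δ hδ => hu.eventually_norm_sub_mul_le (hSI a ha) hδ) hε
  have h : a - u n * a = (b - u n * b) + ((a - b) - u n * (a - b)) := by noncomm_ring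
  rw [h, dist_eq_norm]
  exact (norm_add_le _ _).trans (by linarith [hu.norm_sub_mul_le n (a - b)])

/-- Write `x` as a lift of its class of nearly minimal norm plus an element of `I`: the cut-off by
`1 - u n` eventually absorbs the latter and at most doubles the former. -/
theorem eventually_norm_sub_mul_le_mkHom (hu : I.ApproxUnit u) (x : M) {δ : ℝ} (hδ : 0 < δ) :
    ∀ᶠ n in atTop, ‖x - u n * x‖ ≤ 2 * ‖I.mkHom x‖ + δ := by
  obtain ⟨y, hyx, hy⟩ := I.exists_mkHom_eq (I.mkHom x) (ε := δ / 4) (by positivity)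
  filter_upwards [hu.eventually_norm_sub_mul_le (I.mkHom_eq_mkHom.1 hyx.symm)
    (δ := δ / 2) (by positivity)] with n hn
  have h : x - u n * x = (y - u n * y) + ((x - y) - u n * (x - y)) := by noncomm_ring
  rw [h]
  exact (norm_add_le _ _).trans (by linarith [hu.norm_sub_mul_le n y])

theorem eventually_forall_norm_sub_mul_le_mkHom (hu : I.ApproxUnit u) {S : Set M}
    (hS : IsCompact S) {ε : ℝ} (hε : 0 < ε) :
    ∀ᶠ n in atTop, ∀ x ∈ S, ‖x - u n * x‖ ≤ 2 * ‖I.mkHom x‖ + ε := by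
  -- The Lipschitz constant is `2` for `a ↦ a - u n * a` plus `2` for twice the quotient norm.
  have h := eventually_forall_le_of_isCompact hS
    (f := fun n a => ‖a - u n * a‖ - 2 * ‖I.mkHom a‖) (C := 4) (by norm_num)
    (fun n a b => ?_) (fun a _ δ hδ => ?_) hε
  · filter_upwards [h] with n hn x hx
    linarith [hn x hx]
  · have h : a - u n * a = (b - u n * b) + ((a - b) - u n * (a - b)) := by noncomm_ring
    have h1 : ‖a - u n * a‖ ≤ ‖b - u n * b‖ + 2 * ‖a - b‖ := by
      rw [h]
      exact (norm_add_le _ _).trans (by linarith [hu.norm_sub_mul_le n (a - b)])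
    have h2 : ‖I.mkHom b‖ ≤ ‖I.mkHom a‖ + ‖a - b‖ := by
      have h3 := I.norm_mkHom_le (b - a)
      rw [map_sub, norm_sub_rev b a] at h3
      linarith [norm_le_norm_add_norm_sub' (I.mkHom b) (I.mkHom a)]
    rw [dist_eq_norm]
    linarith
  · filter_upwards [hu.eventually_norm_sub_mul_le_mkHom a hδ] with n hn
    linarith

end ApproxUnit

end CStarIdeal

/-! ### Approximate units from strictly positive elements -/

/-- The continuous function vanishing on `(-∞, 2⁻ᵏ]`, equal to `1` on `[2¹⁻ᵏ, ∞)` and linear in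
between. -/
noncomputable def ramp (k : ℕ) (t : ℝ) : ℝ := max 0 (min 1 (2 ^ k * t - 1))

theorem continuous_ramp (k : ℕ) : Continuous (ramp k) := by unfold ramp; fun_prop

theorem ramp_nonneg (k : ℕ) (t : ℝ) : 0 ≤ ramp k t := le_max_left _ _

theorem ramp_le_one (k : ℕ) (t : ℝ) : ramp k t ≤ 1 := max_le zero_le_one (min_le_left _ _)

theorem ramp_eq_one {k : ℕ} {t : ℝ} (h : 2 ≤ 2 ^ k * t) : ramp k t = 1 := by
  rw [ramp, min_eq_left (by linarith), max_eq_right zero_le_one]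

theorem ramp_eq_zero {k : ℕ} {t : ℝ} (h : 2 ^ k * t ≤ 1) : ramp k t = 0 := by
  rw [ramp, max_eq_left]
  exact (min_le_right _ _).trans (by linarith)

/-- Where `ramp m` is nonzero, `2 ^ m * t > 1`, hence `2 ^ n * t > 2` and `ramp n` has already
reached `1`. -/
theorem ramp_mul_ramp {m n : ℕ} (h : m < n) (t : ℝ) : ramp n t * ramp m t = ramp m t := by
  rcases le_or_gt (2 ^ m * t) 1 with h1 | h1
  · rw [ramp_eq_zero h1, mul_zero]
  · rw [ramp_eq_one, one_mul]
    have h2 : (2 : ℝ) ^ (m + 1) ≤ 2 ^ n := pow_le_pow_right₀ one_le_two h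
    have ht : 0 < t := by
      by_contra! h3
      have : (2 : ℝ) ^ m * t ≤ 0 := mul_nonpos_of_nonneg_of_nonpos (by positivity) h3
      linarith
    have h4 := mul_le_mul_of_nonneg_right h2 ht.le
    rw [pow_succ] at h4
    linarith

/-- The factor `t` puts `ramp k` of a positive element of an ideal into the ideal. The maximum keeps
the cofactor continuous and changes nothing where `ramp k` is nonzero. -/
theorem ramp_eq_mul (k : ℕ) (t : ℝ) : ramp k t = t * (ramp k t / max t ((2 ^ k)⁻¹)) := by
  have hk : (0 : ℝ) < 2 ^ k := by positivity
  rcases le_or_gt (2 ^ k * t) 1 with h1 | h1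
  · simp [ramp_eq_zero h1]
  · have h2 : (2 ^ k)⁻¹ < t := by
      rw [inv_lt_iff_one_lt_mul₀ hk]; linarith
    have h3 : 0 < t := lt_trans (by positivity) h2
    rw [max_eq_left h2.le]
    field_simp

theorem abs_one_sub_ramp_sq_mul_le (k : ℕ) {t : ℝ} (ht : 0 ≤ t) :
    ‖(1 - ramp k t) * t * (1 - ramp k t)‖ ≤ 2 * (1 / 2) ^ k := by
  rcases le_or_gt 2 (2 ^ k * t) with h1 | h1
  · rw [ramp_eq_one h1]
    simp
  · have h2 : t ≤ 2 * (1 / 2) ^ k := by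
      rw [one_div, inv_pow, ← div_eq_mul_inv, le_div_iff₀ (by positivity)]
      linarith
    have h3 : 0 ≤ 1 - ramp k t := sub_nonneg.2 (ramp_le_one k t)
    have h4 : 1 - ramp k t ≤ 1 := by linarith [ramp_nonneg k t]
    rw [Real.norm_of_nonneg (by positivity)]
    calc (1 - ramp k t) * t * (1 - ramp k t) ≤ 1 * t * 1 := by gcongr
      _ ≤ _ := by simpa using h2

namespace CStarIdeal

variable {M : Type u} [CStarAlgebra M] {I : CStarIdeal M}

/-- An ideal with a sequential approximate unit of positive contractions has a sequential
approximate unit in which every element acts as a unit on its predecessors. -/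
theorem exists_approxUnit (e : ℕ → M) (he : ∀ n, e n ∈ I.toSubspace)
    (hpos : ∀ n, ∃ b, e n = star b * b) (hnorm : ∀ n, ‖e n‖ ≤ 1)
    (hlim : ∀ a ∈ I.toSubspace, Tendsto (fun n => e n * a) atTop (𝓝 a)) :
    ∃ u, I.ApproxUnit u := by
  let _ : PartialOrder M := CStarAlgebra.spectralOrder M
  have _ : StarOrderedRing M := CStarAlgebra.spectralOrderedRing M
  have hpos' : ∀ n, 0 ≤ e n := fun n => by
    obtain ⟨b, hb⟩ := hpos n
    rw [hb]; exact star_mul_self_nonneg b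
  have hsum : Summable fun n => ((1 / 2 : ℝ) ^ n) • e n := by
    refine Summable.of_norm_bounded summable_geometric_two fun n => ?_
    rw [norm_smul, norm_pow, Real.norm_of_nonneg (by norm_num)]
    exact mul_le_of_le_one_right (by positivity) (hnorm n)
  have hterm : ∀ n, 0 ≤ ((1 / 2 : ℝ) ^ n) • e n := fun n =>
    smul_nonneg (by positivity) (hpos' n)
  -- A strictly positive element of `I`: it dominates a multiple of every `e n`. The approximate
  -- unit consists of the elements `ramp k` of `h`.
  set h : M := ∑' n, ((1 / 2 : ℝ) ^ n) • e n with hh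
  have hI : h ∈ I.toSubspace := by
    refine I.isClosed'.mem_of_tendsto hsum.hasSum (Eventually.of_forall fun s => ?_)
    refine I.toSubspace.sum_mem fun n _ => ?_
    have : ((1 / 2 : ℝ) ^ n) • e n = (((1 / 2 : ℝ) ^ n : ℝ) : ℂ) • e n := by
      rw [Complex.coe_smul]
    rw [this]
    exact I.toSubspace.smul_mem _ (he n)
  have h0 : 0 ≤ h := tsum_nonneg hterm
  have hsa : IsSelfAdjoint h := IsSelfAdjoint.of_nonneg h0
  have hle : ∀ n, ((1 / 2 : ℝ) ^ n) • e n ≤ h := fun n =>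
    hsum.le_tsum n fun m _ => hterm m
  have hc : ∀ k, Continuous (ramp k) := continuous_ramp
  have hu_norm : ∀ k, ‖cfc (ramp k) h‖ ≤ 1 := fun k =>
    norm_cfc_le zero_le_one fun t _ => by
      rw [Real.norm_of_nonneg (ramp_nonneg k t)]; exact ramp_le_one k t
  have hu_star : ∀ k, star (cfc (ramp k) h) = cfc (ramp k) h := fun k =>
    (IsSelfAdjoint.cfc (f := ramp k) (a := h)).star_eq
  have hone : ∀ k, 1 - cfc (ramp k) h = cfc (fun t => 1 - ramp k t) h := fun k => by
    rw [cfc_sub (fun _ => (1 : ℝ)) (ramp k) h (by fun_prop) ((hc k).continuousOn), cfc_const_one ℝ h]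
  have hcut : ∀ k, ‖(1 - cfc (ramp k) h) * h * (1 - cfc (ramp k) h)‖ ≤ 2 * (1 / 2) ^ k := fun k => by
    have hc1 : ContinuousOn (fun t => 1 - ramp k t) (spectrum ℝ h) :=
      (continuous_const.sub (hc k)).continuousOn
    have heq : (1 - cfc (ramp k) h) * h * (1 - cfc (ramp k) h) =
        cfc (fun t => (1 - ramp k t) * t * (1 - ramp k t)) h := by
      rw [cfc_mul (fun t => (1 - ramp k t) * t) (fun t => 1 - ramp k t) h
        (hc1.mul continuousOn_id) hc1, cfc_mul (fun t => 1 - ramp k t) (fun t => t) h hc1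
        continuousOn_id, cfc_id' ℝ h, hone]
    rw [heq]
    exact norm_cfc_le (by positivity) fun t ht =>
      abs_one_sub_ramp_sq_mul_le k (spectrum_nonneg_of_nonneg h0 ht)
  -- Since `e j ≤ 2 ^ j • h`, compressing by `1 - cfc (ramp k) h` reduces to `hcut`. Writing `e j =
  -- star b * b` turns the two-sided compression into a one-sided estimate.
  have hcut_e : ∀ j k, ‖e j - cfc (ramp k) h * e j‖ ^ 2 ≤ 2 ^ j * (2 * (1 / 2) ^ k) := fun j k => by
    obtain ⟨b, hb⟩ := hpos j
    set c := 1 - cfc (ramp k) h with hcdef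
    have hcs : star c = c := by rw [hcdef, star_sub, star_one, hu_star]
    have hb1 : ‖b‖ ^ 2 ≤ 1 := by
      rw [sq, ← CStarRing.norm_star_mul_self, ← hb]; exact hnorm j
    have h1 : e j - cfc (ramp k) h * e j = (c * star b) * b := by
      rw [hcdef, mul_assoc, ← hb]; noncomm_ring
    have hej : e j ≤ (2 : ℝ) ^ j • h := by
      have h3 := smul_le_smul_of_nonneg_left (hle j) (by positivity : (0 : ℝ) ≤ 2 ^ j)
      rwa [smul_smul, ← mul_pow, mul_one_div_cancel two_ne_zero, one_pow, one_smul] at h3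
    have h4 : ‖c * star b‖ ^ 2 ≤ 2 ^ j * (2 * (1 / 2) ^ k) := by
      have h5 : ‖c * star b‖ ^ 2 = ‖c * e j * c‖ := by
        rw [sq, ← CStarRing.norm_self_mul_star, star_mul, star_star, hcs, hb]
        simp only [mul_assoc]
      have h6 : c * e j * c ≤ c * ((2 : ℝ) ^ j • h) * c := by
        simpa only [hcs] using star_left_conjugate_le_conjugate hej c
      have h7 : 0 ≤ c * e j * c := by
        simpa only [hcs] using star_left_conjugate_nonneg (hpos' j) c
      rw [h5]
      refine (CStarAlgebra.norm_le_norm_of_nonneg_of_le h7 h6).trans ?_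
      rw [mul_smul_comm, smul_mul_assoc, norm_smul, Real.norm_of_nonneg (by positivity)]
      exact mul_le_mul_of_nonneg_left (hcut k) (by positivity)
    rw [h1]
    calc ‖c * star b * b‖ ^ 2 ≤ (‖c * star b‖ * ‖b‖) ^ 2 := by gcongr; exact norm_mul_le _ _
      _ = ‖c * star b‖ ^ 2 * ‖b‖ ^ 2 := mul_pow _ _ _
      _ ≤ 2 ^ j * (2 * (1 / 2) ^ k) := (mul_le_of_le_one_right (by positivity) hb1).trans h4
  refine ⟨fun k => cfc (ramp k) h, ?_, hu_star, hu_norm, ?_, ?_⟩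
  · intro k
    have hg : Continuous fun t : ℝ => ramp k t / max t ((2 ^ k)⁻¹) :=
      (hc k).div (by fun_prop) fun t => (lt_of_lt_of_le (by positivity) (le_max_right _ _)).ne'
    have : cfc (ramp k) h = h * cfc (fun t : ℝ => ramp k t / max t ((2 ^ k)⁻¹)) h := by
      calc cfc (ramp k) h = cfc (fun t => t * (ramp k t / max t ((2 ^ k)⁻¹))) h :=
            congrArg (fun f => cfc f h) (funext (ramp_eq_mul k))
        _ = cfc (fun t : ℝ => t) h * cfc (fun t => ramp k t / max t ((2 ^ k)⁻¹)) h :=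
            cfc_mul (fun t => t) _ h continuousOn_id hg.continuousOn
        _ = _ := by rw [cfc_id' ℝ h]
    change cfc (ramp k) h ∈ I.toSubspace
    rw [this]
    exact I.mul_right_mem _ hI
  · intro m n hmn
    rw [← cfc_mul (ramp n) (ramp m) h (hc n).continuousOn (hc m).continuousOn]
    simp only [ramp_mul_ramp hmn]
  · intro a ha
    rw [Metric.tendsto_nhds]
    intro ε hε
    obtain ⟨j, hj⟩ := ((Metric.tendsto_nhds.1 (hlim a ha)) (ε / 3) (by positivity)).exists
    rw [dist_eq_norm] at hj
    have h1 : Tendsto (fun k : ℕ => (2 : ℝ) ^ j * (2 * (1 / 2) ^ k)) atTop (𝓝 0) := by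
      have := ((tendsto_pow_atTop_nhds_zero_of_lt_one (r := (1 / 2 : ℝ)) (by norm_num)
        (by norm_num)).const_mul 2).const_mul (2 ^ j)
      simpa using this
    have h2 : 0 < ε / 3 / (‖a‖ + 1) := by positivity
    filter_upwards [h1.eventually (gt_mem_nhds (pow_pos h2 2))] with k hk
    have h3 : ‖e j - cfc (ramp k) h * e j‖ < ε / 3 / (‖a‖ + 1) :=
      lt_of_pow_lt_pow_left₀ 2 h2.le ((hcut_e j k).trans_lt hk)
    have h4 : ‖(e j - cfc (ramp k) h * e j) * a‖ ≤ ε / 3 := by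
      refine (norm_mul_le _ _).trans ?_
      calc _ ≤ ε / 3 / (‖a‖ + 1) * (‖a‖ + 1) := by gcongr; linarith
        _ = ε / 3 := by field_simp
    have h5 : cfc (ramp k) h * a - a = (e j * a - a) - (e j - cfc (ramp k) h * e j) * a
        - cfc (ramp k) h * (e j * a - a) := by noncomm_ring
    have h6 : ‖cfc (ramp k) h * (e j * a - a)‖ < ε / 3 :=
      ((norm_mul_le _ _).trans (mul_le_of_le_one_left (norm_nonneg _) (hu_norm k))).trans_lt hj
    rw [dist_eq_norm, h5]
    refine (norm_sub_le _ _).trans_lt ?_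
    have := norm_sub_le (e j * a - a) ((e j - cfc (ramp k) h * e j) * a)
    linarith

end CStarIdeal

/-! ### Quasi-central, asymptotically invariant approximate units -/

namespace CStarIdeal

variable {M : Type u} [CStarAlgebra M] {I : CStarIdeal M}

theorem StrictlyComplete.exists_norm_mul_ge (hI : I.StrictlyComplete) (x : M) {ε : ℝ}
    (hε : 0 < ε) : ∃ a ∈ I.toSubspace, ‖a‖ ≤ 1 ∧ ‖x‖ ≤ ‖x * a‖ + ε := by
  by_contra! h
  have h0 : 0 < ‖x‖ - ε := by
    have := h 0 (zero_mem _) (by simp)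
    simp only [mul_zero, norm_zero] at this
    linarith
  have := hI.norm_le x (‖x‖ - ε) h0.le fun a ha ha1 => by linarith [h a ha ha1]
  linarith

theorem StrictlyComplete.eq_zero (hI : I.StrictlyComplete) {x : M}
    (h : ∀ a ∈ I.toSubspace, x * a = 0) : x = 0 :=
  norm_le_zero_iff.1 (hI.norm_le x 0 le_rfl fun a ha _ => by rw [h a ha, norm_zero])

section Selection

variable {G : Type v} [Group G] [TopologicalSpace G] [IsTopologicalGroup G] {β : AlgAction G M}
  {u : ℕ → M}

/-- For fixed `j` the commutator `z` with `u j` lies in `I`, so in `star x * u k * z - u k * star x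
* z` both terms tend to `star x * z`. -/
theorem ApproxUnit.eventually_commutator_orthogonal (hu : I.ApproxUnit u) (x : M) (j : ℕ) {η : ℝ}
    (hη : 0 < η) :
    ∀ᶠ k in atTop, ‖star (u k * x - x * u k) * (u j * x - x * u j)‖ ≤ η := by
  set z := u j * x - x * u j with hz
  have hzI : z ∈ I.toSubspace := sub_mem (I.mul_right_mem _ (hu.mem j)) (I.mul_left_mem _ (hu.mem j))
  have h1 : Tendsto (fun k => star x * (u k * z) - u k * (star x * z)) atTop
      (𝓝 (star x * z - star x * z)) :=
    ((hu.tendsto_mul z hzI).const_mul _).sub (hu.tendsto_mul _ (I.mul_left_mem _ hzI))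
  rw [sub_self] at h1
  filter_upwards [(Metric.tendsto_nhds.1 h1) η hη] with k hk
  rw [dist_zero_right] at hk
  have : star (u k * x - x * u k) * z = star x * (u k * z) - u k * (star x * z) := by
    rw [star_sub, star_mul, star_mul, hu.star_eq]; noncomm_ring
  rw [this]
  exact hk.le

/-- Because `u k` fixes `u j` for `k > j`, the product splits into the defects of `u k` on `β g (u
j)` and, after applying `β g`, on `β g⁻¹ (u j)`. As `g` runs through `K` these elements fill compact
subsets of `I`, which makes the estimate uniform. -/
theorem ApproxUnit.eventually_translate_orthogonal (hu : I.ApproxUnit u)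
    (hβI : ∀ g, ∀ x ∈ I.toSubspace, β g x ∈ I.toSubspace)
    (hβ : ∀ a ∈ I.toSubspace, Continuous fun g => β g a) {K : Set G} (hK : IsCompact K)
    (j : ℕ) {η : ℝ} (hη : 0 < η) :
    ∀ᶠ k in atTop, ∀ g ∈ K,
      ‖star (β g (u k) - u k) * (β g (u j) - u j)‖ ≤ η := by
  have hc1 := hβ _ (hu.mem j)
  have hc2 : Continuous fun g => β g⁻¹ (u j) := hc1.comp continuous_inv
  have hmem : ∀ h : G, β h (u j) ∈ I.toSubspace := fun h => hβI h _ (hu.mem j)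
  filter_upwards [hu.eventually_forall_norm_sub_mul_le (hK.image hc1)
      (by rintro _ ⟨g, _, rfl⟩; exact hmem g) (half_pos hη),
    hu.eventually_forall_norm_sub_mul_le (hK.image hc2)
      (by rintro _ ⟨g, _, rfl⟩; exact hmem g⁻¹) (half_pos hη), eventually_gt_atTop j]
    with k h1 h2 hk g hg
  have h3 : β g (u k) * β g (u j) = β g (u j) := by rw [← map_mul, hu.mul_eq hk]
  have hinv : β g (β g⁻¹ (u j)) = u j := by
    rw [← StarAlgEquiv.mul_apply, ← map_mul, mul_inv_cancel, map_one]; rfl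
  have h4 : β g (u k) * u j = β g (u k * β g⁻¹ (u j)) := by rw [map_mul, hinv]
  have h5 : star (β g (u k) - u k) * (β g (u j) - u j) =
      (β g (u j) - u k * β g (u j)) + β g (β g⁻¹ (u j) - u k * β g⁻¹ (u j)) := by
    rw [star_sub, ← map_star, hu.star_eq, map_sub, hinv, ← h4, sub_mul, mul_sub, mul_sub, h3,
      hu.mul_eq hk]
    abel
  rw [h5]
  refine (norm_add_le _ _).trans ?_
  rw [StarAlgEquiv.norm_map]
  linarith [h1 _ ⟨g, hg, rfl⟩, h2 _ ⟨g, hg, rfl⟩]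

/-- One step of the recursive choice of the approximate unit: `p` is the member already chosen, and
`L`, `L'` delimit the indices of `u` used. An average of sufficiently late `u k` inherits every
estimate satisfied by each `u k`, while orthogonality makes the averaged commutators and translation
defects small. -/
theorem ApproxUnit.exists_next (hu : I.ApproxUnit u) (hI : I.StrictlyComplete)
    (hβI : ∀ g, ∀ x ∈ I.toSubspace, β g x ∈ I.toSubspace)
    (hβ : ∀ a ∈ I.toSubspace, Continuous fun g => β g a) {K : Set G} (hK : IsCompact K)
    {C : Set M} (hC : IsCompact C) (F : Finset M) {p : M} (hp : p ∈ I.toSubspace) {ε : ℝ}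
    (hε : 0 < ε) (L : ℕ) :
    ∃ e L', L ≤ L' ∧ (e ∈ I.toSubspace ∧ star e = e ∧ ‖e‖ ≤ 1 ∧ (∀ j < L, e * u j = u j) ∧
      ∀ j, L' < j → u j * e = e) ∧
      (∀ w ∈ C, ‖w - e * w‖ ≤ 2 * ‖I.mkHom w‖ + ε) ∧ (∀ x ∈ F, ‖e * x - x * e‖ ≤ ε) ∧
      (∀ g ∈ K, ‖β g e - e‖ ≤ ε) ∧ ∀ x ∈ F, ‖I.mkHom x‖ ≤ ‖x * (e - p)‖ + ε := by
  -- A test vector in the unit ball of `I` nearly attaining the norm of `x - x * p`, which is at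
  -- least the quotient norm of `x` because `x * p ∈ I`. On it a late average acts almost as the
  -- identity, so `x * (e - p)` is large as well.
  choose! a haI ha1 ha using fun x : M => hI.exists_norm_mul_ge (x - x * p) (half_pos hε)
  have hev1 := hu.eventually_forall_norm_sub_mul_le_mkHom hC hε
  have hev2 : ∀ᶠ k in atTop, ∀ x ∈ F, ‖x * (u k * a x) - x * a x‖ ≤ ε / 2 := by
    refine (Finset.eventually_all F).2 fun x _ => ?_
    filter_upwards [(Metric.tendsto_nhds.1 ((hu.tendsto_mul _ (haI x)).const_mul x)) (ε / 2)
      (half_pos hε)] with k hk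
    rw [dist_eq_norm] at hk
    exact hk.le
  obtain ⟨k₀, hk₀⟩ := eventually_atTop.1 (hev1.and hev2)
  -- Commutators and translation defects form one family, so that the same average serves both.
  let c : ℕ → F ⊕ K → M := fun k ω =>
    Sum.elim (fun x : F => u k * x - x * u k) (fun g : K => β g (u k) - u k) ω
  have hbound : ∀ k ω, ‖c k ω‖ ≤ 2 * ∑ x ∈ F, ‖x‖ + 2 := by
    rintro k (x | g)
    · have h1 : ‖(x : M)‖ ≤ ∑ x ∈ F, ‖x‖ :=
        Finset.single_le_sum (f := fun x : M => ‖x‖) (fun _ _ => norm_nonneg _) x.2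
      have h2 := norm_sub_le (u k * x) (x * u k)
      have h3 := hu.norm_mul_le k x
      have h4 := hu.norm_mul_le' k x
      change ‖u k * x - x * u k‖ ≤ _
      linarith
    · have h2 := norm_sub_le (β g (u k)) (u k)
      rw [StarAlgEquiv.norm_map] at h2
      have h3 := hu.norm_le_one k
      have h4 : 0 ≤ ∑ x ∈ F, ‖x‖ := Finset.sum_nonneg fun _ _ => norm_nonneg _
      change ‖β g (u k) - u k‖ ≤ _
      linarith
  have horth : ∀ j, ∀ η : ℝ, 0 < η → ∀ᶠ k in atTop, ∀ ω, ‖star (c k ω) * c j ω‖ ≤ η := by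
    intro j η hη
    have h1 : ∀ᶠ k in atTop, ∀ x ∈ F, ‖star (u k * x - x * u k) * (u j * x - x * u j)‖ ≤ η :=
      (Finset.eventually_all F).2 fun x _ => hu.eventually_commutator_orthogonal x j hη
    filter_upwards [h1, hu.eventually_translate_orthogonal hβI hβ hK j hη] with k h2 h3
    rintro (x | g)
    exacts [h2 x x.2, h3 g g.2]
  obtain ⟨s, hs, hsk, hsum⟩ := exists_small_average c hbound horth hε (max L k₀)
  have hsmall : ∀ ω, ‖average s fun i => c i ω‖ ≤ ε := fun ω =>
    norm_average_le_of_norm_sum_le hs (hsum ω)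
  have hsL : ∀ i ∈ s, L ≤ i := fun i hi => (le_max_left _ _).trans (hsk i hi)
  have hsk₀ : ∀ i ∈ s, k₀ ≤ i := fun i hi => (le_max_right _ _).trans (hsk i hi)
  refine ⟨average s u, max L (s.sup id), le_max_left _ _, ⟨?_, ?_, ?_, ?_, ?_⟩, ?_, ?_, ?_, ?_⟩
  · exact I.toSubspace.smul_mem _ (I.toSubspace.sum_mem fun i _ => hu.mem i)
  · rw [average, star_smul, star_sum, star_inv₀, star_natCast]
    simp only [hu.star_eq]
  · exact norm_average_le hs fun i _ => hu.norm_le_one i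
  · intro j hj
    rw [average_mul]
    exact average_const hs fun i hi => hu.mul_eq (hj.trans_le (hsL i hi))
  · intro j hj
    rw [mul_average]
    have : ∀ i ∈ s, i < j := fun i hi =>
      ((Finset.le_sup (f := id) hi).trans (le_max_right _ _)).trans_lt hj
    rw [average, Finset.sum_congr rfl fun i hi => hu.mul_eq (this i hi), average]
  · intro w hw
    rw [norm_sub_rev, average_mul]
    refine norm_average_sub_le hs fun i hi => ?_
    rw [norm_sub_rev]
    exact (hk₀ i (hsk₀ i hi)).1 w hw
  · intro x hx
    rw [average_mul, mul_average, ← average_sub]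
    exact hsmall (Sum.inl ⟨x, hx⟩)
  · intro g hg
    have : β g (average s u) = average s fun i => β g (u i) := by
      rw [average, map_smul, map_sum, average]
    rw [this, ← average_sub]
    exact hsmall (Sum.inr ⟨g, hg⟩)
  · intro x hx
    have h1 : ‖x * (average s u * a x) - x * a x‖ ≤ ε / 2 := by
      rw [average_mul, mul_average]
      exact norm_average_sub_le hs fun i hi => (hk₀ i (hsk₀ i hi)).2 x hx
    have h2 : (x - x * p) * a x =
        x * (average s u - p) * a x - (x * (average s u * a x) - x * a x) := by noncomm_ring
    have h3 : ‖x * (average s u - p) * a x‖ ≤ ‖x * (average s u - p)‖ :=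
      (_root_.norm_mul_le _ _).trans (mul_le_of_le_one_right (norm_nonneg _) (ha1 x))
    have h4 := ha x
    rw [h2] at h4
    have h5 := norm_sub_le (x * (average s u - p) * a x) (x * (average s u * a x) - x * a x)
    have h6 := I.norm_mkHom_le (x - x * p)
    rw [I.mkHom_sub_of_mem (I.mul_left_mem x hp)] at h6
    linarith

/-- Existence of an approximate unit that is quasi-central, asymptotically invariant, and
compatible with the quotient norm for prescribed sequences of compact sets. -/
theorem ApproxUnit.exists_quasicentral (hu : I.ApproxUnit u) (hI : I.StrictlyComplete)
    (hβI : ∀ g, ∀ x ∈ I.toSubspace, β g x ∈ I.toSubspace)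
    (hβ : ∀ a ∈ I.toSubspace, Continuous fun g => β g a) {K : ℕ → Set G}
    (hK : ∀ n, IsCompact (K n)) {C : ℕ → Set M} (hC : ∀ n, IsCompact (C n)) (F : ℕ → Finset M) :
    ∃ e, I.ApproxUnit e ∧ (∀ n, ∀ w ∈ C n, ‖w - e n * w‖ ≤ 2 * ‖I.mkHom w‖ + (1 / 2) ^ n) ∧
      (∀ n, ∀ x ∈ F n, ‖e n * x - x * e n‖ ≤ (1 / 2) ^ n) ∧
      (∀ n, ∀ g ∈ K n, ‖β g (e n) - e n‖ ≤ (1 / 2) ^ n) ∧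
      ∀ n, ∀ x ∈ F (n + 1), ‖I.mkHom x‖ ≤ ‖x * (e (n + 1) - e n)‖ + (1 / 2) ^ (n + 1) := by
  -- The index `L' + 1` lies beyond `L'` and below `L' + 2`. So `u (L' + 1)` fixes the old member
  -- and is fixed by all later ones, which yields `e n * e m = e m`. The shift also makes the
  -- indices increase strictly.
  have step := fun (n : ℕ) (p : I.toSubspace × ℕ) =>
    hu.exists_next hI hβI hβ (hK n) (hC n) (F n) p.1.2 (ε := (1 / 2) ^ n) (by positivity) (p.2 + 2)
  choose e' L' h using step
  let f : ℕ → I.toSubspace × ℕ := fun n =>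
    Nat.rec (⟨e' 0 0, (h 0 0).2.1.1⟩, L' 0 0)
      (fun n p => (⟨e' (n + 1) p, (h (n + 1) p).2.1.1⟩, L' (n + 1) p)) n
  -- Before stage `0` the member is `0` and the index bound is `0`.
  let prev : ℕ → I.toSubspace × ℕ := fun n => Nat.casesOn n 0 f
  have hf : ∀ n, ((f n).1 : M) = e' n (prev n) := fun n => by cases n <;> rfl
  have hf2 : ∀ n, (f n).2 = L' n (prev n) := fun n => by cases n <;> rfl
  have hL : ∀ n, (f n).2 + 2 ≤ (f (n + 1)).2 := fun n => by
    rw [hf2 (n + 1)]; exact (h (n + 1) (f n)).1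
  have hLmono : StrictMono fun n => (f n).2 := strictMono_nat_of_lt_succ fun n => by
    have := hL n; omega
  have hun : ∀ n j, j ≤ n → e' n (prev n) * u j = u j := by
    intro n j hj
    refine (h n (prev n)).2.1.2.2.2.1 j ?_
    cases n with
    | zero => omega
    | succ n =>
      have h1 : n ≤ (f n).2 := hLmono.le_apply
      change j < (f n).2 + 2
      omega
  refine ⟨fun n => (f n).1, ⟨fun n => (f n).1.2, ?_, ?_, ?_, ?_⟩, ?_, ?_, ?_, ?_⟩
  · intro n
    simp only [hf]
    exact (h n (prev n)).2.1.2.1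
  · intro n
    simp only [hf]
    exact (h n (prev n)).2.1.2.2.1
  · intro m n hmn
    obtain ⟨n, rfl⟩ : ∃ k, n = k + 1 := ⟨n - 1, by omega⟩
    have h1 : u ((f m).2 + 1) * (f m).1 = (f m).1 := by
      have := (h m (prev m)).2.1.2.2.2.2 ((f m).2 + 1)
      rw [← hf, ← hf2] at this
      exact this (Nat.lt_succ_self _)
    have h2 : ((f (n + 1)).1 : M) * u ((f m).2 + 1) = u ((f m).2 + 1) := by
      refine (congrArg (· * u ((f m).2 + 1)) (hf (n + 1))).trans ?_
      refine (h (n + 1) (f n)).2.1.2.2.2.1 _ ?_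
      have : (f m).2 ≤ (f n).2 := hLmono.monotone (by omega : m ≤ n)
      omega
    rw [← h1, ← mul_assoc, h2]
  · intro a ha
    rw [Metric.tendsto_atTop]
    intro ε hε
    obtain ⟨j, hj⟩ := (hu.eventually_norm_sub_mul_le ha (δ := ε / 4) (by positivity)).exists
    refine ⟨j, fun n hn => ?_⟩
    simp only [hf, dist_eq_norm]
    have h1 : e' n (prev n) * a - a =
        e' n (prev n) * (a - u j * a) - (a - u j * a) := by
      rw [mul_sub, ← mul_assoc, hun n j hn]; abel
    have h2 : ‖e' n (prev n) * (a - u j * a)‖ ≤ ‖a - u j * a‖ :=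
      (_root_.norm_mul_le _ _).trans
        (mul_le_of_le_one_left (norm_nonneg _) (h n (prev n)).2.1.2.2.1)
    rw [h1]
    refine (norm_sub_le _ _).trans_lt ?_
    linarith
  · intro n w hw
    simp only [hf]
    exact (h n (prev n)).2.2.1 w hw
  · intro n x hx
    simp only [hf]
    exact (h n (prev n)).2.2.2.1 x hx
  · intro n g hg
    simp only [hf]
    exact (h n (prev n)).2.2.2.2.1 g hg
  · intro n x hx
    exact (h (n + 1) (f n)).2.2.2.2.2 x hx

end Selection

end CStarIdeal

/-! ### Sums of orthogonal families -/

section Orthogonal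

variable {N : Type u} [NonUnitalCStarAlgebra N]

/-- `star (a + b) * (a + b)` is a sum of two self-adjoint elements with product zero, and its norm
is the maximum of theirs. -/
theorem norm_add_le_of_orthogonal {a b : N} (h1 : star a * b = 0) (h2 : a * star b = 0) {R : ℝ}
    (ha : ‖a‖ ≤ R) (hb : ‖b‖ ≤ R) : ‖a + b‖ ≤ R := by
  have hR : 0 ≤ R := (norm_nonneg _).trans ha
  have h3 : star b * a = 0 := by simpa using congrArg star h1
  have h4 : star (a + b) * (a + b) = star a * a + star b * b := by
    rw [star_add, add_mul, mul_add, mul_add, h1, h3, add_zero, zero_add]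
  have h5 : star a * a * (star b * b) = 0 := by
    rw [mul_assoc, ← mul_assoc a, h2, zero_mul, mul_zero]
  refine abs_le_of_sq_le_sq' ?_ hR |>.2
  rw [sq, ← CStarRing.norm_star_mul_self, h4,
    (IsSelfAdjoint.star_mul_self a).norm_add_eq_max (IsSelfAdjoint.star_mul_self b) h5,
    CStarRing.norm_star_mul_self, CStarRing.norm_star_mul_self, ← sq, ← sq]
  exact max_le (pow_le_pow_left₀ (norm_nonneg _) ha 2) (pow_le_pow_left₀ (norm_nonneg _) hb 2)

theorem norm_sum_le_of_orthogonal (s : Finset ℕ) {z : ℕ → N}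
    (h1 : ∀ i ∈ s, ∀ j ∈ s, i ≠ j → star (z i) * z j = 0)
    (h2 : ∀ i ∈ s, ∀ j ∈ s, i ≠ j → z i * star (z j) = 0) {R : ℝ} (hR0 : 0 ≤ R)
    (hR : ∀ i ∈ s, ‖z i‖ ≤ R) : ‖∑ i ∈ s, z i‖ ≤ R := by
  classical
  induction s using Finset.induction with
  | empty => simpa using hR0
  | insert k s hk ih =>
    have hmem : ∀ i ∈ s, i ∈ insert k s := fun i hi => Finset.mem_insert_of_mem hi
    have hkm := Finset.mem_insert_self k s
    have hne : ∀ i ∈ s, k ≠ i := fun i hi => fun h => hk (h ▸ hi)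
    rw [Finset.sum_insert hk]
    refine norm_add_le_of_orthogonal ?_ ?_ (hR k hkm)
      (ih (fun i hi j hj => h1 i (hmem i hi) j (hmem j hj))
        (fun i hi j hj => h2 i (hmem i hi) j (hmem j hj)) fun i hi => hR i (hmem i hi))
    · rw [Finset.mul_sum]
      exact Finset.sum_eq_zero fun i hi => h1 k hkm i (hmem i hi) (hne i hi)
    · rw [star_sum, Finset.mul_sum]
      exact Finset.sum_eq_zero fun i hi => h2 k hkm i (hmem i hi) (hne i hi)

end Orthogonal

namespace CStarIdeal

variable {M : Type u} [CStarAlgebra M] {I : CStarIdeal M}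

/-! ### Strict limits -/

variable (I) in
/-- Convergence of a sequence in the strict topology defined by the ideal `I`. -/
def StrictLim (S : ℕ → M) (x : M) : Prop :=
  ∀ a ∈ I.toSubspace, Tendsto (fun n => S n * a) atTop (𝓝 (x * a)) ∧
    Tendsto (fun n => a * S n) atTop (𝓝 (a * x))

namespace StrictLim

variable {S T : ℕ → M} {x y : M}

theorem congr (h : I.StrictLim S x) (hST : ∀ n, S n = T n) : I.StrictLim T x := by
  rwa [show T = S from funext fun n => (hST n).symm]

theorem add (h : I.StrictLim S x) (h' : I.StrictLim T y) :
    I.StrictLim (fun n => S n + T n) (x + y) := fun a ha =>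
  ⟨by simpa only [add_mul] using (h a ha).1.add (h' a ha).1,
    by simpa only [mul_add] using (h a ha).2.add (h' a ha).2⟩

theorem sub (h : I.StrictLim S x) (h' : I.StrictLim T y) :
    I.StrictLim (fun n => S n - T n) (x - y) := fun a ha =>
  ⟨by simpa only [sub_mul] using (h a ha).1.sub (h' a ha).1,
    by simpa only [mul_sub] using (h a ha).2.sub (h' a ha).2⟩

theorem const_smul (h : I.StrictLim S x) (c : ℂ) :
    I.StrictLim (fun n => c • S n) (c • x) := fun a ha =>
  ⟨by simpa only [smul_mul_assoc] using (h a ha).1.const_smul c,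
    by simpa only [mul_smul_comm] using (h a ha).2.const_smul c⟩

theorem const_mul (h : I.StrictLim S x) (w : M) :
    I.StrictLim (fun n => w * S n) (w * x) := fun a ha =>
  ⟨by simpa only [mul_assoc] using (h a ha).1.const_mul w,
    by simpa only [mul_assoc] using (h (a * w) (I.mul_right_mem w ha)).2⟩

theorem star (h : I.StrictLim S x) : I.StrictLim (fun n => star (S n)) (star x) := fun a ha => by
  have h' := h (Star.star a) (I.star_mem ha)
  exact ⟨by simpa only [star_mul, star_star] using h'.2.star,
    by simpa only [star_mul, star_star] using h'.1.star⟩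

theorem of_tendsto (h : Tendsto S atTop (𝓝 x)) : I.StrictLim S x := fun a _ =>
  ⟨h.mul_const a, h.const_mul a⟩

theorem unique (hI : I.StrictlyComplete) (h : I.StrictLim S x) (h' : I.StrictLim S y) : x = y := by
  rw [← sub_eq_zero]
  refine hI.eq_zero fun a ha => ?_
  rw [sub_mul, sub_eq_zero]
  exact tendsto_nhds_unique (h a ha).1 (h' a ha).1

theorem norm_le (hI : I.StrictlyComplete) (h : I.StrictLim S x) {R : ℝ} (hR : 0 ≤ R)
    (hS : ∀ᶠ n in atTop, ‖S n‖ ≤ R) : ‖x‖ ≤ R := by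
  refine hI.norm_le x R hR fun a ha ha1 => le_of_tendsto (h a ha).1.norm ?_
  filter_upwards [hS] with n hn
  calc ‖S n * a‖ ≤ ‖S n‖ * ‖a‖ := norm_mul_le _ _
    _ ≤ R * 1 := by gcongr
    _ = R := mul_one R

theorem map (h : I.StrictLim S x) (σ : M ≃⋆ₐ[ℂ] M) (hσ : ∀ a ∈ I.toSubspace, σ.symm a ∈ I.toSubspace) :
    I.StrictLim (fun n => σ (S n)) (σ x) := fun a ha => by
  have hc : Continuous σ := AddMonoidHomClass.continuous_of_bound σ 1 fun y => by
    rw [StarAlgEquiv.norm_map, one_mul]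
  have h' := h _ (hσ a ha)
  exact ⟨by simpa [Function.comp_def] using (hc.tendsto _).comp h'.1, by simpa [Function.comp_def] using (hc.tendsto _).comp h'.2⟩

end StrictLim

/-- A strictly convergent series in `I` with summable norms has its sum in `I`. -/
theorem StrictlyComplete.mem_of_summable (hI : I.StrictlyComplete) {z : ℕ → M} {x : M}
    (h : I.StrictLim (fun N => ∑ n ∈ Finset.range N, z n) x) (hz : ∀ n, z n ∈ I.toSubspace)
    {C : ℝ} (hC : ∀ᶠ n in atTop, ‖z n‖ ≤ C * (1 / 2) ^ n) : x ∈ I.toSubspace := by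
  have hs : Summable z := by
    refine Summable.of_norm_bounded_eventually (summable_geometric_two.mul_left C) ?_
    rwa [Nat.cofinite_eq_atTop]
  have h1 := hs.hasSum.tendsto_sum_nat
  rw [h.unique hI (StrictLim.of_tendsto h1)]
  exact I.isClosed'.mem_of_tendsto h1
    (Eventually.of_forall fun N => I.toSubspace.sum_mem fun n _ => hz n)

/-! ### Block sequences -/

/-- A sequence `z` whose `n`-th member is supported, on both sides, near the `n`-th position of
the approximate unit `e`. -/
structure Block (e : ℕ → M) (c : ℕ) (z : ℕ → M) : Prop where
  left_zero : ∀ {k n}, k + c ≤ n → e k * z n = 0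
  right_zero : ∀ {k n}, k + c ≤ n → z n * e k = 0
  left_id : ∀ {k n}, n + c ≤ k → e k * z n = z n
  right_id : ∀ {k n}, n + c ≤ k → z n * e k = z n

namespace Block

variable {e z z' : ℕ → M} {c : ℕ}

theorem mono (h : Block e c z) {c' : ℕ} (hc : c ≤ c') : Block e c' z :=
  ⟨fun hk => h.left_zero (by omega), fun hk => h.right_zero (by omega),
    fun hk => h.left_id (by omega), fun hk => h.right_id (by omega)⟩

theorem sub (h : Block e c z) (h' : Block e c z') : Block e c fun n => z n - z' n :=
  ⟨fun hk => by rw [mul_sub, h.left_zero hk, h'.left_zero hk, sub_zero],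
    fun hk => by rw [sub_mul, h.right_zero hk, h'.right_zero hk, sub_zero],
    fun hk => by rw [mul_sub, h.left_id hk, h'.left_id hk],
    fun hk => by rw [sub_mul, h.right_id hk, h'.right_id hk]⟩

theorem star (he : I.ApproxUnit e) (h : Block e c z) : Block e c fun n => star (z n) := by
  refine ⟨fun {k n} hk => ?_, fun {k n} hk => ?_, fun {k n} hk => ?_, fun {k n} hk => ?_⟩
  · rw [← he.star_eq k, ← star_mul, h.right_zero hk, star_zero]
  · rw [← he.star_eq k, ← star_mul, h.left_zero hk, star_zero]
  · rw [← he.star_eq k, ← star_mul, h.right_id hk]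
  · rw [← he.star_eq k, ← star_mul, h.left_id hk]

theorem star_mul_eq_zero_of_le (he : I.ApproxUnit e) (h : Block e c z) {n m : ℕ}
    (hnm : n + 2 * c ≤ m) : Star.star (z n) * z m = 0 := by
  rw [← (h.star he).right_id (le_refl (n + c)), mul_assoc, h.left_zero (by omega), mul_zero]

theorem star_mul_eq_zero (he : I.ApproxUnit e) (h : Block e c z) {n m : ℕ}
    (hnm : n + 2 * c ≤ m ∨ m + 2 * c ≤ n) : Star.star (z n) * z m = 0 := by
  rcases hnm with hnm | hnm
  · exact h.star_mul_eq_zero_of_le he hnm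
  · simpa using congrArg Star.star (h.star_mul_eq_zero_of_le he hnm)

/-- Members at distance at least `2 * c` are orthogonal on both sides. Within a residue class modulo
`2 * c` the sum is therefore bounded by `R`, and there are `2 * c` classes. -/
theorem norm_sum_le (he : I.ApproxUnit e) (h : Block e c z) (hc : 0 < c) (s : Finset ℕ) {R : ℝ}
    (hR0 : 0 ≤ R) (hR : ∀ n ∈ s, ‖z n‖ ≤ R) : ‖∑ n ∈ s, z n‖ ≤ 2 * c * R := by
  have hsep : ∀ n m : ℕ, n % (2 * c) = m % (2 * c) → n ≠ m →
      n + 2 * c ≤ m ∨ m + 2 * c ≤ n := by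
    intro n m h1 h2
    have h3 := Nat.div_add_mod n (2 * c)
    have h4 := Nat.div_add_mod m (2 * c)
    rcases lt_trichotomy (n / (2 * c)) (m / (2 * c)) with h5 | h5 | h5
    · left
      have := Nat.mul_le_mul_left (2 * c) h5
      rw [Nat.succ_eq_add_one, mul_add, mul_one] at this
      omega
    · rw [h5] at h3
      omega
    · right
      have := Nat.mul_le_mul_left (2 * c) h5
      rw [Nat.succ_eq_add_one, mul_add, mul_one] at this
      omega
  rw [← Finset.sum_fiberwise_of_maps_to (s := s) (t := Finset.range (2 * c))
    (g := fun n => n % (2 * c)) fun n _ => Finset.mem_range.2 (Nat.mod_lt _ (by omega))]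
  refine (norm_sum_le_of_le (n := fun _ => R) _ fun r _ => ?_).trans (by simp)
  refine norm_sum_le_of_orthogonal _ (fun i hi j hj hij => ?_) (fun i hi j hj hij => ?_) hR0
    fun i hi => hR i (Finset.mem_filter.1 hi).1
  · exact h.star_mul_eq_zero he
      (hsep i j ((Finset.mem_filter.1 hi).2.trans (Finset.mem_filter.1 hj).2.symm) hij)
  · have := (h.star he).star_mul_eq_zero he
      (hsep i j ((Finset.mem_filter.1 hi).2.trans (Finset.mem_filter.1 hj).2.symm) hij)
    rwa [star_star] at this

/-- A tail `T` starting at `k + c` annihilates `e k`, so `T * a = T * (a - e k * a)`; the tails are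
uniformly bounded and `a - e k * a` is small. -/
theorem cauchySeq_sum_mul (he : I.ApproxUnit e) (h : Block e c z) (hc : 0 < c) {R : ℝ}
    (hR : ∀ n, ‖z n‖ ≤ R) {a : M} (ha : a ∈ I.toSubspace) :
    CauchySeq fun N => (∑ n ∈ Finset.range N, z n) * a := by
  have hR0 : 0 ≤ R := (norm_nonneg _).trans (hR 0)
  rw [Metric.cauchySeq_iff']
  intro ε hε
  have hδ : 0 < ε / (2 * (2 * c * R + 1)) := by positivity
  obtain ⟨k, hk⟩ := (he.eventually_norm_sub_mul_le ha hδ).exists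
  refine ⟨k + c, fun N hN => ?_⟩
  obtain ⟨p, rfl⟩ := Nat.exists_eq_add_of_le hN
  rw [dist_eq_norm, ← sub_mul, Finset.sum_range_add_sub_sum_range]
  set T := ∑ n ∈ Finset.range p, z (k + c + n) with hT
  have hTe : T * e k = 0 := by
    rw [hT, Finset.sum_mul]
    exact Finset.sum_eq_zero fun n _ => h.right_zero (by omega)
  have hTn : ‖T‖ ≤ 2 * c * R := by
    have : T = ∑ n ∈ Finset.Ico (k + c) (k + c + p), z n := by
      rw [hT, Finset.sum_Ico_eq_sum_range]; simp
    rw [this]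
    exact h.norm_sum_le he hc _ hR0 fun n _ => hR n
  have h1 : T * a = T * (a - e k * a) := by rw [mul_sub, ← mul_assoc, hTe, zero_mul, sub_zero]
  rw [h1]
  calc ‖T * (a - e k * a)‖ ≤ ‖T‖ * ‖a - e k * a‖ := norm_mul_le _ _
    _ ≤ (2 * c * R + 1) * (ε / (2 * (2 * c * R + 1))) := by gcongr; linarith
    _ = ε / 2 := by field_simp
    _ < ε := half_lt_self hε

theorem exists_strictLim (hI : I.StrictlyComplete) (he : I.ApproxUnit e) (h : Block e c z)
    (hc : 0 < c) {R : ℝ} (hR : ∀ n, ‖z n‖ ≤ R) :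
    ∃ x, I.StrictLim (fun N => ∑ n ∈ Finset.range N, z n) x := by
  have hR0 : 0 ≤ R := (norm_nonneg _).trans (hR 0)
  refine hI.exists_limit _ ⟨2 * c * R, fun N => h.norm_sum_le he hc _ hR0 fun n _ => hR n⟩
    (fun a ha => h.cauchySeq_sum_mul he hc hR ha) fun a ha => ?_
  have h1 := (h.star he).cauchySeq_sum_mul he hc (fun n => (norm_star (z n)).trans_le (hR n))
    (I.star_mem ha)
  rw [Metric.cauchySeq_iff'] at h1 ⊢
  intro ε hε
  obtain ⟨N, hN⟩ := h1 ε hε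
  refine ⟨N, fun n hn => ?_⟩
  have := hN n hn
  rwa [dist_eq_norm, ← star_sum, ← star_sum, ← star_mul, ← star_mul, ← star_sub, norm_star,
    ← dist_eq_norm] at this

/-- A finite partial sum lies in `I` and can be discarded, so only the tail of the sequence counts.
-/
theorem norm_mkHom_le (hI : I.StrictlyComplete) (he : I.ApproxUnit e) (h : Block e c z)
    (hc : 0 < c) (hz : ∀ n, z n ∈ I.toSubspace) {x : M}
    (hx : I.StrictLim (fun N => ∑ n ∈ Finset.range N, z n) x) {R : ℝ} (hR0 : 0 ≤ R)
    (hR : ∀ᶠ n in atTop, ‖z n‖ ≤ R) : ‖I.mkHom x‖ ≤ 2 * c * R := by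
  obtain ⟨p, hp⟩ := eventually_atTop.1 hR
  set y := ∑ n ∈ Finset.range p, z n with hy
  have hyI : y ∈ I.toSubspace := I.toSubspace.sum_mem fun n _ => hz n
  rw [← I.mkHom_sub_of_mem hyI]
  refine (I.norm_mkHom_le _).trans
    ((hx.sub (StrictLim.of_tendsto tendsto_const_nhds)).norm_le hI (by positivity) ?_)
  filter_upwards [eventually_ge_atTop p] with N hN
  rw [← Finset.sum_Ico_eq_sub _ hN]
  exact h.norm_sum_le he hc _ hR0 fun n hn => hp n (Finset.mem_Ico.1 hn).1

/-- In contrast to `mem_of_summable` no rate of decay is needed, thanks to the orthogonality of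
distant blocks. -/
theorem mem_of_tendsto_zero (hI : I.StrictlyComplete) (he : I.ApproxUnit e) (h : Block e c z)
    (hc : 0 < c) (hz : ∀ n, z n ∈ I.toSubspace) {x : M}
    (hx : I.StrictLim (fun N => ∑ n ∈ Finset.range N, z n) x)
    (h0 : Tendsto z atTop (𝓝 0)) : x ∈ I.toSubspace := by
  rw [← I.mkHom_eq_zero, ← norm_le_zero_iff]
  refine le_of_forall_pos_le_add fun ε hε => ?_
  have hc' : (0 : ℝ) < c := by exact_mod_cast hc
  have h1 : ∀ᶠ n in atTop, ‖z n‖ ≤ ε / (2 * c) := by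
    filter_upwards [(Metric.tendsto_nhds.1 h0) (ε / (2 * c)) (by positivity)] with n hn
    rw [dist_zero_right] at hn
    exact hn.le
  refine (h.norm_mkHom_le hI he hc hz hx (by positivity) h1).trans (le_of_eq ?_)
  field_simp
  ring

end Block

end CStarIdeal

namespace CStarIdeal

variable {M : Type u} [CStarAlgebra M] {I : CStarIdeal M}

/-! ### Gluing a sequence along an approximate unit -/

/-- The successive differences of an approximate unit. -/
def bump (e : ℕ → M) (n : ℕ) : M := e (n + 2) - e (n + 1)

/-- A difference that acts as a unit on the corresponding `bump`. -/
def wide (e : ℕ → M) (n : ℕ) : M := e (n + 3) - e n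

namespace ApproxUnit

variable {e : ℕ → M}

theorem bump_mem (he : I.ApproxUnit e) (n : ℕ) : bump e n ∈ I.toSubspace :=
  sub_mem (he.mem _) (he.mem _)

theorem norm_bump_le (he : I.ApproxUnit e) (n : ℕ) : ‖bump e n‖ ≤ 2 := by
  have := norm_sub_le (e (n + 2)) (e (n + 1))
  have h1 := he.norm_le_one (n + 2)
  have h2 := he.norm_le_one (n + 1)
  unfold bump
  linarith

theorem norm_wide_le (he : I.ApproxUnit e) (n : ℕ) : ‖wide e n‖ ≤ 2 := by
  have := norm_sub_le (e (n + 3)) (e n)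
  have h1 := he.norm_le_one (n + 3)
  have h2 := he.norm_le_one n
  unfold wide
  linarith

theorem star_bump (he : I.ApproxUnit e) (n : ℕ) : star (bump e n) = bump e n := by
  rw [bump, star_sub, he.star_eq, he.star_eq]

theorem star_wide (he : I.ApproxUnit e) (n : ℕ) : star (wide e n) = wide e n := by
  rw [wide, star_sub, he.star_eq, he.star_eq]

theorem mul_bump_eq_zero (he : I.ApproxUnit e) {k n : ℕ} (h : k ≤ n) : e k * bump e n = 0 := by
  rw [bump, mul_sub, he.mul_eq' (by omega), he.mul_eq' (by omega), sub_self]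

theorem bump_mul_eq_zero (he : I.ApproxUnit e) {k n : ℕ} (h : k ≤ n) : bump e n * e k = 0 := by
  rw [bump, sub_mul, he.mul_eq (by omega), he.mul_eq (by omega), sub_self]

theorem mul_bump (he : I.ApproxUnit e) {k n : ℕ} (h : n + 3 ≤ k) : e k * bump e n = bump e n := by
  rw [bump, mul_sub, he.mul_eq (by omega), he.mul_eq (by omega)]

theorem wide_mul_eq_zero (he : I.ApproxUnit e) {k n : ℕ} (h : k < n) : wide e n * e k = 0 := by
  rw [wide, sub_mul, he.mul_eq (by omega), he.mul_eq (by omega), sub_self]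

theorem wide_mul (he : I.ApproxUnit e) {k n : ℕ} (h : n + 4 ≤ k) : wide e n * e k = wide e n := by
  rw [wide, sub_mul, he.mul_eq' (by omega), he.mul_eq' (by omega)]

theorem wide_mul_bump (he : I.ApproxUnit e) (n : ℕ) : wide e n * bump e n = bump e n := by
  rw [wide, sub_mul, he.mul_bump (by omega), he.mul_bump_eq_zero le_rfl, sub_zero]

theorem bump_mul_wide (he : I.ApproxUnit e) (n : ℕ) : bump e n * wide e n = bump e n := by
  simpa [star_mul, he.star_bump, he.star_wide] using congrArg star (he.wide_mul_bump n)

theorem wide_mul_bump_eq_zero (he : I.ApproxUnit e) {m n : ℕ} (h : n + 3 ≤ m ∨ m + 3 ≤ n) :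
    wide e n * bump e m = 0 := by
  rcases h with h | h
  · rw [wide, sub_mul, he.mul_bump_eq_zero h, he.mul_bump_eq_zero (by omega), sub_zero]
  · rw [wide, sub_mul, he.mul_bump h, he.mul_bump (by omega), sub_self]

theorem tendsto_mul_bump (he : I.ApproxUnit e) {a : M} (ha : a ∈ I.toSubspace) :
    Tendsto (fun n => a * bump e n) atTop (𝓝 0) := by
  have h := he.tendsto_mul' ha
  have h1 := ((tendsto_add_atTop_iff_nat 2).2 h).sub ((tendsto_add_atTop_iff_nat 1).2 h)
  rw [sub_self] at h1
  simpa only [bump, mul_sub] using h1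

theorem sum_bump (e : ℕ → M) (N : ℕ) :
    ∑ n ∈ Finset.range N, bump e n = e (N + 1) - e 1 :=
  Finset.sum_range_sub (fun n => e (n + 1)) N

end ApproxUnit

/-- The `n`-th term of the series gluing the sequence `x` along `e`. -/
def glueTerm (e x : ℕ → M) (n : ℕ) : M := bump e n * x n * wide e n

variable (I) in
/-- `X` is the strict sum of the compressions of `x n` to the `n`-th block of `e`. -/
def IsGlue (e x : ℕ → M) (X : M) : Prop :=
  I.StrictLim (fun N => ∑ n ∈ Finset.range N, glueTerm e x n) X

/-- A sequence almost commuting with the approximate unit `e`. -/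
def AlmostCommutes (e x : ℕ → M) : Prop :=
  ∀ᶠ n in atTop, ∀ m ≤ n + 8, ‖e n * x m - x m * e n‖ ≤ (1 / 2) ^ n

/-- A sequence that is slowly varying modulo the ideal, seen through the approximate unit `e`. -/
def SlowlyVarying (e x : ℕ → M) : Prop :=
  ∀ j < 5, Tendsto (fun p => (x (p + j) - x (p + 2)) - e p * (x (p + j) - x (p + 2))) atTop (𝓝 0)

section

variable {e x y : ℕ → M} {X Y Z : M} {R : ℝ}

theorem glueTerm_mem (he : I.ApproxUnit e) (x : ℕ → M) (n : ℕ) :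
    glueTerm e x n ∈ I.toSubspace :=
  I.mul_right_mem _ (I.mul_right_mem _ (he.bump_mem n))

theorem block_glueTerm (he : I.ApproxUnit e) (x : ℕ → M) : Block e 4 (glueTerm e x) := by
  refine ⟨fun {k n} h => ?_, fun {k n} h => ?_, fun {k n} h => ?_, fun {k n} h => ?_⟩
  · rw [glueTerm, ← mul_assoc, ← mul_assoc, he.mul_bump_eq_zero (by omega), zero_mul, zero_mul]
  · rw [glueTerm, mul_assoc, he.wide_mul_eq_zero (by omega), mul_zero]
  · rw [glueTerm, ← mul_assoc, ← mul_assoc, he.mul_bump (by omega)]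
  · rw [glueTerm, mul_assoc, he.wide_mul (by omega)]

theorem ApproxUnit.norm_bump_mul_mul_wide_le (he : I.ApproxUnit e) (n : ℕ) (w : M) :
    ‖bump e n * w * wide e n‖ ≤ 4 * ‖w‖ := by
  calc ‖bump e n * w * wide e n‖ ≤ ‖bump e n‖ * ‖w‖ * ‖wide e n‖ := norm_mul₃_le
    _ ≤ 2 * ‖w‖ * 2 := by
      gcongr
      exacts [he.norm_bump_le n, he.norm_wide_le n]
    _ = 4 * ‖w‖ := by ring

theorem exists_isGlue (hI : I.StrictlyComplete) (he : I.ApproxUnit e) (hx : ∀ n, ‖x n‖ ≤ R) :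
    ∃ X, I.IsGlue e x X :=
  (block_glueTerm he x).exists_strictLim hI he (by norm_num) (R := 4 * R) fun n =>
    (he.norm_bump_mul_mul_wide_le n (x n)).trans (by linarith [hx n])

theorem IsGlue.add (hX : I.IsGlue e x X) (hY : I.IsGlue e y Y) :
    I.IsGlue e (fun n => x n + y n) (X + Y) :=
  (StrictLim.add hX hY).congr fun N => by
    simp only [glueTerm, mul_add, add_mul, Finset.sum_add_distrib]

theorem IsGlue.sub (hX : I.IsGlue e x X) (hY : I.IsGlue e y Y) :
    I.IsGlue e (fun n => x n - y n) (X - Y) :=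
  (StrictLim.sub hX hY).congr fun N => by
    simp only [glueTerm, mul_sub, sub_mul, Finset.sum_sub_distrib]

theorem IsGlue.const_smul (hX : I.IsGlue e x X) (c : ℂ) :
    I.IsGlue e (fun n => c • x n) (c • X) :=
  (StrictLim.const_smul hX c).congr fun N => by
    simp only [glueTerm, mul_smul_comm, smul_mul_assoc, Finset.smul_sum]

/-- The norm modulo `I` of the result of gluing is controlled by the tails of the sequence. -/
theorem IsGlue.norm_mkHom_le (hI : I.StrictlyComplete) (he : I.ApproxUnit e)
    (hX : I.IsGlue e x X) {r : ℝ} (hr : 0 ≤ r) (hx : ∀ᶠ n in atTop, ‖x n - e n * x n‖ ≤ r) :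
    ‖I.mkHom X‖ ≤ 32 * r := by
  refine ((block_glueTerm he x).norm_mkHom_le hI he (by norm_num) (glueTerm_mem he x) hX
    (R := 4 * r) (by positivity) ?_).trans (le_of_eq (by push_cast; ring))
  filter_upwards [hx] with n hn
  -- As `bump e n * e n = 0`, only the part of `x n` cut off by `1 - e n` enters. The constant `32`
  -- is `2 * 4` from the block width times `4` from the norms of `bump` and `wide`.
  have h1 : glueTerm e x n = bump e n * (x n - e n * x n) * wide e n := by
    rw [mul_sub, ← mul_assoc, he.bump_mul_eq_zero le_rfl, zero_mul, sub_zero, glueTerm]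
  rw [h1]
  exact (he.norm_bump_mul_mul_wide_le n _).trans (by linarith)

/-! ### Commutators with the bumps -/

theorem norm_commutator_sub_le {a b w : M} {r s : ℝ} (h1 : ‖a * w - w * a‖ ≤ r)
    (h2 : ‖b * w - w * b‖ ≤ s) : ‖(a - b) * w - w * (a - b)‖ ≤ r + s := by
  have h : (a - b) * w - w * (a - b) = (a * w - w * a) - (b * w - w * b) := by noncomm_ring
  rw [h]
  exact (norm_sub_le _ _).trans (add_le_add h1 h2)

theorem half_pow_add_le (n k : ℕ) : ((1 : ℝ) / 2) ^ (n + k) ≤ (1 / 2) ^ n :=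
  pow_le_pow_of_le_one (by norm_num) (by norm_num) (Nat.le_add_right n k)

theorem AlmostCommutes.bump (h : AlmostCommutes e x) :
    ∀ᶠ n in atTop, ∀ m ≤ n + 8, ‖bump e n * x m - x m * bump e n‖ ≤ 2 * (1 / 2) ^ n := by
  filter_upwards [(tendsto_add_atTop_nat 2).eventually h, (tendsto_add_atTop_nat 1).eventually h]
    with n h2 h1 m hm
  refine (norm_commutator_sub_le (h2 m (by omega)) (h1 m (by omega))).trans ?_
  linarith [half_pow_add_le n 2, half_pow_add_le n 1]

theorem AlmostCommutes.wide (h : AlmostCommutes e x) :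
    ∀ᶠ n in atTop, ∀ m ≤ n + 8, ‖wide e n * x m - x m * wide e n‖ ≤ 2 * (1 / 2) ^ n := by
  filter_upwards [(tendsto_add_atTop_nat 3).eventually h, h] with n h2 h1 m hm
  refine (norm_commutator_sub_le (h2 m (by omega)) (h1 m (by omega))).trans ?_
  linarith [half_pow_add_le n 3]

theorem AlmostCommutes.star (he : I.ApproxUnit e) (h : AlmostCommutes e x) :
    AlmostCommutes e fun n => star (x n) := by
  filter_upwards [h] with n hn m hm
  have h1 : e n * Star.star (x m) - Star.star (x m) * e n =
      - Star.star (e n * x m - x m * e n) := by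
    rw [star_sub, star_mul, star_mul, he.star_eq]; abel
  rw [h1, norm_neg, norm_star]
  exact hn m hm

/-! ### Compatibility of gluing with the algebraic operations modulo the ideal -/

/-- Since `wide` acts as a unit on `bump`, both `wide * star x * bump` and `bump * star x * wide`
differ from `bump * star x` by commutators of summable norm. The asymmetric form of `glueTerm` thus
avoids square roots of the bumps. -/
theorem IsGlue.star_sub_mem (hI : I.StrictlyComplete) (he : I.ApproxUnit e)
    (hx : AlmostCommutes e x) (hX : I.IsGlue e x X)
    (hY : I.IsGlue e (fun n => star (x n)) Y) : star X - Y ∈ I.toSubspace := by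
  refine hI.mem_of_summable (z := fun n => star (glueTerm e x n) - glueTerm e (fun n => star (x n)) n)
    (C := 8) ((StrictLim.sub hX.star hY).congr fun N => by
      simp only [star_sum, Finset.sum_sub_distrib])
    (fun n => sub_mem (I.star_mem (glueTerm_mem he x n)) (glueTerm_mem he _ n)) ?_
  filter_upwards [(hx.star he).bump, (hx.star he).wide] with n h1 h2
  have h3 : star (glueTerm e x n) - glueTerm e (fun n => star (x n)) n =
      bump e n * (wide e n * star (x n) - star (x n) * wide e n)
      - wide e n * (bump e n * star (x n) - star (x n) * bump e n) := by
    rw [glueTerm, glueTerm, star_mul, star_mul, he.star_bump, he.star_wide, mul_sub, mul_sub,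
      ← mul_assoc (bump e n) (wide e n), he.bump_mul_wide, ← mul_assoc (wide e n) (bump e n),
      he.wide_mul_bump]
    noncomm_ring
  rw [h3]
  refine (norm_sub_le _ _).trans ?_
  have h4 : ‖bump e n * (wide e n * star (x n) - star (x n) * wide e n)‖ ≤
      2 * (2 * (1 / 2) ^ n) := (norm_mul_le _ _).trans
    (mul_le_mul (he.norm_bump_le n) (h2 n (by omega)) (norm_nonneg _) zero_le_two)
  have h5 : ‖wide e n * (bump e n * star (x n) - star (x n) * bump e n)‖ ≤
      2 * (2 * (1 / 2) ^ n) := (norm_mul_le _ _).trans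
    (mul_le_mul (he.norm_wide_le n) (h1 n (by omega)) (norm_nonneg _) zero_le_two)
  linarith

/-- The series of `bump e n * w` telescopes strictly to `w - e 1 * w`, and replacing its terms by
`glueTerm` costs only commutators of summable norm. -/
theorem IsGlue.const_sub_mem (hI : I.StrictlyComplete) (he : I.ApproxUnit e) {w : M}
    (hw : AlmostCommutes e fun _ => w) (hX : I.IsGlue e (fun _ => w) X) :
    w - X ∈ I.toSubspace := by
  have h1 : I.StrictLim (fun N => ∑ n ∈ Finset.range N, bump e n * w) (w - e 1 * w) := by
    intro a ha
    simp only [← Finset.sum_mul, ApproxUnit.sum_bump, sub_mul, mul_sub]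
    refine ⟨Tendsto.sub ?_ tendsto_const_nhds, Tendsto.sub ?_ tendsto_const_nhds⟩
    · simpa only [mul_assoc] using
        (tendsto_add_atTop_iff_nat 1).2 (he.tendsto_mul (w * a) (I.mul_left_mem w ha))
    · simpa only [mul_assoc] using
        ((tendsto_add_atTop_iff_nat 1).2 (he.tendsto_mul' ha)).mul_const w
  have h2 : w - e 1 * w - X ∈ I.toSubspace := by
    refine hI.mem_of_summable (z := fun n => bump e n * w - glueTerm e (fun _ => w) n) (C := 4)
      ((h1.sub hX).congr fun N => by simp only [Finset.sum_sub_distrib])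
      (fun n => sub_mem (I.mul_right_mem _ (he.bump_mem n)) (glueTerm_mem he _ n)) ?_
    filter_upwards [hw.wide] with n hn
    have h3 : bump e n * w - glueTerm e (fun _ => w) n =
        bump e n * (wide e n * w - w * wide e n) := by
      rw [glueTerm, mul_sub, ← mul_assoc, he.bump_mul_wide, mul_assoc]
    rw [h3]
    have := (norm_mul_le (bump e n) (wide e n * w - w * wide e n)).trans
      (mul_le_mul (he.norm_bump_le n) (hn n (by omega)) (norm_nonneg _) zero_le_two)
    linarith
  have h3 : w - X = (w - e 1 * w - X) + e 1 * w := by abel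
  rw [h3]
  exact add_mem h2 (I.mul_right_mem _ (he.mem 1))

/-- The two series differ only in that `σ` has been moved past `bump` and `wide`, with an error of
order `(1 / 2) ^ n`. -/
theorem IsGlue.map_sub_mem (hI : I.StrictlyComplete) (he : I.ApproxUnit e)
    (σ : M ≃⋆ₐ[ℂ] M) (hσ : ∀ a ∈ I.toSubspace, σ a ∈ I.toSubspace)
    (hσ' : ∀ a ∈ I.toSubspace, σ.symm a ∈ I.toSubspace)
    (hσe : ∀ᶠ n in atTop, ‖σ (e n) - e n‖ ≤ (1 / 2) ^ n) (hx : ∀ n, ‖x n‖ ≤ R)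
    (hX : I.IsGlue e x X) (hY : I.IsGlue e (fun n => σ (x n)) Y) : σ X - Y ∈ I.toSubspace := by
  have hR : 0 ≤ R := (norm_nonneg _).trans (hx 0)
  have hdiff : ∀ a b : M, ∀ n k l : ℕ, ‖σ a - a‖ ≤ (1 / 2) ^ (n + k) →
      ‖σ b - b‖ ≤ (1 / 2) ^ (n + l) → ‖σ (a - b) - (a - b)‖ ≤ 2 * (1 / 2) ^ n := by
    intro a b n k l ha hb
    have h1 : σ (a - b) - (a - b) = (σ a - a) - (σ b - b) := by rw [map_sub]; abel
    rw [h1]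
    refine (norm_sub_le _ _).trans ?_
    linarith [half_pow_add_le n k, half_pow_add_le n l]
  refine hI.mem_of_summable
    (z := fun n => σ (glueTerm e x n) - glueTerm e (fun n => σ (x n)) n)
    (C := 8 * R) ((StrictLim.sub (hX.map σ hσ') hY).congr fun N => by
      simp only [map_sum, Finset.sum_sub_distrib])
    (fun n => sub_mem (hσ _ (glueTerm_mem he x n)) (glueTerm_mem he _ n)) ?_
  filter_upwards [hσe, (tendsto_add_atTop_nat 1).eventually hσe,
    (tendsto_add_atTop_nat 2).eventually hσe, (tendsto_add_atTop_nat 3).eventually hσe]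
    with n h0 h1 h2 h3
  have hb : ‖σ (bump e n) - bump e n‖ ≤ 2 * (1 / 2) ^ n := hdiff _ _ n 2 1 h2 h1
  have hw : ‖σ (wide e n) - wide e n‖ ≤ 2 * (1 / 2) ^ n := hdiff _ _ n 3 0 h3 h0
  have h4 : σ (glueTerm e x n) - glueTerm e (fun n => σ (x n)) n =
      (σ (bump e n) - bump e n) * σ (x n) * σ (wide e n) +
        bump e n * σ (x n) * (σ (wide e n) - wide e n) := by
    rw [glueTerm, glueTerm, map_mul, map_mul]
    noncomm_ring
  rw [h4]
  have hxn : ‖σ (x n)‖ ≤ R := (StarAlgEquiv.norm_map σ (x n)).trans_le (hx n)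
  have hwn : ‖σ (wide e n)‖ ≤ 2 := (StarAlgEquiv.norm_map σ _).trans_le (he.norm_wide_le n)
  calc _ ≤ ‖σ (bump e n) - bump e n‖ * ‖σ (x n)‖ * ‖σ (wide e n)‖ +
        ‖bump e n‖ * ‖σ (x n)‖ * ‖σ (wide e n) - wide e n‖ :=
        (norm_add_le _ _).trans (add_le_add norm_mul₃_le norm_mul₃_le)
    _ ≤ (2 * (1 / 2) ^ n) * R * 2 + 2 * R * (2 * (1 / 2) ^ n) := by
        gcongr
        exact he.norm_bump_le n
    _ = 8 * R * (1 / 2) ^ n := by ring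

/-! ### Local form of the glued element and products -/

theorem IsGlue.mul_approxUnit_band (he : I.ApproxUnit e) (hX : I.IsGlue e x X) {j k : ℕ}
    (h : j + 8 ≤ k) : e k * (X * e j) = X * e j := by
  have hz := block_glueTerm he x
  have h1 := (hX (e j) (he.mem j)).1
  refine tendsto_nhds_unique (h1.const_mul (e k)) (h1.congr fun N => ?_)
  rw [Finset.sum_mul, Finset.mul_sum]
  refine Finset.sum_congr rfl fun n _ => ?_
  rcases le_total (j + 4) n with hn | hn
  · rw [hz.right_zero hn, mul_zero]
  · rw [← mul_assoc, hz.left_id (by omega)]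

theorem IsGlue.approxUnit_mul_band (he : I.ApproxUnit e) (hX : I.IsGlue e x X) {j k : ℕ}
    (h : k + 8 ≤ j) : e k * X * e j = e k * X := by
  have hz := block_glueTerm he x
  have h1 := (hX (e k) (he.mem k)).2
  refine tendsto_nhds_unique (h1.mul_const (e j)) (h1.congr fun N => ?_)
  rw [Finset.mul_sum, Finset.sum_mul]
  refine Finset.sum_congr rfl fun n _ => ?_
  rcases le_total (k + 4) n with hn | hn
  · rw [hz.left_zero hn, zero_mul]
  · rw [mul_assoc, hz.right_id (by omega)]

/-- `X` moves supports by at most `8` positions, and `e (n + 3)` fixes the `n`-th term, whence the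
width `11`. -/
theorem IsGlue.block_mul (he : I.ApproxUnit e) (hX : I.IsGlue e x X) (y : ℕ → M) :
    Block e 11 fun n => X * glueTerm e y n := by
  have hz := block_glueTerm he y
  refine ⟨fun {k n} h => ?_, fun {k n} h => ?_, fun {k n} h => ?_, fun {k n} h => ?_⟩
  · rw [← mul_assoc, ← hX.approxUnit_mul_band he (j := n) (by omega), mul_assoc, glueTerm,
      ← mul_assoc (e n), ← mul_assoc (e n), he.mul_bump_eq_zero le_rfl, zero_mul, zero_mul, mul_zero]
  · rw [mul_assoc, hz.right_zero (by omega), mul_zero]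
  · have h1 : e (n + 3) * glueTerm e y n = glueTerm e y n := by
      rw [glueTerm, ← mul_assoc, ← mul_assoc, he.mul_bump le_rfl]
    rw [← h1, ← mul_assoc X, ← mul_assoc, hX.mul_approxUnit_band he (by omega)]
  · rw [mul_assoc, hz.right_id (by omega)]

theorem IsGlue.mul_bump_eq (he : I.ApproxUnit e) (hX : I.IsGlue e x X) (p : ℕ) :
    X * bump e (p + 2) =
      ∑ j ∈ Finset.range 5, glueTerm e x (p + j) * bump e (p + 2) := by
  have h1 := (hX _ (he.bump_mem (p + 2))).1
  refine tendsto_nhds_unique h1 (tendsto_const_nhds.congr' ?_)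
  filter_upwards [eventually_ge_atTop (p + 5)] with N hN
  have h2 : ∀ n, (n + 3 ≤ p + 2 ∨ p + 2 + 3 ≤ n) → glueTerm e x n * bump e (p + 2) = 0 :=
    fun n hn => by rw [glueTerm, mul_assoc, he.wide_mul_bump_eq_zero hn, mul_zero]
  rw [Finset.sum_mul, ← Finset.sum_range_add_sum_Ico _ hN,
    ← Finset.sum_range_add_sum_Ico _ (Nat.le_add_right p 5),
    Finset.sum_eq_zero fun n hn => h2 n (Or.inl (by have := Finset.mem_range.1 hn; omega)),
    Finset.sum_eq_zero (s := Finset.Ico (p + 5) N) fun n hn => h2 n (Or.inr (by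
      have := Finset.mem_Ico.1 hn; omega)), zero_add, add_zero, Finset.sum_Ico_eq_sum_range]
  simp

theorem SlowlyVarying.tendsto_bump_mul (he : I.ApproxUnit e) (hs : SlowlyVarying e x) {j : ℕ}
    (hj : j < 5) :
    Tendsto (fun p => bump e (p + 2) * (x (p + j) - x (p + 2))) atTop (𝓝 0) := by
  refine squeeze_zero_norm (a := fun p => 2 *
    ‖(x (p + j) - x (p + 2)) - e p * (x (p + j) - x (p + 2))‖) (fun p => ?_) ?_
  · have h1 : bump e (p + 2) * (x (p + j) - x (p + 2)) = bump e (p + 2) *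
        ((x (p + j) - x (p + 2)) - e p * (x (p + j) - x (p + 2))) := by
      rw [mul_sub (bump e (p + 2)) (x (p + j) - x (p + 2)), ← mul_assoc,
        he.bump_mul_eq_zero (by omega), zero_mul, sub_zero]
    rw [h1]
    exact (norm_mul_le _ _).trans (mul_le_mul_of_nonneg_right (he.norm_bump_le _) (norm_nonneg _))
  · simpa using (hs j hj).norm.const_mul 2

theorem AlmostCommutes.tendsto_bump (h : AlmostCommutes e x) {i j : ℕ} (hij : j ≤ i + 8) :
    Tendsto (fun p => CStarIdeal.bump e (p + i) * x (p + j) - x (p + j) * CStarIdeal.bump e (p + i))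
      atTop (𝓝 0) := by
  refine squeeze_zero_norm' (a := fun p => 2 * (1 / 2) ^ (p + i)) ?_ ?_
  · filter_upwards [(tendsto_add_atTop_nat i).eventually h.bump] with p hp
    exact hp (p + j) (by omega)
  · simpa using ((tendsto_add_atTop_iff_nat i).2 (tendsto_pow_atTop_nhds_zero_of_lt_one
      (r := (1 / 2 : ℝ)) (by norm_num) (by norm_num))).const_mul 2

theorem AlmostCommutes.tendsto_wide (h : AlmostCommutes e x) {i j : ℕ} (hij : j ≤ i + 8) :
    Tendsto (fun p => CStarIdeal.wide e (p + i) * x (p + j) - x (p + j) * CStarIdeal.wide e (p + i))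
      atTop (𝓝 0) := by
  refine squeeze_zero_norm' (a := fun p => 2 * (1 / 2) ^ (p + i)) ?_ ?_
  · filter_upwards [(tendsto_add_atTop_nat i).eventually h.wide] with p hp
    exact hp (p + j) (by omega)
  · simpa using ((tendsto_add_atTop_iff_nat i).2 (tendsto_pow_atTop_nhds_zero_of_lt_one
      (r := (1 / 2 : ℝ)) (by norm_num) (by norm_num))).const_mul 2

theorem tendsto_zero_of_bounded_mul {f g : ℕ → M} {C : ℝ} (hf : ∀ n, ‖f n‖ ≤ C)
    (hg : Tendsto g atTop (𝓝 0)) : Tendsto (fun n => f n * g n) atTop (𝓝 0) := by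
  refine squeeze_zero_norm (a := fun n => C * ‖g n‖) (fun n => ?_) (by simpa using hg.norm.const_mul C)
  exact (norm_mul_le _ _).trans (mul_le_mul_of_nonneg_right (hf n) (norm_nonneg _))

theorem tendsto_zero_of_mul_bounded {f g : ℕ → M} {C : ℝ} (hf : ∀ n, ‖f n‖ ≤ C)
    (hg : Tendsto g atTop (𝓝 0)) : Tendsto (fun n => g n * f n) atTop (𝓝 0) := by
  refine squeeze_zero_norm (a := fun n => ‖g n‖ * C) (fun n => ?_) (by simpa using hg.norm.mul_const C)
  exact (norm_mul_le _ _).trans (mul_le_mul_of_nonneg_left (hf n) (norm_nonneg _))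

/-- The glued element is locally close to the members of the sequence. -/
theorem IsGlue.tendsto_mul_bump_sub (he : I.ApproxUnit e) (hx : AlmostCommutes e x)
    (hs : SlowlyVarying e x) (hX : I.IsGlue e x X) :
    Tendsto (fun n => X * bump e n - bump e n * x n) atTop (𝓝 0) := by
  rw [← tendsto_add_atTop_iff_nat 2]
  -- The five neighbouring bumps add up to `e (p + 6) - e (p + 1)`, which acts as a unit on `bump e
  -- (p + 2)`.
  have hsum : ∀ p, bump e (p + 2) * x (p + 2) =
      ∑ j ∈ Finset.range 5, bump e (p + j) * bump e (p + 2) * x (p + 2) := by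
    intro p
    rw [← Finset.sum_mul, ← Finset.sum_mul]
    congr 1
    have h1 : ∑ j ∈ Finset.range 5, bump e (p + j) = e (p + 6) - e (p + 1) :=
      Finset.sum_range_sub (fun j => e (p + j + 1)) 5
    rw [h1, sub_mul, he.mul_bump (by omega), he.mul_bump_eq_zero (by omega), sub_zero]
  have hterm : ∀ j ∈ Finset.range 5, Tendsto (fun p => glueTerm e x (p + j) * bump e (p + 2) -
      bump e (p + j) * bump e (p + 2) * x (p + 2)) atTop (𝓝 0) := by
    intro j hj
    have hj5 : j < 5 := Finset.mem_range.1 hj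
    -- The three errors come from replacing `x (p + j)` by `x (p + 2)`, from commuting it with
    -- `wide`, and from commuting it with `bump e (p + 2)`.
    have h1 := tendsto_zero_of_bounded_mul (fun p => he.norm_bump_le (p + j))
      (hs.tendsto_bump_mul he hj5)
    have h2 := tendsto_zero_of_bounded_mul (fun p => he.norm_bump_le (p + j))
      (tendsto_zero_of_mul_bounded (fun p => he.norm_bump_le (p + 2))
        (hx.tendsto_wide (i := j) (j := j) (by omega)))
    have h3 := tendsto_zero_of_bounded_mul (fun p => he.norm_bump_le (p + j))
      (tendsto_zero_of_bounded_mul (fun p => he.norm_wide_le (p + j))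
        (hx.tendsto_bump (i := 2) (j := j) (by omega)))
    have h4 := (h1.sub h2).sub h3
    rw [sub_zero, sub_zero] at h4
    refine h4.congr fun p => ?_
    have h5 : bump e (p + j) * (wide e (p + j) * (bump e (p + 2) * x (p + j))) =
        bump e (p + j) * (bump e (p + 2) * x (p + j)) := by
      rw [← mul_assoc, he.bump_mul_wide]
    rw [glueTerm]
    simp only [mul_sub, sub_mul, mul_assoc, h5]
    abel
  have h := tendsto_finsetSum (Finset.range 5) hterm
  rw [Finset.sum_const_zero] at h
  refine h.congr fun p => ?_
  rw [Finset.sum_sub_distrib, ← hsum, ← hX.mul_bump_eq he]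

/-- The `n`-th term of the difference is `(X * bump e n - bump e n * x n) * y n * wide e n`. It
tends to zero in norm, not necessarily summably, so the block structure is needed to conclude. -/
theorem IsGlue.mul_sub_mem (hI : I.StrictlyComplete) (he : I.ApproxUnit e)
    (hx : AlmostCommutes e x) (hs : SlowlyVarying e x) (hy : ∀ n, ‖y n‖ ≤ R)
    (hX : I.IsGlue e x X) (hY : I.IsGlue e y Y) (hZ : I.IsGlue e (fun n => x n * y n) Z) :
    X * Y - Z ∈ I.toSubspace := by
  have hblock := (hX.block_mul he y).sub
    ((block_glueTerm he fun n => x n * y n).mono (c' := 11) (by norm_num))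
  refine hblock.mem_of_tendsto_zero hI he (by norm_num)
    (fun n => sub_mem (I.mul_left_mem _ (glueTerm_mem he y n)) (glueTerm_mem he _ n))
    ((StrictLim.sub (StrictLim.const_mul hY X) hZ).congr fun N => by
      rw [Finset.sum_sub_distrib, Finset.mul_sum]) ?_
  have h := tendsto_zero_of_mul_bounded (fun n => he.norm_wide_le n)
    (tendsto_zero_of_mul_bounded hy (hX.tendsto_mul_bump_sub he hx hs))
  refine h.congr fun n => ?_
  simp only [glueTerm]
  noncomm_ring

/-- A lower bound for the norm modulo `I` of the result of gluing. -/
theorem IsGlue.eventually_norm_mul_bump_le (he : I.ApproxUnit e)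
    (hx : AlmostCommutes e x) (hs : SlowlyVarying e x) (hX : I.IsGlue e x X) {ε : ℝ} (hε : 0 < ε) :
    ∀ᶠ n in atTop, ‖x n * bump e n‖ ≤ 2 * ‖I.mkHom X‖ + ε := by
  -- `Y` is a representative of the class of `X` of nearly minimal norm; the late bumps do not see
  -- the difference `X - Y ∈ I`.
  obtain ⟨Y, hYX, hY⟩ := I.exists_mkHom_eq (I.mkHom X) (ε := ε / 4) (by positivity)
  have h1 := (hX.tendsto_mul_bump_sub he hx hs).add (hx.tendsto_bump (i := 0) (j := 0) (by omega))
  have h2 := (he.tendsto_mul_bump (I.mkHom_eq_mkHom.1 hYX.symm)).sub h1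
  rw [add_zero, sub_zero] at h2
  filter_upwards [(Metric.tendsto_nhds.1 h2) (ε / 2) (by positivity)] with n hn
  rw [dist_zero_right] at hn
  have h3 : x n * bump e n = Y * bump e n + ((X - Y) * bump e n -
      (X * bump e n - bump e n * x n + (bump e (n + 0) * x (n + 0) - x (n + 0) * bump e (n + 0)))) := by
    simp only [add_zero]
    noncomm_ring
  have h4 : ‖Y * bump e n‖ ≤ ‖Y‖ * 2 := (norm_mul_le _ _).trans
    (mul_le_mul_of_nonneg_left (he.norm_bump_le n) (norm_nonneg _))
  rw [h3]
  exact (norm_add_le _ _).trans (by linarith)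

end

end CStarIdeal

/-! ### Automatic continuity of lifts -/

theorem AlgAction.apply_inv_apply {G : Type v} [Group G] {A : Type u}
    [NonUnitalCStarAlgebra A] (β : AlgAction G A) (g : G) (x : A) : β g (β g⁻¹ x) = x := by
  rw [← StarAlgEquiv.mul_apply, ← map_mul, mul_inv_cancel, map_one]; rfl

/-- All `β g` are isometric, so pointwise continuity on `S` is joint continuity along the curve `f`.
-/
theorem AlgAction.continuous_apply {G : Type v} [Group G] [TopologicalSpace G]
    {A : Type u} [NonUnitalCStarAlgebra A] {β : AlgAction G A} {S : Set A} (hβ : ∀ a ∈ S, Continuous fun g => β g a) {f : G → A}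
    (hf : Continuous f) (hfI : ∀ g, f g ∈ S) : Continuous fun g => β g (f g) := by
  rw [continuous_iff_continuousAt]
  intro g₀
  have h1 := (hβ _ (hfI g₀)).tendsto g₀
  have h2 : Tendsto (fun g => β g (f g - f g₀)) (𝓝 g₀) (𝓝 0) := by
    refine squeeze_zero_norm (a := fun g => ‖f g - f g₀‖)
      (fun g => (StarAlgEquiv.norm_map (β g) _).le) ?_
    have := ((hf.tendsto g₀).sub (tendsto_const_nhds (x := f g₀))).norm
    simpa using this
  have h3 := h2.add h1
  rw [zero_add] at h3
  exact h3.congr fun g => by rw [← map_add, sub_add_cancel]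

namespace CStarIdeal

section Continuity

variable {M : Type u} [CStarAlgebra M] {I : CStarIdeal M} {G : Type v} [Group G]
  [TopologicalSpace G] [IsTopologicalGroup G] {β : AlgAction G M} {u : ℕ → M}

theorem continuous_action_mul (hβ : ∀ a ∈ I.toSubspace, Continuous fun g => β g a)
    (hβI : ∀ g, ∀ x ∈ I.toSubspace, β g x ∈ I.toSubspace)
    (x : M) {a : M} (ha : a ∈ I.toSubspace) : Continuous fun g => β g x * a := by
  have h := AlgAction.continuous_apply (S := I.toSubspace) hβ
    (f := fun g => x * β g⁻¹ a) (((hβ a ha).comp continuous_inv).const_mul x)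
    fun g => I.mul_left_mem x (hβI _ _ ha)
  exact h.congr fun g => by rw [map_mul, AlgAction.apply_inv_apply]

theorem continuous_mul_action (hβ : ∀ a ∈ I.toSubspace, Continuous fun g => β g a)
    (hβI : ∀ g, ∀ x ∈ I.toSubspace, β g x ∈ I.toSubspace)
    (x : M) {a : M} (ha : a ∈ I.toSubspace) : Continuous fun g => a * β g x := by
  have h := (continuous_action_mul hβ hβI (star x) (I.star_mem ha)).star
  exact h.congr fun g => by rw [star_mul, star_star, map_star, star_star]

/-- If the class of `x` modulo `I` has a continuous orbit map, then so has `x`. -/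
theorem continuous_action_of_mkHom [BaireSpace G] (hI : I.StrictlyComplete)
    (hu : I.ApproxUnit u) (hβI : ∀ g, ∀ x ∈ I.toSubspace, β g x ∈ I.toSubspace)
    (hβ : ∀ a ∈ I.toSubspace, Continuous fun g => β g a) {x : M}
    (hx : Continuous fun g => I.mkHom (β g x)) : Continuous fun g => β g x := by
  -- The action being isometric, small oscillation at one point can be translated to every other
  -- point; the point may depend on `ε`.
  suffices key : ∀ ε > 0, ∃ h, ∀ᶠ g in 𝓝 h, ‖β g x - β h x‖ ≤ ε by
    rw [continuous_iff_continuousAt]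
    intro g₀
    rw [ContinuousAt, Metric.tendsto_nhds]
    intro ε hε
    obtain ⟨h, hh⟩ := key (ε / 2) (half_pos hε)
    have ht : Tendsto (fun g => h * g₀⁻¹ * g) (𝓝 g₀) (𝓝 h) := by
      have : Continuous fun g => h * g₀⁻¹ * g := by fun_prop
      simpa using this.tendsto g₀
    filter_upwards [ht.eventually hh] with g hg
    have h1 : β (h * g₀⁻¹ * g) x - β h x = β (h * g₀⁻¹) (β g x - β g₀ x) := by
      rw [map_sub, ← StarAlgEquiv.mul_apply, ← StarAlgEquiv.mul_apply, ← map_mul, ← map_mul,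
        inv_mul_cancel_right]
    rw [h1, StarAlgEquiv.norm_map] at hg
    rw [dist_eq_norm]
    linarith
  intro ε hε
  set y : G → M := fun g => β g x - x with hy
  set V : Set G := {g | ‖I.mkHom (y g)‖ < ε / 16} with hV
  have hVopen : IsOpen V := by
    refine isOpen_lt ?_ continuous_const
    simp only [hy, map_sub]
    exact (hx.sub continuous_const).norm
  have h1V : (1 : G) ∈ V := by
    have : y 1 = 0 := by
      simp only [hy, map_one]
      exact sub_self x
    simp only [hV, Set.mem_ofPred_eq, this, map_zero, norm_zero]
    positivity
  -- These sets are closed because `g ↦ y g * a` is norm-continuous for `a ∈ I`, and the norm is a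
  -- supremum over such `a`. They cover `G` because, for `g ∈ V`, the late cut-offs of `y g` are
  -- controlled by its quotient norm.
  let f : ℕ → Set G := fun k => Vᶜ ∪ {g | ∀ j ≥ k, ‖y g - u j * y g‖ ≤ 3 * (ε / 16)}
  have hf : ∀ k, IsClosed (f k) := by
    intro k
    refine hVopen.isClosed_compl.union ?_
    have : {g | ∀ j ≥ k, ‖y g - u j * y g‖ ≤ 3 * (ε / 16)} =
        ⋂ j ≥ k, ⋂ a ∈ {a | a ∈ I.toSubspace ∧ ‖a‖ ≤ 1},
          {g | ‖(y g - u j * y g) * a‖ ≤ 3 * (ε / 16)} := by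
      ext g
      simp only [Set.mem_ofPred_eq, Set.mem_iInter]
      refine forall₂_congr fun j _ => ⟨fun h a ha => ?_, fun h => ?_⟩
      · exact (norm_mul_le _ _).trans ((mul_le_of_le_one_right (norm_nonneg _) ha.2).trans h)
      · exact hI.norm_le _ _ (by positivity) fun a ha ha1 => h a ⟨ha, ha1⟩
    rw [this]
    refine isClosed_biInter fun j _ => isClosed_biInter fun a ha => isClosed_le ?_ continuous_const
    have hc : Continuous fun g => y g * a := by
      simp only [hy, sub_mul]
      exact (continuous_action_mul hβ hβI x ha.1).sub continuous_const
    have hc2 : Continuous fun g => y g * a - u j * (y g * a) := hc.sub (hc.const_mul _)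
    refine hc2.norm.congr fun g => ?_
    simp only [hy]
    congr 1
    noncomm_ring
  have hcover : ⋃ k, f k = Set.univ := by
    refine Set.eq_univ_of_forall fun g => Set.mem_iUnion.2 ?_
    by_cases hg : g ∈ V
    · obtain ⟨k, hk⟩ := eventually_atTop.1
        (hu.eventually_norm_sub_mul_le_mkHom (y g) (δ := ε / 16) (by positivity))
      refine ⟨k, Or.inr fun j hj => (hk j hj).trans ?_⟩
      have : ‖I.mkHom (y g)‖ < ε / 16 := hg
      linarith
    · exact ⟨0, Or.inl hg⟩
  -- By Baire, some `k` works on a neighbourhood of a point `h ∈ V`. There the part cut off by `1 -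
  -- u k` is uniformly small, and the remaining part `u k * β g x` is continuous in `g`.
  obtain ⟨h, hhV, hh⟩ := (dense_iUnion_interior_of_closed hf hcover).inter_open_nonempty V hVopen
    ⟨1, h1V⟩
  obtain ⟨k, hk⟩ := Set.mem_iUnion.1 hh
  have hsmall : ∀ g ∈ V ∩ interior (f k), ‖y g - u k * y g‖ ≤ 3 * (ε / 16) := fun g hg => by
    rcases interior_subset hg.2 with h' | h'
    · exact (h' hg.1).elim
    · exact h' k le_rfl
  have hck : Continuous fun g => u k * β g x := continuous_mul_action hβ hβI x (hu.mem k)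
  refine ⟨h, ?_⟩
  filter_upwards [(hVopen.inter isOpen_interior).mem_nhds ⟨hhV, hk⟩,
    (Metric.tendsto_nhds.1 (hck.tendsto h)) (ε / 16) (by positivity)] with g hg hg2
  rw [dist_eq_norm] at hg2
  have h1 : β g x - β h x = (y g - u k * y g) - (y h - u k * y h) +
      (u k * β g x - u k * β h x) := by
    simp only [hy]
    noncomm_ring
  rw [h1]
  refine (norm_add_le _ _).trans ?_
  have h2 := norm_sub_le (y g - u k * y g) (y h - u k * y h)
  linarith [hsmall g hg, hsmall h ⟨hhV, hk⟩]

end Continuity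

end CStarIdeal

/-! ### Sampling countably many paths -/

section Sampling

variable {E : Type u} [SeminormedAddCommGroup E]

/-- Uniform continuity of finitely many paths on a compact interval. The interval reaches `N + 2` so
as to contain a step of length at most `1` from any time whose integer part is `N`. -/
theorem exists_common_modulus (F : ℕ → ℝ≥0 → E) (hF : ∀ i, Continuous (F i)) (N : ℕ) :
    ∃ δ : ℝ≥0, 0 < δ ∧ δ ≤ 1 ∧ ∀ i ≤ N, ∀ s s' : ℝ≥0, s ≤ N + 2 → s' ≤ N + 2 → s ≤ s' →
      s' ≤ s + δ → ‖F i s' - F i s‖ ≤ 1 / ((N : ℝ) + 1) := by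
  let H : ℝ≥0 → Fin (N + 1) → E := fun s i => F i s
  have hH : Continuous H := continuous_pi fun i => hF i
  have hu := (isCompact_Icc (a := (0 : ℝ≥0)) (b := (N + 2 : ℝ≥0))).uniformContinuousOn_of_continuous
    hH.continuousOn
  obtain ⟨δ, hδ, h⟩ := Metric.uniformContinuousOn_iff.1 hu (1 / ((N : ℝ) + 1)) (by positivity)
  refine ⟨min 1 (Real.toNNReal (δ / 2)), by simpa using hδ, min_le_left _ _, ?_⟩
  intro i hi s s' hs hs' hss hd
  have h1 : (s' : ℝ) ≤ s + δ / 2 := by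
    have h2 : s' ≤ s + Real.toNNReal (δ / 2) := hd.trans (by gcongr; exact min_le_right _ _)
    have h3 : (s' : ℝ) ≤ ((s + Real.toNNReal (δ / 2) : ℝ≥0) : ℝ) := by exact_mod_cast h2
    rwa [NNReal.coe_add, Real.coe_toNNReal _ (by positivity)] at h3
  have h2 : dist s' s < δ := by
    rw [NNReal.dist_eq, abs_of_nonneg (sub_nonneg.2 (by exact_mod_cast hss))]
    linarith
  have h3 := h s' ⟨zero_le, hs'⟩ s ⟨zero_le, hs⟩ h2
  have h4 := (dist_le_pi_dist (H s') (H s) ⟨i, by omega⟩).trans h3.le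
  rwa [dist_eq_norm] at h4

/-- Countably many continuous paths can be sampled along a common sequence of times tending to
infinity so slowly that no path oscillates asymptotically between consecutive times. -/
theorem exists_sampling (F : ℕ → ℝ≥0 → E) (hF : ∀ i, Continuous (F i)) :
    ∃ t : ℕ → ℝ≥0, Monotone t ∧ Tendsto t atTop atTop ∧ ∀ i, ∀ ε : ℝ, 0 < ε → ∀ᶠ n in atTop,
      ∀ s, t n ≤ s → s ≤ t (n + 1) → ‖F i s - F i (t n)‖ ≤ ε := by
  choose δ hδ0 hδ1 hδ using exists_common_modulus F hF
  -- The step length is the modulus belonging to the integer part of the current time.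
  let t : ℕ → ℝ≥0 := fun n => Nat.rec 0 (fun _ r => r + δ ⌊r⌋₊) n
  have hstep : ∀ n, t (n + 1) = t n + δ ⌊t n⌋₊ := fun n => rfl
  have hmono : Monotone t := monotone_nat_of_le_succ fun n => by rw [hstep]; exact le_self_add
  have htop : Tendsto t atTop atTop := by
    refine tendsto_atTop_atTop_of_monotone hmono fun B => ?_
    by_contra! hB
    -- If the times stayed below `B`, only finitely many step lengths would occur; their minimum is
    -- positive, so the times would be unbounded.
    obtain ⟨k, -, hk⟩ := Finset.exists_min_image (Finset.range (⌊B⌋₊ + 1)) δ ⟨0, by simp⟩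
    have hlow : ∀ n : ℕ, n * δ k ≤ t n := by
      intro n
      induction n with
      | zero => simp
      | succ n ih =>
        rw [hstep, Nat.cast_succ, add_mul, one_mul]
        refine add_le_add ih (hk _ (Finset.mem_range.2 (Nat.lt_succ_of_le ?_)))
        exact Nat.floor_mono (hB n).le
    obtain ⟨n, hn⟩ := exists_nat_gt (B / δ k)
    rw [div_lt_iff₀ (hδ0 k)] at hn
    exact (hn.trans_le (hlow n)).not_gt (hB n)
  refine ⟨t, hmono, htop, fun i ε hε => ?_⟩
  obtain ⟨N, hN⟩ := exists_nat_gt (1 / ε)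
  filter_upwards [htop.eventually_ge_atTop ((max i N : ℕ) : ℝ≥0)] with n hn s hs1 hs2
  have h1 : max i N ≤ ⌊t n⌋₊ := Nat.le_floor hn
  have h2 : t n ≤ ⌊t n⌋₊ + 1 := (Nat.lt_floor_add_one (t n)).le
  have h3 : s ≤ ⌊t n⌋₊ + 2 := by
    refine hs2.trans ?_
    rw [hstep]
    calc t n + δ ⌊t n⌋₊ ≤ (⌊t n⌋₊ + 1) + 1 := add_le_add h2 (hδ1 _)
      _ = _ := by rw [add_assoc, one_add_one_eq_two]
  refine (hδ ⌊t n⌋₊ i ((le_max_left _ _).trans h1) (t n) s (hs1.trans h3) h3 hs1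
    (hs2.trans_eq (hstep n))).trans ?_
  have h4 : (N : ℝ) ≤ ⌊t n⌋₊ := by exact_mod_cast (le_max_right _ _).trans h1
  rw [div_le_iff₀ (by positivity)]
  rw [div_lt_iff₀ hε] at hN
  nlinarith

/-- Transfers bounds at the sampling times back to the whole path; the lower estimate for the folded
homomorphism rests on it. -/
theorem eventually_norm_le_of_sampling {F : ℝ≥0 → E} {t : ℕ → ℝ≥0}
    (ht : Tendsto t atTop atTop) {ε : ℝ}
    (h : ∀ᶠ n in atTop, ∀ s, t n ≤ s → s ≤ t (n + 1) → ‖F s - F (t n)‖ ≤ ε) {r : ℝ}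
    (hr : ∀ᶠ n in atTop, ‖F (t n)‖ ≤ r) : ∀ᶠ s in atTop, ‖F s‖ ≤ r + ε := by
  obtain ⟨N, hN⟩ := eventually_atTop.1 (h.and hr)
  filter_upwards [eventually_ge_atTop (t N)] with s hs
  have hex : ∃ k, s < t (N + k + 1) := by
    obtain ⟨k, hk⟩ := (((tendsto_add_atTop_iff_nat (N + 1)).2 ht).eventually_gt_atTop s).exists
    exact ⟨k, by rwa [show N + k + 1 = k + (N + 1) by omega]⟩
  classical
  obtain ⟨k, hk1, hk2⟩ : ∃ k, t (N + k) ≤ s ∧ s ≤ t (N + k + 1) := by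
    refine ⟨Nat.find hex, ?_, (Nat.find_spec hex).le⟩
    rcases Nat.eq_zero_or_pos (Nat.find hex) with h0 | h0
    · rwa [h0]
    · have := Nat.find_min hex (Nat.sub_lt h0 one_pos)
      rw [show N + (Nat.find hex - 1) + 1 = N + Nat.find hex by omega] at this
      exact not_lt.1 this
  obtain ⟨h1, h2⟩ := hN (N + k) (by omega)
  have h3 := norm_le_norm_add_norm_sub' (F s) (F (t (N + k)))
  linarith [h1 s hk1 hk2]

theorem tendsto_sub_of_tendsto_succ_sub {f : ℕ → E}
    (h : Tendsto (fun n => f (n + 1) - f n) atTop (𝓝 0)) (i j : ℕ) :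
    Tendsto (fun n => f (n + i) - f (n + j)) atTop (𝓝 0) := by
  have key : ∀ i, Tendsto (fun n => f (n + i) - f n) atTop (𝓝 0) := by
    intro i
    induction i with
    | zero => simpa using tendsto_const_nhds
    | succ i ih =>
      have h1 := ((tendsto_add_atTop_iff_nat i).2 h).add ih
      rw [add_zero] at h1
      exact h1.congr fun n => by rw [← add_assoc]; abel
  have h1 := (key i).sub (key j)
  rw [sub_zero] at h1
  exact h1.congr fun n => by abel

end Sampling

/-! ### The norm of the path algebra -/

section PathNorm

variable {A : Type u} [NonUnitalCStarAlgebra A]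

theorem pathMk_eq_pathMk {f g : ℝ≥0 →ᵇ A} :
    pathMk f = pathMk g ↔ Tendsto (fun s => f s - g s) atTop (𝓝 0) :=
  CStarIdeal.Quotient.mk_eq_mk

theorem eventually_norm_le_norm_pathMk (f : ℝ≥0 →ᵇ A) {ε : ℝ} (hε : 0 < ε) :
    ∀ᶠ s in atTop, ‖f s‖ ≤ ‖pathMk f‖ + ε := by
  obtain ⟨g, hg, hgn⟩ := CStarIdeal.Quotient.exists_norm_lt (pathMk f) (half_pos hε)
  have h := pathMk_eq_pathMk.1 (show pathMk g = pathMk f from hg)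
  filter_upwards [(Metric.tendsto_nhds.1 h) (ε / 2) (half_pos hε)] with s hs
  rw [dist_zero_right] at hs
  have h1 := norm_le_norm_add_norm_sub (g s) (f s)
  have h2 := g.norm_coe_le_norm s
  linarith

/-- A cut-off vanishing up to `s₀` and equal to `1` from `s₀ + 1` on does not change the class of
the path. -/
theorem norm_pathMk_le_of_eventually {f : ℝ≥0 →ᵇ A} {r : ℝ} (hr : 0 ≤ r)
    (h : ∀ᶠ s in atTop, ‖f s‖ ≤ r) : ‖pathMk f‖ ≤ r := by
  obtain ⟨s₀, hs₀⟩ := eventually_atTop.1 h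
  let c : ℝ≥0 → ℝ := fun s => ((min 1 (s - s₀) : ℝ≥0) : ℝ)
  have hc : Continuous c := by fun_prop
  have hbound : ∀ s, ‖c s • f s‖ ≤ r := by
    intro s
    rw [norm_smul, NNReal.norm_eq]
    rcases le_total s s₀ with hs | hs
    · rw [tsub_eq_zero_of_le hs]
      simpa using hr
    · exact (mul_le_of_le_one_left (norm_nonneg _)
        (by exact_mod_cast min_le_left (1 : ℝ≥0) (s - s₀))).trans (hs₀ s hs)
  let g : ℝ≥0 →ᵇ A := BoundedContinuousFunction.ofNormedAddCommGroup (fun s => c s • f s)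
    (hc.smul f.continuous) r hbound
  have hfg : pathMk f = pathMk g := by
    refine pathMk_eq_pathMk.2 (tendsto_const_nhds.congr' ?_)
    filter_upwards [eventually_ge_atTop (s₀ + 1)] with s hs
    have h1 : c s = 1 := by
      simp only [c]
      rw [min_eq_left (le_tsub_of_add_le_left hs), NNReal.coe_one]
    change 0 = f s - c s • f s
    rw [h1, one_smul, sub_self]
  rw [hfg]
  exact (CStarIdeal.Quotient.norm_mk_le g).trans
    (BoundedContinuousFunction.norm_ofNormedAddCommGroup_le _ hr hbound)

theorem norm_pathConst (a : A) : ‖pathConst a‖ = ‖a‖ := by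
  refine le_antisymm (norm_pathMk_le_of_eventually (norm_nonneg a)
    (Eventually.of_forall fun _ => le_rfl)) (le_of_forall_pos_le_add fun ε hε => ?_)
  exact (eventually_norm_le_norm_pathMk (BoundedContinuousFunction.const ℝ≥0 a) hε).exists.choose_spec

end PathNorm

/-- The limit superior of the sequence `f` is at most `r`. -/
def AsympLE (f : ℕ → ℝ) (r : ℝ) : Prop := ∀ ε : ℝ, 0 < ε → ∀ᶠ n in atTop, f n ≤ r + ε

namespace CStarIdeal

/-! ### Gluing countably many sequences simultaneously -/

section Simultaneous

variable {M : Type u} [CStarAlgebra M] {I : CStarIdeal M} {G : Type v} [Group G] {β : AlgAction G M} {u : ℕ → M}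

/-- The elements whose distance to the ideal is tested at stage `n`. -/
def testSet (β : AlgAction G M) (K : ℕ → Set G) (P : Set ℕ) (x : ℕ → ℕ → M) (n i j k : ℕ) : Set M :=
  ((({x i n, x i n + x j n - x k n, x i n * x j n - x k n, star (x i n) - x j n} ∪
    (fun c : ℂ => c • x i n - x j n) '' Metric.closedBall 0 n) ∪
    (fun l => x i (n + l) - x i (n + 2)) '' Set.Iio 5) ∪
    {w | i ∈ P ∧ w ∈ (fun g => β g (x i n) - x j n) '' K n})

/-- All the elements tested at stage `n`. -/
def testUnion (β : AlgAction G M) (K : ℕ → Set G) (P : Set ℕ) (x : ℕ → ℕ → M) (n : ℕ) : Set M :=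
  ⋃ i ∈ Set.Iic n, ⋃ j ∈ Set.Iic n, ⋃ k ∈ Set.Iic n, testSet β K P x n i j k

theorem eventually_mem_testUnion {K : ℕ → Set G} {P : Set ℕ} {x : ℕ → ℕ → M} (i j k : ℕ)
    {w : ℕ → M} (h : ∀ᶠ n in atTop, w n ∈ testSet β K P x n i j k) :
    ∀ᶠ n in atTop, w n ∈ testUnion β K P x n := by
  filter_upwards [h, eventually_ge_atTop i, eventually_ge_atTop j, eventually_ge_atTop k]
    with n hn hi hj hk
  exact Set.mem_biUnion hi (Set.mem_biUnion hj (Set.mem_biUnion hk hn))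

variable [TopologicalSpace G]

/-- Continuity of the orbits for `i ∈ P` is what makes the part involving the group compact; the
scalars are confined to a ball growing with `n`. -/
theorem isCompact_testSet {K : ℕ → Set G} (hK : ∀ n, IsCompact (K n)) {P : Set ℕ}
    {x : ℕ → ℕ → M} (hP : ∀ i ∈ P, ∀ n, Continuous fun g => β g (x i n)) (n i j k : ℕ) :
    IsCompact (testSet β K P x n i j k) := by
  refine (((Set.Finite.isCompact (by simp)).union ((isCompact_closedBall _ _).image
    (by fun_prop))).union ((Set.finite_Iio 5).image _).isCompact).union ?_
  by_cases hi : i ∈ P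
  · have h : {w | i ∈ P ∧ w ∈ (fun g => β g (x i n) - x j n) '' K n} =
        (fun g => β g (x i n) - x j n) '' K n := by
      ext w
      exact and_iff_right hi
    rw [h]
    exact (hK n).image ((hP i hi n).sub continuous_const)
  · simp [hi]

theorem isCompact_testUnion {K : ℕ → Set G} (hK : ∀ n, IsCompact (K n)) {P : Set ℕ}
    {x : ℕ → ℕ → M} (hP : ∀ i ∈ P, ∀ n, Continuous fun g => β g (x i n)) (n : ℕ) :
    IsCompact (testUnion β K P x n) :=
  (Set.finite_Iic n).isCompact_biUnion fun i _ => (Set.finite_Iic n).isCompact_biUnion fun j _ =>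
    (Set.finite_Iic n).isCompact_biUnion fun k _ => isCompact_testSet hK hP n i j k

/-- The constant is `32` from gluing times `2` from comparing the cut-off `1 - e n` with the
quotient norm. -/
theorem IsGlue.norm_mkHom_le_of_asympLE (hI : I.StrictlyComplete) {e w : ℕ → M}
    (he : I.ApproxUnit e) {W : M} (hW : I.IsGlue e w W)
    (hw : ∀ᶠ n in atTop, ‖w n - e n * w n‖ ≤ 2 * ‖I.mkHom (w n)‖ + (1 / 2) ^ n) {r : ℝ}
    (hr : 0 ≤ r) (h : AsympLE (fun n => ‖I.mkHom (w n)‖) r) : ‖I.mkHom W‖ ≤ 64 * r := by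
  refine le_of_forall_pos_le_add fun ε hε => ?_
  have h1 := hW.norm_mkHom_le hI he (r := 2 * r + 3 * (ε / 96)) (by positivity) ?_
  · linarith
  · have h2 : ∀ᶠ n : ℕ in atTop, ((1 : ℝ) / 2) ^ n < ε / 96 :=
      (tendsto_pow_atTop_nhds_zero_of_lt_one (by norm_num) (by norm_num)).eventually
        (gt_mem_nhds (by positivity))
    filter_upwards [hw, h _ (by positivity : 0 < ε / 96), h2] with n h3 h4 h5
    linarith

/-- Countably many bounded sequences in `M`, slowly varying modulo `I`, can be glued along a common
approximate unit so that modulo `I` gluing is asymptotically isometric up to constants and respects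
all the algebraic relations that hold asymptotically modulo `I`. -/
theorem exists_simultaneous_glue [IsTopologicalGroup G] [LocallyCompactSpace G] [SecondCountableTopology G]
    (hI : I.StrictlyComplete) (hu : I.ApproxUnit u)
    (hβI : ∀ g, ∀ x ∈ I.toSubspace, β g x ∈ I.toSubspace)
    (hβ : ∀ a ∈ I.toSubspace, Continuous fun g => β g a) {P : Set ℕ} {x : ℕ → ℕ → M}
    (hP : ∀ i ∈ P, ∀ n, Continuous fun g => β g (x i n)) {R : ℕ → ℝ} (hR : ∀ i n, ‖x i n‖ ≤ R i)
    (hslow : ∀ i, Tendsto (fun n => I.mkHom (x i (n + 1)) - I.mkHom (x i n)) atTop (𝓝 0)) :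
    ∃ X : ℕ → M,
      (∀ i r, 0 ≤ r → AsympLE (fun n => ‖I.mkHom (x i n)‖) r → ‖I.mkHom (X i)‖ ≤ 64 * r) ∧
      (∀ i j k r, 0 ≤ r → AsympLE (fun n => ‖I.mkHom (x i n + x j n - x k n)‖) r →
        ‖I.mkHom (X i) + I.mkHom (X j) - I.mkHom (X k)‖ ≤ 64 * r) ∧
      (∀ i j k r, 0 ≤ r → AsympLE (fun n => ‖I.mkHom (x i n * x j n - x k n)‖) r →
        ‖I.mkHom (X i) * I.mkHom (X j) - I.mkHom (X k)‖ ≤ 64 * r) ∧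
      (∀ i j r, 0 ≤ r → AsympLE (fun n => ‖I.mkHom (star (x i n) - x j n)‖) r →
        ‖star (I.mkHom (X i)) - I.mkHom (X j)‖ ≤ 64 * r) ∧
      (∀ (c : ℂ) i j r, 0 ≤ r → AsympLE (fun n => ‖I.mkHom (c • x i n - x j n)‖) r →
        ‖c • I.mkHom (X i) - I.mkHom (X j)‖ ≤ 64 * r) ∧
      (∀ g, ∀ i ∈ P, ∀ j r, 0 ≤ r → AsympLE (fun n => ‖I.mkHom (β g (x i n) - x j n)‖) r →
        ‖I.mkHom (β g (X i)) - I.mkHom (X j)‖ ≤ 64 * r) ∧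
      (∀ i w, (∀ n, x i n = w) → I.mkHom (X i) = I.mkHom w) ∧
      (∀ i, AsympLE (fun n => ‖I.mkHom (x i n)‖) (2 * ‖I.mkHom (X i)‖)) := by
  classical
  let K : ℕ → Set G := compactCovering G
  have hK : ∀ n, IsCompact (K n) := isCompact_compactCovering G
  -- The range of the second index covers all `m ≤ n + 8`, the window required by `AlmostCommutes`.
  let F : ℕ → Finset M := fun n => Finset.image₂ x (Finset.range (n + 1)) (Finset.range (n + 9))
  have hF : ∀ {n i m}, i ≤ n → m ≤ n + 8 → x i m ∈ F n := fun hi hm =>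
    Finset.mem_image₂_of_mem (Finset.mem_range.2 (by omega)) (Finset.mem_range.2 (by omega))
  obtain ⟨e, he, hC, hcomm, hinv, hlow⟩ := hu.exists_quasicentral hI hβI hβ hK
    (isCompact_testUnion hK hP) F
  have htest : ∀ i j k (w : ℕ → M), (∀ᶠ n in atTop, w n ∈ testSet β K P x n i j k) →
      ∀ᶠ n in atTop, ‖w n - e n * w n‖ ≤ 2 * ‖I.mkHom (w n)‖ + (1 / 2) ^ n := by
    intro i j k w hw
    filter_upwards [eventually_mem_testUnion i j k hw] with n hn
    exact hC n _ hn
  have hAC : ∀ i, AlmostCommutes e (x i) := by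
    intro i
    filter_upwards [eventually_ge_atTop i] with n hn m hm
    exact hcomm n _ (hF hn hm)
  have hSV : ∀ i, SlowlyVarying e (x i) := by
    intro i l hl
    have h1 := htest i i i (fun n => x i (n + l) - x i (n + 2)) (Eventually.of_forall fun n =>
      Or.inl (Or.inr ⟨l, hl, rfl⟩))
    refine squeeze_zero_norm' h1 ?_
    have h2 := ((tendsto_sub_of_tendsto_succ_sub (hslow i) l 2).norm.const_mul 2).add
      (tendsto_pow_atTop_nhds_zero_of_lt_one (r := (1 / 2 : ℝ)) (by norm_num) (by norm_num))
    simpa only [map_sub, norm_zero, mul_zero, add_zero] using h2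
  choose X hX using fun i => exists_isGlue hI he (hR i)
  refine ⟨X, ?_, ?_, ?_, ?_, ?_, ?_, ?_, ?_⟩
  · intro i r hr h
    exact (hX i).norm_mkHom_le_of_asympLE hI he (htest i i i _ (Eventually.of_forall fun n => by
      simp [testSet])) hr h
  · intro i j k r hr h
    rw [← map_add, ← map_sub]
    exact (((hX i).add (hX j)).sub (hX k)).norm_mkHom_le_of_asympLE hI he
      (htest i j k _ (Eventually.of_forall fun n => by simp [testSet])) hr h
  · intro i j k r hr h
    obtain ⟨Z, hZ⟩ := exists_isGlue hI he (x := fun n => x i n * x j n) (R := R i * R j)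
      fun n => (norm_mul_le _ _).trans (mul_le_mul (hR i n) (hR j n) (norm_nonneg _)
        ((norm_nonneg _).trans (hR i n)))
    have h1 := (hX i).mul_sub_mem hI he (hAC i) (hSV i) (hR j) (hX j) hZ
    rw [← map_mul, I.mkHom_eq_mkHom.2 h1, ← map_sub]
    exact (hZ.sub (hX k)).norm_mkHom_le_of_asympLE hI he
      (htest i j k _ (Eventually.of_forall fun n => by simp [testSet])) hr h
  · intro i j r hr h
    obtain ⟨Z, hZ⟩ := exists_isGlue hI he (x := fun n => star (x i n)) (R := R i)
      fun n => (norm_star _).trans_le (hR i n)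
    have h1 := (hX i).star_sub_mem hI he (hAC i) hZ
    rw [← map_star, I.mkHom_eq_mkHom.2 h1, ← map_sub]
    exact (hZ.sub (hX j)).norm_mkHom_le_of_asympLE hI he
      (htest i j j _ (Eventually.of_forall fun n => by simp [testSet])) hr h
  · intro c i j r hr h
    rw [← map_smul, ← map_sub]
    refine (((hX i).const_smul c).sub (hX j)).norm_mkHom_le_of_asympLE hI he
      (htest i j j _ ?_) hr h
    obtain ⟨n₀, hn₀⟩ := exists_nat_ge ‖c‖
    filter_upwards [eventually_ge_atTop n₀] with n hn
    refine Or.inl (Or.inl (Or.inr ⟨c, ?_, rfl⟩))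
    rw [mem_closedBall_zero_iff]
    exact hn₀.trans (by exact_mod_cast hn)
  · intro g i hi j r hr h
    obtain ⟨n₀, hn₀⟩ := exists_mem_compactCovering g
    have hg : ∀ᶠ n in atTop, g ∈ K n := by
      filter_upwards [eventually_ge_atTop n₀] with n hn
      exact compactCovering_subset G hn hn₀
    obtain ⟨Z, hZ⟩ := exists_isGlue hI he (x := fun n => β g (x i n)) (R := R i)
      fun n => (StarAlgEquiv.norm_map (β g) _).trans_le (hR i n)
    have h1 := (hX i).map_sub_mem hI he (β g) (hβI g)
      (fun a ha => by
        have : (β g).symm = β g⁻¹ := (map_inv β g).symm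
        rw [this]
        exact hβI _ a ha)
      (hg.mono fun n hn => hinv n g hn) (hR i) hZ
    -- By asymptotic invariance of `e`, gluing the translates gives the translate of `X i` modulo
    -- `I`. Since `g` lies in `K n` for late `n`, the differences with `x j n` are among the tested
    -- elements.
    rw [I.mkHom_eq_mkHom.2 h1, ← map_sub]
    refine (hZ.sub (hX j)).norm_mkHom_le_of_asympLE hI he (htest i j j _ ?_) hr h
    filter_upwards [hg] with n hn
    exact Or.inr ⟨hi, g, hn, rfl⟩
  · intro i w hw
    have hx : x i = fun _ => w := funext hw
    have h1 := hX i
    have h2 := hAC i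
    rw [hx] at h1 h2
    exact (I.mkHom_eq_mkHom.2 (h1.const_sub_mem hI he h2)).symm
  · intro i ε hε
    have h2 : ∀ᶠ n : ℕ in atTop, ((1 : ℝ) / 2) ^ (n + 2) < ε / 2 :=
      ((tendsto_add_atTop_iff_nat 2).2 (tendsto_pow_atTop_nhds_zero_of_lt_one (by norm_num)
        (by norm_num))).eventually (gt_mem_nhds (by positivity))
    filter_upwards [(hX i).eventually_norm_mul_bump_le he (hAC i) (hSV i) (half_pos hε), h2,
      eventually_ge_atTop i] with n h3 h4 hn
    -- The stage `n + 1` is the one at which the quotient norm is seen through `bump e n`.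
    have h5 := hlow (n + 1) (x i n) (hF (by omega) (by omega))
    have h6 : x i n * (e (n + 1 + 1) - e (n + 1)) = x i n * bump e n := rfl
    rw [h6] at h5
    linarith

end Simultaneous

end CStarIdeal

/-! ### Extension of Lipschitz maps from dense sequences -/

theorem exists_lipschitz_extension {E : Type u} {Q : Type v} [PseudoMetricSpace E] [MetricSpace Q]
    [CompleteSpace Q] {b : ℕ → E} (hb : DenseRange b) {f : ℕ → Q} {C : ℝ} (hC : 0 ≤ C)
    (h : ∀ i j, dist (f i) (f j) ≤ C * dist (b i) (b j)) :
    ∃ φ : E → Q, Continuous φ ∧ ∀ i, φ (b i) = f i := by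
  -- The sequence `b` may have repetitions; the Lipschitz bound makes `f` well defined on its range.
  have hval : ∀ y : Set.range b, ∃ q : Q, ∀ i, b i = y → f i = q := by
    rintro ⟨_, j, rfl⟩
    refine ⟨f j, fun i hi => dist_le_zero.1 ((h i j).trans ?_)⟩
    rw [show b i = b j from hi, dist_self, mul_zero]
  choose f' hf' using hval
  have hLip : LipschitzWith C.toNNReal f' := LipschitzWith.of_dist_le_mul fun y z => by
    obtain ⟨_, i, rfl⟩ := y
    obtain ⟨_, j, rfl⟩ := z
    rw [← hf' ⟨b i, i, rfl⟩ i rfl, ← hf' ⟨b j, j, rfl⟩ j rfl, Real.coe_toNNReal _ hC]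
    exact h i j
  refine ⟨hb.extend f', ?_, fun i => ?_⟩
  · exact (Dense.uniformContinuous_extend hb hLip.uniformContinuous).continuous
  · rw [hf' ⟨b i, i, rfl⟩ i rfl]
    exact Dense.extend_eq hb hLip.continuous ⟨b i, i, rfl⟩

/-! ### The dynamical folding property of quotients of strictly complete algebras -/

theorem asympLE_norm_pathMk {Q : Type u} [NonUnitalCStarAlgebra Q] {t : ℕ → ℝ≥0}
    (ht : Tendsto t atTop atTop) (f : ℝ≥0 →ᵇ Q) :
    AsympLE (fun n => ‖f (t n)‖) ‖pathMk f‖ := fun _ hε =>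
  ht.eventually (eventually_norm_le_norm_pathMk f hε)

/-- Countably many paths representing the values of `ψ` on dense sequences of `B`, of `B₀` and
of `D`, where the paths for elements of `B₀` are constant and those for elements of `D` take values
in the continuous part of the action. -/
theorem exists_dense_paths {G : Type v} [Group G] [TopologicalSpace G] {Q : Type u}
    [NonUnitalCStarAlgebra Q] (γ : AlgAction G Q) {B : Type w} [NonUnitalCStarAlgebra B]
    [TopologicalSpace.SeparableSpace B] (B₀ D : NonUnitalStarSubalgebra ℂ B)
    (ψ : B →⋆ₙₐ[ℂ] PathAlgebra Q) (h₀ : ∀ b ∈ B₀, ψ b ∈ Set.range (pathConst (A := Q)))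
    (hD : ∀ d : D, ψ d ∈ pathSubalgebra γ.continuousPart) :
    ∃ (b : ℕ → B) (F : ℕ → (ℝ≥0 →ᵇ Q)) (b₀ : ℕ → B₀) (d : ℕ → D) (i₀ iD : ℕ → ℕ),
      (∀ i, pathMk (F i) = ψ (b i)) ∧ DenseRange b ∧ DenseRange b₀ ∧ DenseRange d ∧
      (∀ n, b (i₀ n) = b₀ n) ∧ (∀ n, b (iD n) = d n) ∧
      (∀ n, ∃ c, F (i₀ n) = BoundedContinuousFunction.const ℝ≥0 c) ∧
      ∀ n s, F (iD n) s ∈ γ.continuousPart := by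
  have : SecondCountableTopology B := UniformSpace.secondCountable_of_separable B
  choose f hf using fun b : B => CStarIdeal.Quotient.mk_surjective _ (ψ b)
  choose! c hc using h₀
  choose p hpD hp using fun d : D => mem_pathSubalgebra.1 (hD d)
  let k : ℕ ≃ ℕ ⊕ ℕ ⊕ ℕ := (Denumerable.eqv (ℕ ⊕ ℕ ⊕ ℕ)).symm
  -- A dense sequence of `B` may miss `B₀` and `D` altogether, so dense sequences of these are added
  -- separately.
  let b : ℕ ⊕ ℕ ⊕ ℕ → B := Sum.elim (TopologicalSpace.denseSeq B)
    (Sum.elim (fun n => (TopologicalSpace.denseSeq B₀ n : B))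
      (fun n => (TopologicalSpace.denseSeq D n : B)))
  let F : ℕ ⊕ ℕ ⊕ ℕ → (ℝ≥0 →ᵇ Q) := Sum.elim (fun n => f (TopologicalSpace.denseSeq B n))
    (Sum.elim (fun n => BoundedContinuousFunction.const ℝ≥0 (c (TopologicalSpace.denseSeq B₀ n)))
      (fun n => p (TopologicalSpace.denseSeq D n)))
  have hk : ∀ i, k (k.symm i) = i := k.apply_symm_apply
  refine ⟨b ∘ k, F ∘ k, TopologicalSpace.denseSeq B₀, TopologicalSpace.denseSeq D,
    fun n => k.symm (Sum.inr (Sum.inl n)), fun n => k.symm (Sum.inr (Sum.inr n)), fun i => ?_, ?_,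
    TopologicalSpace.denseRange_denseSeq _, TopologicalSpace.denseRange_denseSeq _,
    fun n => by simp only [Function.comp_apply, hk]; rfl,
    fun n => by simp only [Function.comp_apply, hk]; rfl, fun n => ?_, fun n s => ?_⟩
  · simp only [Function.comp_apply]
    rcases k i with n | n | n
    exacts [hf _, hc _ (TopologicalSpace.denseSeq B₀ n).2, hp _]
  · refine (TopologicalSpace.denseRange_denseSeq B).mono ?_
    rintro _ ⟨n, rfl⟩
    exact ⟨k.symm (Sum.inl n), by simp only [Function.comp_apply, hk]; rfl⟩
  · simp only [Function.comp_apply, hk]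
    exact ⟨_, rfl⟩
  · simp only [Function.comp_apply, hk]
    exact hpD _ s

/-- The folded homomorphism sends `b i` to the class of the element glued from lifts of samples of a
path for `ψ (b i)`. All its properties are norm estimates on dense sequences, passed to the limit.
-/
theorem hasDynamicalFoldingProperty_quotient {M : Type u} [CStarAlgebra M] {I : CStarIdeal M}
    {G : Type v} [Group G] [TopologicalSpace G] [IsTopologicalGroup G] [LocallyCompactSpace G]
    [SecondCountableTopology G] {β : AlgAction G M} {u : ℕ → M} (hI : I.StrictlyComplete)
    (hu : I.ApproxUnit u) (hβI : ∀ g, ∀ x ∈ I.toSubspace, β g x ∈ I.toSubspace)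
    (hβ : ∀ a ∈ I.toSubspace, Continuous fun g => β g a) :
    HasDynamicalFoldingProperty.{u, v, w} (β.quotient I hβI) := by
  intro B _ _ B₀ D _ _ δ _ ψ h₀ hδψ hD
  set γ := β.quotient I hβI with hγdef
  have hγ : ∀ g x, γ g (I.mkHom x) = I.mkHom (β g x) := fun g x => rfl
  obtain ⟨b, F, b₀, d, i₀, iD, hF, hb, hb₀, hd, hbi₀, hbiD, hconst, hcont⟩ :=
    exists_dense_paths γ B₀ D ψ h₀ hD
  obtain ⟨t, hmono, htop, ht⟩ := exists_sampling (fun i => F i) fun i => (F i).continuous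
  -- Lifting by a fixed function of the class makes the lifts of a constant path constant; this is
  -- what gives agreement with `ψ` on `B₀`.
  choose σ hσ hσn using fun q : I.Quotient => I.exists_mkHom_eq q one_pos
  let x : ℕ → ℕ → M := fun i n => σ (F i (t n))
  have hx : ∀ i n, I.mkHom (x i n) = F i (t n) := fun i n => hσ _
  -- The classes have continuous orbits by the choice of the paths for `D`; automatic continuity
  -- passes this on to the lifts.
  have hP : ∀ i ∈ Set.range iD, ∀ n, Continuous fun g => β g (x i n) := by
    rintro _ ⟨m, rfl⟩ n
    refine CStarIdeal.continuous_action_of_mkHom hI hu hβI hβ ?_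
    simp only [← hγ, hx]
    exact hcont m (t n)
  have hslow : ∀ i, Tendsto (fun n => I.mkHom (x i (n + 1)) - I.mkHom (x i n)) atTop (𝓝 0) := by
    intro i
    rw [Metric.tendsto_nhds]
    intro ε hε
    filter_upwards [ht i (ε / 2) (half_pos hε)] with n hn
    have := hn (t (n + 1)) (hmono n.le_succ) le_rfl
    rw [dist_zero_right, hx, hx]
    linarith
  obtain ⟨X, hnorm, hadd, hmul, hstar, hsmul, hact, hcst, hlow⟩ :=
    CStarIdeal.exists_simultaneous_glue hI hu hβI hβ hP (R := fun i => ‖F i‖ + 1)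
      (fun i n => (hσn _).le.trans (by gcongr; exact (F i).norm_coe_le_norm _)) hslow
  have hψ : ∀ y, ‖ψ y‖ ≤ ‖y‖ := NonUnitalStarAlgHom.norm_apply_le ψ
  have hasymp : ∀ (f : ℝ≥0 →ᵇ I.Quotient) (y : B) (w : ℕ → M), pathMk f = ψ y →
      (∀ n, I.mkHom (w n) = f (t n)) → AsympLE (fun n => ‖I.mkHom (w n)‖) ‖y‖ := by
    intro f y w hfy hw ε hε
    filter_upwards [asympLE_norm_pathMk htop f ε hε] with n hn
    rw [hw]
    rw [hfy] at hn
    linarith [hψ y]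
  obtain ⟨φ, hφ, hφb⟩ := exists_lipschitz_extension hb (f := fun i => I.mkHom (X i)) (C := 64)
    (by norm_num) fun i j => by
      have := hsmul 1 i j _ (norm_nonneg (b i - b j)) (hasymp (F i - F j) (b i - b j) _
        (by rw [map_sub, map_sub, hF, hF]) fun n => by
          rw [one_smul, map_sub, hx, hx]; rfl)
      rwa [one_smul, ← dist_eq_norm, ← dist_eq_norm] at this
  have hφadd : ∀ y z, φ (y + z) = φ y + φ z := by
    -- The third variable is needed because the sum of two members of the dense sequence need not be
    -- a member. The same device serves for the other operations and for the action.
    have key : ∀ y z v, ‖φ y + φ z - φ v‖ ≤ 64 * ‖y + z - v‖ := by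
      intro y z v
      refine hb.induction_on₃ (p := fun y z v => ‖φ y + φ z - φ v‖ ≤ 64 * ‖y + z - v‖)
        (isClosed_le (by fun_prop) (by fun_prop)) (fun i j k => ?_) y z v
      rw [hφb, hφb, hφb]
      exact hadd i j k _ (norm_nonneg _) (hasymp (F i + F j - F k) _ _
        (by rw [map_sub, map_sub, map_add, map_add, hF, hF, hF]) fun n => by
          rw [map_sub, map_add, hx, hx, hx]; rfl)
    intro y z
    have := key y z (y + z)
    rw [sub_self, norm_zero, mul_zero, norm_le_zero_iff, sub_eq_zero] at this
    exact this.symm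
  have hφmul : ∀ y z, φ (y * z) = φ y * φ z := by
    have key : ∀ y z v, ‖φ y * φ z - φ v‖ ≤ 64 * ‖y * z - v‖ := by
      intro y z v
      refine hb.induction_on₃ (p := fun y z v => ‖φ y * φ z - φ v‖ ≤ 64 * ‖y * z - v‖)
        (isClosed_le (by fun_prop) (by fun_prop)) (fun i j k => ?_) y z v
      rw [hφb, hφb, hφb]
      exact hmul i j k _ (norm_nonneg _) (hasymp (F i * F j - F k) _ _
        (by rw [map_sub, map_sub, map_mul, map_mul, hF, hF, hF]) fun n => by
          rw [map_sub, map_mul, hx, hx, hx]; rfl)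
    intro y z
    have := key y z (y * z)
    rw [sub_self, norm_zero, mul_zero, norm_le_zero_iff, sub_eq_zero] at this
    exact this.symm
  have hφstar : ∀ y, φ (star y) = star (φ y) := by
    have key : ∀ y z, ‖star (φ y) - φ z‖ ≤ 64 * ‖star y - z‖ := by
      intro y z
      refine hb.induction_on₂ (p := fun y z => ‖star (φ y) - φ z‖ ≤ 64 * ‖star y - z‖)
        (isClosed_le (by fun_prop) (by fun_prop)) (fun i j => ?_) y z
      rw [hφb, hφb]
      exact hstar i j _ (norm_nonneg _) (hasymp (star (F i) - F j) _ _
        (by rw [map_sub, map_sub, map_star, map_star, hF, hF]) fun n => by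
          rw [map_sub, map_star, hx, hx]; rfl)
    intro y
    have := key y (star y)
    rw [sub_self, norm_zero, mul_zero, norm_le_zero_iff, sub_eq_zero] at this
    exact this.symm
  have hφsmul : ∀ (c : ℂ) y, φ (c • y) = c • φ y := by
    intro c
    have key : ∀ y z, ‖c • φ y - φ z‖ ≤ 64 * ‖c • y - z‖ := by
      intro y z
      refine hb.induction_on₂ (p := fun y z => ‖c • φ y - φ z‖ ≤ 64 * ‖c • y - z‖)
        (isClosed_le (by fun_prop) (by fun_prop)) (fun i j => ?_) y z
      rw [hφb, hφb]
      exact hsmul c i j _ (norm_nonneg _) (hasymp (c • F i - F j) _ _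
        (by rw [map_sub, map_sub, map_smul, map_smul, hF, hF]) fun n => by
          rw [map_sub, map_smul, hx, hx]; rfl)
    intro y
    have := key y (c • y)
    rw [sub_self, norm_zero, mul_zero, norm_le_zero_iff, sub_eq_zero] at this
    exact this.symm
  have hφact : ∀ g (y : D), φ (δ g y) = γ g (φ y) := by
    intro g
    have hγc : Continuous (γ g) := AddMonoidHomClass.continuous_of_bound (γ g) 1 fun y => by
      rw [StarAlgEquiv.norm_map, one_mul]
    have hδc : Continuous (δ g) := AddMonoidHomClass.continuous_of_bound (δ g) 1 fun y => by
      rw [StarAlgEquiv.norm_map, one_mul]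
    have key : ∀ y z : D, ‖γ g (φ y) - φ z‖ ≤ 64 * ‖((δ g y : D) : B) - z‖ := by
      intro y z
      refine hd.induction_on₂ (p := fun y z : D => ‖γ g (φ y) - φ z‖ ≤ 64 * ‖((δ g y : D) : B) - z‖)
        (isClosed_le (by fun_prop) (by fun_prop)) (fun m n => ?_) y z
      rw [← hbiD, ← hbiD, hφb, hφb, hγ]
      refine hact g (iD m) ⟨m, rfl⟩ (iD n) _ (norm_nonneg _)
        (hasymp (boundedPathAction γ g (F (iD m)) - F (iD n)) _ _ ?_ fun k => ?_)
      · rw [map_sub, map_sub, ← pathAction_mk, hF, hF, hδψ, hbiD]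
      · rw [map_sub, ← hγ, hx, hx]; rfl
    intro y
    have := key y (δ g y)
    rw [sub_self, norm_zero, mul_zero, norm_le_zero_iff, sub_eq_zero] at this
    exact this.symm
  have hψc : Continuous ψ := AddMonoidHomClass.continuous_of_bound ψ 1 fun y => by
    rw [one_mul]; exact hψ y
  have hupper : ∀ y, ‖φ y‖ ≤ 64 * ‖ψ y‖ := by
    refine fun y => hb.induction_on (p := fun y => ‖φ y‖ ≤ 64 * ‖ψ y‖) y
      (isClosed_le (by fun_prop) (by fun_prop)) fun i => ?_
    rw [hφb]
    refine hnorm i _ (norm_nonneg _) ?_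
    simp only [hx, ← hF]
    exact asympLE_norm_pathMk htop (F i)
  -- The norm of the class of a path is controlled by its values at all late times, hence, by slow
  -- sampling, by its values at the times `t n`. Together with `hupper` this identifies the kernels.
  have hlower : ∀ y, ‖ψ y‖ ≤ 2 * ‖φ y‖ := by
    refine fun y => hb.induction_on (p := fun y => ‖ψ y‖ ≤ 2 * ‖φ y‖) y
      (isClosed_le (by fun_prop) (by fun_prop)) fun i => ?_
    rw [hφb, ← hF]
    refine le_of_forall_pos_le_add fun ε hε => norm_pathMk_le_of_eventually (by positivity) ?_
    have h1 := hlow i (ε / 2) (half_pos hε)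
    simp only [hx] at h1
    filter_upwards [eventually_norm_le_of_sampling htop (ht i (ε / 2) (half_pos hε)) h1] with s hs
    linarith
  refine ⟨{ toFun := φ
            map_smul' := hφsmul
            map_zero' := by simpa using hφsmul 0 0
            map_add' := hφadd
            map_mul' := hφmul
            map_star' := hφstar }, ?_, hφact, fun y => ⟨fun h => ?_, fun h => ?_⟩⟩
  · have hpc : Continuous (pathConst (A := I.Quotient)) :=
      AddMonoidHomClass.continuous_of_bound pathConst 1 fun y => by
        rw [one_mul, norm_pathConst]
    intro y hy
    change pathConst (φ y) = ψ y
    refine hb₀.induction_on (p := fun y : B₀ => pathConst (φ y) = ψ y) ⟨y, hy⟩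
      (isClosed_eq (by fun_prop) (by fun_prop)) fun n => ?_
    obtain ⟨c, hc⟩ := hconst n
    have h1 : I.mkHom (X (i₀ n)) = c := by
      rw [hcst (i₀ n) (σ c) fun m => by simp only [x, hc]; rfl]
      exact hσ c
    rw [← hbi₀, hφb, h1, ← hF, hc]
    rfl
  · have h1 := hlower y
    rw [show φ y = 0 from h, norm_zero, mul_zero, norm_le_zero_iff] at h1
    exact h1
  · have h1 := hupper y
    rw [h, norm_zero, mul_zero, norm_le_zero_iff] at h1
    exact h1

/-! ### Multiplier algebras are strictly complete -/

section Multiplier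

variable {A : Type u} [NonUnitalCStarAlgebra A]

theorem mul_coeHom (x : 𝓜(ℂ, A)) (a : A) :
    x * DoubleCentralizer.coeHom (𝕜 := ℂ) a = DoubleCentralizer.coeHom (𝕜 := ℂ) (x.fst a) := by
  refine DoubleCentralizer.ext ℂ A _ _ (Prod.ext ?_ ?_)
  · ext b
    exact fst_mul x a b
  · ext b
    exact x.central b a

theorem coeHom_mul (x : 𝓜(ℂ, A)) (a : A) :
    DoubleCentralizer.coeHom (𝕜 := ℂ) a * x = DoubleCentralizer.coeHom (𝕜 := ℂ) (x.snd a) := by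
  refine DoubleCentralizer.ext ℂ A _ _ (Prod.ext ?_ ?_)
  · ext b
    exact (x.central a b).symm
  · ext b
    exact snd_mul x b a

theorem isometry_coeHom : Isometry (DoubleCentralizer.coeHom (𝕜 := ℂ) (A := A)) :=
  AddMonoidHomClass.isometry_of_norm _ (norm_coe_multiplier A)

theorem mem_multiplierIdeal {x : 𝓜(ℂ, A)} :
    x ∈ (multiplierIdeal A).toSubspace ↔ ∃ a, DoubleCentralizer.coeHom (𝕜 := ℂ) a = x := Iff.rfl

theorem norm_multiplier_le {x : 𝓜(ℂ, A)} {R : ℝ} (hR : 0 ≤ R)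
    (h : ∀ a : A, ‖a‖ ≤ 1 → ‖x.fst a‖ ≤ R) : ‖x‖ ≤ R := by
  rw [← DoubleCentralizer.norm_fst]
  refine ContinuousLinearMap.opNorm_le_bound _ hR fun a => ?_
  rcases eq_or_ne a 0 with rfl | ha
  · simp
  · have h0 : (0 : ℝ) < ‖a‖ := norm_pos_iff.2 ha
    have h1 := h (((‖a‖⁻¹ : ℝ) : ℂ) • a) (by
      rw [norm_smul, Complex.norm_real, norm_inv, norm_norm, inv_mul_cancel₀ h0.ne'])
    rw [map_smul, norm_smul, Complex.norm_real, norm_inv, norm_norm, inv_mul_le_iff₀ h0] at h1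
    rwa [mul_comm]

/-- Pointwise limits of uniformly bounded operators are bounded, and the centrality relation passes
to the limit. -/
theorem exists_multiplier_limit (S : ℕ → 𝓜(ℂ, A)) {R : ℝ} (hR : ∀ n, ‖S n‖ ≤ R)
    (h1 : ∀ a : A, CauchySeq fun n => (S n).fst a) (h2 : ∀ a : A, CauchySeq fun n => (S n).snd a) :
    ∃ x : 𝓜(ℂ, A), ∀ a, Tendsto (fun n => (S n).fst a) atTop (𝓝 (x.fst a)) ∧
      Tendsto (fun n => (S n).snd a) atTop (𝓝 (x.snd a)) := by
  choose L hL using fun a => cauchySeq_tendsto_of_complete (h1 a)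
  choose L' hL' using fun a => cauchySeq_tendsto_of_complete (h2 a)
  have mk : ∀ (T : ℕ → A →L[ℂ] A) (l : A → A), (∀ n, ‖T n‖ ≤ R) →
      (∀ a, Tendsto (fun n => T n a) atTop (𝓝 (l a))) → ∃ l' : A →L[ℂ] A, ∀ a, l' a = l a := by
    intro T l hT hl
    refine ⟨LinearMap.mkContinuous
      { toFun := l
        map_add' := fun a b => tendsto_nhds_unique (hl (a + b))
          (by simpa only [map_add] using (hl a).add (hl b))
        map_smul' := fun c a => tendsto_nhds_unique (hl (c • a))
          (by simpa only [map_smul, RingHom.id_apply] using (hl a).const_smul c) } R fun a => ?_, fun a => rfl⟩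
    refine le_of_tendsto (hl a).norm (Eventually.of_forall fun n => ?_)
    exact (T n).le_of_opNorm_le (hT n) a
  obtain ⟨f, hf⟩ := mk (fun n => (S n).fst) L
    (fun n => (DoubleCentralizer.norm_fst (S n)).trans_le (hR n)) hL
  obtain ⟨f', hf'⟩ := mk (fun n => (S n).snd) L'
    (fun n => (DoubleCentralizer.norm_snd (S n)).trans_le (hR n)) hL'
  refine ⟨{ fst := f, snd := f', central := fun a b => ?_ }, fun a => ⟨?_, ?_⟩⟩
  · rw [hf, hf']
    exact tendsto_nhds_unique ((hL' a).mul_const b)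
      (((hL b).const_mul a).congr fun n => ((S n).central a b).symm)
  · simpa only [hf] using hL a
  · simpa only [hf'] using hL' a

theorem strictlyComplete_multiplierIdeal : (multiplierIdeal A).StrictlyComplete where
  norm_le x R hR h := norm_multiplier_le hR fun a ha => by
    have h1 := h _ (mem_multiplierIdeal.2 ⟨a, rfl⟩) (by rwa [norm_coe_multiplier])
    rwa [mul_coeHom, norm_coe_multiplier] at h1
  exists_limit S hS h1 h2 := by
    obtain ⟨R, hR⟩ := hS
    obtain ⟨x, hx⟩ := exists_multiplier_limit S hR
      (fun a => by
        have := h1 _ (mem_multiplierIdeal.2 ⟨a, rfl⟩)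
        simp only [mul_coeHom] at this
        rw [CauchySeq, ← isometry_coeHom.isUniformInducing.cauchy_map_iff, map_map]
        exact this)
      (fun a => by
        have := h2 _ (mem_multiplierIdeal.2 ⟨a, rfl⟩)
        simp only [coeHom_mul] at this
        rw [CauchySeq, ← isometry_coeHom.isUniformInducing.cauchy_map_iff, map_map]
        exact this)
    refine ⟨x, ?_⟩
    rintro _ ⟨a, rfl⟩
    have hc := (isometry_coeHom (A := A)).continuous
    constructor
    · have := (hc.tendsto _).comp (hx a).1
      rw [← mul_coeHom] at this
      exact this.congr fun n => (mul_coeHom (S n) a).symm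
    · have := (hc.tendsto _).comp (hx a).2
      rw [← coeHom_mul] at this
      exact this.congr fun n => (coeHom_mul (S n) a).symm

theorem exists_approxUnit_multiplierIdeal (hA : IsSigmaUnital A) :
    ∃ u, (multiplierIdeal A).ApproxUnit u := by
  obtain ⟨e, hpos, hnorm, hl, -⟩ := hA
  refine CStarIdeal.exists_approxUnit (fun n => DoubleCentralizer.coeHom (𝕜 := ℂ) (e n))
    (fun n => mem_multiplierIdeal.2 ⟨_, rfl⟩) (fun n => ?_)
    (fun n => (norm_coe_multiplier A _).trans_le (hnorm n)) ?_
  · obtain ⟨b, hb⟩ := hpos n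
    exact ⟨DoubleCentralizer.coeHom (𝕜 := ℂ) b, by rw [hb, map_mul, map_star]⟩
  · rintro _ ⟨a, rfl⟩
    exact (((isometry_coeHom (A := A)).continuous.tendsto _).comp (hl a)).congr fun n =>
      map_mul _ (e n) a

end Multiplier

end DynFolding

theorem theorem2p9 {G : Type v} [Group G] [TopologicalSpace G] [IsTopologicalGroup G]
    [LocallyCompactSpace G] [SecondCountableTopology G]
    {A : Type u} [NonUnitalCStarAlgebra A] (hA : DynFolding.IsSigmaUnital A)
    (α : DynFolding.AlgAction G A) (hα : α.IsContinuous) :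
    DynFolding.HasDynamicalFoldingProperty.{u, v, w} (DynFolding.coronaAction α) := by
  obtain ⟨u, hu⟩ := DynFolding.exists_approxUnit_multiplierIdeal hA
  refine DynFolding.hasDynamicalFoldingProperty_quotient
    DynFolding.strictlyComplete_multiplierIdeal hu _ ?_
  rintro _ ⟨a, rfl⟩
  exact ((DynFolding.isometry_coeHom (A := A)).continuous.comp (hα a)).congr fun g =>
    (DynFolding.multiplierAction_coe α g a).symm
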